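/- Let $N\ge 2$, $T>0$, let $\Omega\subset\mathbb R^N$ be a bounded open set with smooth boundary, $Y=(0,1)^N$, let $Y^H\subset Y$ be compact with smooth boundary and such that $Y^*=Y\setminus Y^H$ is connected, and let $E_\sharp(Y^*)=\mathbb R^N\setminus\bigcup_{k\in\mathbb Z^N}(k+Y^H)$ be the periodic extension of $Y^*$. For $\varepsilon>0$ let $$\Omega_\varepsilon=\{x\in\Omega : x/\varepsilon\in E_\sharp(Y^*)\}\cup\bigcup\{\,\varepsilon(k+Y)\cap\Omega : k\in\mathbb Z^N,\ \varepsilon(k+Y)\cap\partial\Omega\neq\varnothing\,\},$$ that is, $\Omega$ is perforated by the holes $\varepsilon(k+Y^H)$ of exactly those cells $\varepsilon(k+Y)$ that do not meet $\partial\Omega$. Let $\varepsilon$ run through a sequence of positive numbers tending to $0$, let $\{u_\varepsilon\}$ be bounded in $L^2(0,T;H^1(\Omega_\varepsilon))$, and assume that for some $r>0$ $$\varepsilon^r\int_0^T\!\!\int_{\Omega_\varepsilon}u_\varepsilon(x,t)\,v_1(x)\,\partial_t\Bigl(c_1(t)\,c_2\bigl(\tfrac{t}{\varepsilon^r}\bigr)\Bigr)\,dx\,dt\to0$$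 for all $v_1\in C_c^\infty(\Omega)$, all $c_1\in C_c^\infty(0,T)$ and all $1$-periodic $c_2\in C^\infty(\mathbb R)$. Then there are a subsequence (still denoted by $\varepsilon$), a function $u\in L^2(0,T;H^1(\Omega))$ and a function $u_1\in L^2(\Omega\times(0,T)\times(0,1);H^1_\sharp(Y^*)/\mathbb R)$ such that $$\int_0^T\!\!\int_{\Omega_\varepsilon}\nabla u_\varepsilon(x,t)\cdot v\bigl(x,t,\tfrac x\varepsilon,\tfrac t{\varepsilon^r}\bigr)\,dx\,dt\to\int_0^T\!\!\int_\Omega\int_0^1\!\!\int_{Y^*}\bigl(\nabla u(x,t)+\nabla_yu_1(x,t,y,s)\bigr)\cdot v(x,t,y,s)\,dy\,ds\,dx\,dt$$ for every $v\in L^2(\Omega\times(0,T);C_\sharp(Y\times(0,1)))^N$. Here $C_\sharp(Y\times(0,1))$ is the space of continuous functions of $(y,s)\in\mathbb R^N\times\mathbb R$ that are $1$-periodic in each variable, with the supremum norm, and $H^1_\sharp(Y^*)/\mathbb R$ is the space of functions on $E_\sharp(Y^*)$ that are $\mathbb Z^N$-periodic, have a weak gradient, belong with it to $L^2(Y^*)$,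 and have mean zero over $Y^*$. -/

import Mathlib

open MeasureTheory Filter Set
open scoped Topology ContDiff NNReal ENNReal BoundedContinuousFunction

namespace Perforated

/-- The Euclidean space `ℝ^N`. -/
abbrev Euc (N : ℕ) : Type := EuclideanSpace ℝ (Fin N)

/-- The lattice vector in `ℝ^N` with integer coordinates `k`. -/
noncomputable def latticeVec {N : ℕ} (k : Fin N → ℤ) : Euc N :=
  WithLp.toLp 2 (fun i => (k i : ℝ))

/-- The open unit cube `Y = (0,1)^N`. -/
def unitCell (N : ℕ) : Set (Euc N) := {y | ∀ i, y i ∈ Ioo (0 : ℝ) 1}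

/-- `Y* = Y \ Y^H`, the unit cube without the hole `Y^H`. -/
def cellStar {N : ℕ} (YH : Set (Euc N)) : Set (Euc N) := unitCell N \ YH

/-- `E_♯(Y*)`, the periodic extension of `Y*` to `ℝ^N`: the complement of all integer translates of
the hole. The common faces of neighbouring cells belong to it. -/
def perStar {N : ℕ} (YH : Set (Euc N)) : Set (Euc N) :=
  {y | ∀ k : Fin N → ℤ, y - latticeVec k ∉ YH}

/-- The open cube `ε (k + Y)` of side length `ε`. -/
def epsCell {N : ℕ} (ε : ℝ) (k : Fin N → ℤ) : Set (Euc N) :=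
  {x | ε⁻¹ • x - latticeVec k ∈ unitCell N}

/-- The perforated domain `Ω_ε`: the points `x` of `Ω` with `x/ε ∈ E_♯(Y*)`, together with all
points of `Ω` in cells that meet `∂Ω`. Thus the cells that meet `∂Ω` carry no hole. -/
def perforated {N : ℕ} (Ω YH : Set (Euc N)) (ε : ℝ) : Set (Euc N) :=
  {x ∈ Ω | ε⁻¹ • x ∈ perStar YH} ∪
    {x ∈ Ω | ∃ k : Fin N → ℤ, x ∈ epsCell ε k ∧ (epsCell ε k ∩ frontier Ω).Nonempty}

/-- The boundary of `A` is a smooth hypersurface with `A` locally on one side of it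
(meaningful for open as well as for closed `A`). -/
def HasSmoothBoundary {N : ℕ} (A : Set (Euc N)) : Prop :=
  ∀ x ∈ frontier A, ∃ V : Set (Euc N), IsOpen V ∧ x ∈ V ∧ ∃ ρ : Euc N → ℝ,
    ContDiffOn ℝ ∞ ρ V ∧ (∀ y ∈ V, fderiv ℝ ρ y ≠ 0) ∧
    interior A ∩ V = {y ∈ V | ρ y < 0} ∧ closure A ∩ V = {y ∈ V | ρ y ≤ 0}

/-- `D(U)`: smooth real functions with compact support contained in `U`. -/
structure IsTestFun {F : Type*} [NormedAddCommGroup F] [NormedSpace ℝ F]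
    (U : Set F) (φ : F → ℝ) : Prop where
  smooth : ContDiff ℝ ∞ φ
  compact : HasCompactSupport φ
  support_subset : tsupport φ ⊆ U

/-- `g` is the weak gradient of `f` on the open set `U`. -/
structure IsWeakGradient {N : ℕ} (U : Set (Euc N)) (f : Euc N → ℝ) (g : Euc N → Euc N) :
    Prop where
  locInt_fun : LocallyIntegrableOn f U
  locInt_grad : LocallyIntegrableOn g U
  integral_eq : ∀ φ : Euc N → ℝ, IsTestFun U φ →
    ∫ x in U, f x • gradient φ x = - ∫ x in U, φ x • g x

/-- `w ∈ L²(P, μ; H¹(U))`, with (slicewise) weak gradient `g`. -/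
structure MemL2H1 {N : ℕ} {P : Type*} [MeasurableSpace P] (μ : Measure P) (U : Set (Euc N))
    (w : P → Euc N → ℝ) (g : P → Euc N → Euc N) : Prop where
  memLp_fun : MemLp (Function.uncurry w) 2 (μ.prod (volume.restrict U))
  memLp_grad : MemLp (Function.uncurry g) 2 (μ.prod (volume.restrict U))
  weakGradient : ∀ᵐ p ∂μ, IsWeakGradient U (w p) (g p)

/-- `w ∈ L²(P, μ; H¹_♯(Y*)/ℝ)`, with (slicewise) weak gradient `g`: for almost every parameter the
function `w p` is periodic, has a weak gradient on `E_♯(Y*)` and has mean zero over `Y*`, and the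
`H¹(Y*)`-norm is square integrable with respect to the parameter. -/
structure MemL2H1PerZeroMean {N : ℕ} {P : Type*} [MeasurableSpace P] (μ : Measure P)
    (YH : Set (Euc N)) (w : P → Euc N → ℝ) (g : P → Euc N → Euc N) : Prop where
  memLp_fun : MemLp (Function.uncurry w) 2 (μ.prod (volume.restrict (cellStar YH)))
  memLp_grad : MemLp (Function.uncurry g) 2 (μ.prod (volume.restrict (cellStar YH)))
  periodic : ∀ᵐ p ∂μ, ∀ (k : Fin N → ℤ) (y : Euc N), w p (y + latticeVec k) = w p y
  weakGradient : ∀ᵐ p ∂μ, IsWeakGradient (perStar YH) (w p) (g p)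
  zeroMean : ∀ᵐ p ∂μ, ∫ y in cellStar YH, w p y = 0

/-- `v ∈ L²(Ω × (0,T); C_♯(Y × (0,1)))^N`: a square integrable (Bochner) function of `(x,t)` whose
values are continuous vector fields in `(y,s)`, periodic with respect to the unit cell, with the
supremum norm. -/
structure IsAdmissible {N : ℕ} (Ω : Set (Euc N)) (T : ℝ)
    (v : Euc N × ℝ → (Euc N × ℝ) →ᵇ Euc N) : Prop where
  memLp : MemLp v 2 (volume.restrict (Ω ×ˢ Ioo 0 T))
  periodic : ∀ᵐ p ∂(volume.restrict (Ω ×ˢ Ioo 0 T)),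
    ∀ (k : Fin N → ℤ) (m : ℤ) (y : Euc N) (s : ℝ), v p (y + latticeVec k, s + m) = v p (y, s)

end Perforated

open Perforated

/-!
The proof uses neither extension operators nor strong compactness in `L²`; it is a chain of weak limits
and orthogonality arguments.

Extend the pairs `(u_ε, ∇u_ε)` by zero from `Ω_ε × (0,T)` to `ℝ^N × ℝ`. Composition with the
measure preserving map `((x,t,s),y) ↦ (ε([x/ε] + y), ε^r([t/ε^r] + s))` (`unfolding`) turns them
into a bounded sequence in `L²` of the variables `(x,t,s,y)`, a subsequence of which converges
weakly to some `Z = (U, W)` (`exists_isTwoScaleLimit`). Continuous test fields, and hence all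
admissible ones, converge strongly under this composition (`tendsto_admissible`), so that the
limit in the theorem is the integral of `W · v`. In the holes `Z` vanishes, because the cell of a
fixed point of `Ω` does not meet `∂Ω` once `ε` is small. It remains to show that
`W = ∇u + ∇_y u₁` on `Y*`.

Weak differentiability of periodic functions on `Y*` is encoded as orthogonality of the pair
`(w, ∇w)` to the set `cellTests` of pairs `(∂_e η, η e)`, where `η` is smooth, periodic and
supported away from the holes (`isWeakGradient_perExt`). The equations for `u_ε`, tested with
`φ(x) η(x/ε) c₁(t) c₂(t/ε^r)`, say that for every `ε` the pair
`c₁ c₂ (φ u_ε / ε, φ ∇u_ε + u_ε ∇φ)` is orthogonal to `cellTests`, after integration over the other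
variables. Three consequences are drawn.

* Multiplied by `ε`, the limit of this relation says that `U` has `y`-gradient zero on the connected
  set `Y*`. The assumption on the oscillations in time says the same about the derivative in `s`.
  Thus `U = u(x,t)` (`exists_slow_limit`).
* Call a field on `Y*` solenoidal if it is orthogonal to the gradients of all periodic `H¹`
  functions on `Y*`. The relation holds for these too, and there the term with `1/ε` is absent;
  its limit is `∫ φ θ · W + u ∇φ · θ = 0` (`integral_lim_solenoidal`). As `N ≥ 2`, for each `i` there
  is a solenoidal field `η e_i` of nonzero mean that avoids the hole: take for `η` a function of
  another coordinate, supported near the faces of the cube. This exhibits the weak gradient of `u`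
  as a weighted mean of `W` (`exists_slow_gradient`).
* Subtracting `∇u`, one finds that `W - ∇u` is orthogonal to all products of functions of `(x,t,s)`
  with solenoidal fields. By the Poincaré inequality on `Y*` the gradients form a closed subspace of
  `L²`, also with parameters, so that `W - ∇u` is the `y`-gradient of a function `u₁` of mean zero
  (`exists_corrector`).

The Poincaré inequality (`poincare`) is proved on a ball by averaging translation estimates, and is
then carried to the whole of `Y*` by translations: every point of the closure of `Y*` has a
neighbourhood that is pushed into `Y*` along a short vector. This is the only use of the smoothness
of the boundary of the hole. Statements on functions of several groups of variables are
reduced to the individual groups by `Determining.prod` (products of determining classes are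
determining) and `ae_forall_integral_inner_slice_eq_zero` (orthogonality to products passes to
almost every slice).
-/

namespace Perforated

/-! ### Square integrable functions: pairings, weak limits, dominated convergence -/

section LTwo

variable {α β E : Type*} [MeasurableSpace α] [MeasurableSpace β] {μ : Measure α} {ν : Measure β}
  [NormedAddCommGroup E] [InnerProductSpace ℝ E]

theorem inner_toLp_eq_integral {f g : α → E} (hf : MemLp f 2 μ) (hg : MemLp g 2 μ) :
    inner ℝ (hf.toLp f) (hg.toLp g) = ∫ x, inner ℝ (f x) (g x) ∂μ := by
  rw [L2.inner_def]
  apply integral_congr_ae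
  filter_upwards [hf.coeFn_toLp, hg.coeFn_toLp] with x h1 h2
  rw [h1, h2]

theorem integrable_inner_of_memLp {f g : α → E} (hf : MemLp f 2 μ) (hg : MemLp g 2 μ) :
    Integrable (fun x => (inner ℝ (f x) (g x) : ℝ)) μ := by
  refine (L2.integrable_inner (𝕜 := ℝ) (hf.toLp f) (hg.toLp g)).congr ?_
  filter_upwards [hf.coeFn_toLp, hg.coeFn_toLp] with x h1 h2
  rw [h1, h2]

theorem integrable_smul_of_memLp {F : Type*} [NormedAddCommGroup F] [NormedSpace ℝ F] {f : α → ℝ}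
    {g : α → F} (hf : MemLp f 2 μ) (hg : MemLp g 2 μ) : Integrable (fun x => f x • g x) μ :=
  memLp_one_iff_integrable.1 (hg.smul hf)

theorem abs_integral_inner_le {f g : α → E} (hf : MemLp f 2 μ) (hg : MemLp g 2 μ) :
    |∫ x, inner ℝ (f x) (g x) ∂μ| ≤ (eLpNorm f 2 μ).toReal * (eLpNorm g 2 μ).toReal := by
  rw [← inner_toLp_eq_integral hf hg, ← Lp.norm_toLp f hf, ← Lp.norm_toLp g hg]
  exact abs_real_inner_le_norm _ _

theorem sq_toReal_eLpNorm_two {f : α → E} (hf : MemLp f 2 μ) :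
    (eLpNorm f 2 μ).toReal ^ 2 = ∫ x, inner ℝ (f x) (f x) ∂μ := by
  rw [← inner_toLp_eq_integral hf hf, ← Lp.norm_toLp f hf, real_inner_self_eq_norm_sq]

theorem eLpNorm_two_sq {F : Type*} [NormedAddCommGroup F] (f : α → F) :
    eLpNorm f 2 μ ^ 2 = ∫⁻ x, ‖f x‖ₑ ^ 2 ∂μ := by
  rw [eLpNorm_eq_lintegral_rpow_enorm_toReal (by norm_num) (by norm_num), ← ENNReal.rpow_natCast,
    ← ENNReal.rpow_mul]
  norm_num

theorem ae_eq_zero_of_integral_inner_self {f : α → E} (hf : MemLp f 2 μ)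
    (h : ∫ x, inner ℝ (f x) (f x) ∂μ = 0) : f =ᵐ[μ] 0 := by
  rw [← sq_toReal_eLpNorm_two hf] at h
  have h1 : (eLpNorm f 2 μ).toReal = 0 := by simpa using h
  have h2 : eLpNorm f 2 μ = 0 := by
    rcases (ENNReal.toReal_eq_zero_iff _).1 h1 with h | h
    · exact h
    · exact absurd h hf.2.ne
  exact (eLpNorm_eq_zero_iff hf.1 (by norm_num)).1 h2

/-- Bounded sequences of `L²` have weakly convergent subsequences. -/
theorem exists_weak_limit [CompleteSpace E] [TopologicalSpace.SeparableSpace E]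
    [MeasureTheory.IsSeparable μ] (f : ℕ → α → E) (C : ℝ≥0) (hf : ∀ n, MemLp (f n) 2 μ)
    (hC : ∀ n, eLpNorm (f n) 2 μ ≤ C) :
    ∃ φ : ℕ → ℕ, StrictMono φ ∧ ∃ Z : α → E, MemLp Z 2 μ ∧ ∀ q : α → E, MemLp q 2 μ →
      Tendsto (fun j => ∫ x, inner ℝ (f (φ j) x) (q x) ∂μ) atTop
        (𝓝 (∫ x, inner ℝ (Z x) (q x) ∂μ)) := by
  have : Fact ((2 : ℝ≥0∞) ≠ ⊤) := ⟨by norm_num⟩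
  let F : ℕ → Lp E 2 μ := fun n => (hf n).toLp (f n)
  let D : ℕ → WeakDual ℝ (Lp E 2 μ) := fun n =>
    WeakDual.toStrongDual.symm (InnerProductSpace.toDual ℝ _ (F n))
  have hD : ∀ n, D n ∈ WeakDual.toStrongDual ⁻¹'
      Metric.closedBall (0 : StrongDual ℝ (Lp E 2 μ)) (C : ℝ) := by
    intro n
    simp only [mem_preimage, D]
    rw [LinearEquiv.apply_symm_apply]
    have h1 : ‖InnerProductSpace.toDual ℝ (Lp E 2 μ) (F n)‖ ≤ C := by
      rw [LinearIsometryEquiv.norm_map, Lp.norm_toLp]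
      exact ENNReal.toReal_le_coe_of_le_coe (hC n)
    rw [Metric.mem_closedBall]
    exact (dist_zero_right _).trans_le h1
  obtain ⟨d, -, φ, hφ, hlim⟩ := WeakDual.isSeqCompact_closedBall ℝ (Lp E 2 μ) 0 (C : ℝ) hD
  let Z : Lp E 2 μ := (InnerProductSpace.toDual ℝ _).symm (WeakDual.toStrongDual d)
  refine ⟨φ, hφ, Z, Lp.memLp Z, fun q hq => ?_⟩
  have h1 := ((WeakDual.eval_continuous (hq.toLp q)).tendsto d).comp hlim
  have h2 : d (hq.toLp q) = ∫ x, inner ℝ (Z x) (q x) ∂μ := by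
    have : d (hq.toLp q) = inner ℝ Z (hq.toLp q) := by
      simp only [Z]
      rw [InnerProductSpace.toDual_symm_apply]; rfl
    rw [this, L2.inner_def]
    apply integral_congr_ae
    filter_upwards [hq.coeFn_toLp] with x h1
    rw [h1]
  rw [← h2]
  refine h1.congr fun j => ?_
  rw [← inner_toLp_eq_integral (hf _) hq]
  rfl

/-- The pairing of a weakly convergent bounded sequence with a strongly convergent one converges. -/
theorem tendsto_integral_inner {f : ℕ → α → E} {Z : α → E} {C : ℝ≥0} {q : ℕ → α → E} {q₀ : α → E}
    (hf : ∀ n, MemLp (f n) 2 μ) (hC : ∀ n, eLpNorm (f n) 2 μ ≤ C)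
    (hw : ∀ q : α → E, MemLp q 2 μ → Tendsto (fun j => ∫ x, inner ℝ (f j x) (q x) ∂μ) atTop
        (𝓝 (∫ x, inner ℝ (Z x) (q x) ∂μ)))
    (hq : ∀ n, MemLp (q n) 2 μ) (hq₀ : MemLp q₀ 2 μ)
    (hlim : Tendsto (fun n => eLpNorm (fun x => q n x - q₀ x) 2 μ) atTop (𝓝 0)) :
    Tendsto (fun j => ∫ x, inner ℝ (f j x) (q j x) ∂μ) atTop
        (𝓝 (∫ x, inner ℝ (Z x) (q₀ x) ∂μ)) := by
  have h1 : Tendsto (fun j => ∫ x, inner ℝ (f j x) (q j x - q₀ x) ∂μ) atTop (𝓝 0) := by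
    have h2 : Tendsto (fun n => (C : ℝ) * (eLpNorm (fun x => q n x - q₀ x) 2 μ).toReal)
        atTop (𝓝 0) := by
      have := ((ENNReal.tendsto_toReal ENNReal.zero_ne_top).comp hlim).const_mul (C : ℝ)
      simpa using this
    refine squeeze_zero_norm (fun j => ?_) h2
    refine (abs_integral_inner_le (hf j) ((hq j).sub hq₀)).trans ?_
    refine mul_le_mul_of_nonneg_right ?_ ENNReal.toReal_nonneg
    exact ENNReal.toReal_le_coe_of_le_coe (hC j)
  have h3 := (hw q₀ hq₀).add h1
  rw [add_zero] at h3
  refine h3.congr fun j => ?_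
  rw [← integral_add (integrable_inner_of_memLp (hf j) hq₀)
    (show Integrable (fun x => (inner ℝ (f j x) (q j x - q₀ x) : ℝ)) μ from
      integrable_inner_of_memLp (hf j) ((hq j).sub hq₀))]
  congr 1; ext x; rw [← inner_add_right]; simp

theorem tendsto_eLpNorm_two_of_dominated {F : Type*} [NormedAddCommGroup F]
    {q : ℕ → α → F} {q₀ : α → F} {B : α → ℝ}
    (hq : ∀ n, AEStronglyMeasurable (q n) μ) (hB : MemLp B 2 μ)
    (hqB : ∀ n, ∀ᵐ x ∂μ, ‖q n x‖ ≤ B x)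
    (hlim : ∀ᵐ x ∂μ, Tendsto (fun n => q n x) atTop (𝓝 (q₀ x))) :
    Tendsto (fun n => eLpNorm (fun x => q n x - q₀ x) 2 μ) atTop (𝓝 0) := by
  have hq₀ : AEStronglyMeasurable q₀ μ := aestronglyMeasurable_of_tendsto_ae _ hq hlim
  have hb : ∀ᵐ x ∂μ, ‖q₀ x‖ ≤ B x := by
    filter_upwards [hlim, ae_all_iff.2 hqB] with x h1 h2
    exact le_of_tendsto h1.norm (Eventually.of_forall h2)
  have key : Tendsto (fun n => ∫⁻ x, ‖q n x - q₀ x‖ₑ ^ 2 ∂μ) atTop (𝓝 (∫⁻ _, 0 ∂μ)) := by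
    refine tendsto_lintegral_of_dominated_convergence' (fun x => ‖(2 * B x)‖ₑ ^ 2)
      (fun n => ((hq n).sub hq₀).enorm.pow_const _) (fun n => ?_) ?_ ?_
    · filter_upwards [hqB n, hb] with x h1 h2
      have h3 : ‖q n x - q₀ x‖ ≤ ‖2 * B x‖ := by
        refine (norm_sub_le _ _).trans ?_
        refine le_trans ?_ (le_abs_self _)
        linarith
      have h4 : ‖q n x - q₀ x‖ₑ ≤ ‖2 * B x‖ₑ := enorm_le_iff_norm_le.2 h3
      gcongr
    · have := (hB.const_mul 2)
      rw [← eLpNorm_two_sq (fun x => 2 * B x)]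
      exact (ENNReal.pow_lt_top this.2).ne
    · filter_upwards [hlim] with x hx
      have h1 : Tendsto (fun n => q n x - q₀ x) atTop (𝓝 0) := by
        simpa using hx.sub_const (q₀ x)
      have h2 : Tendsto (fun n => ‖q n x - q₀ x‖ₑ) atTop (𝓝 0) := by
        simpa using h1.enorm
      have h3 := ((ENNReal.continuous_pow 2).tendsto 0).comp h2
      rwa [zero_pow two_ne_zero] at h3
  rw [lintegral_zero] at key
  have h2 : Tendsto (fun n => (∫⁻ x, ‖q n x - q₀ x‖ₑ ^ 2 ∂μ) ^ (1/2 : ℝ)) atTop (𝓝 0) := by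
    have := key.ennrpow_const (1/2 : ℝ)
    simpa using this
  refine h2.congr fun n => ?_
  rw [← eLpNorm_two_sq (fun x => q n x - q₀ x), ← ENNReal.rpow_natCast, ← ENNReal.rpow_mul]
  norm_num

/-- Integrating out one variable of a square integrable function against a square integrable
weight gives a square integrable function. -/
theorem memLp_two_integral_right [SFinite μ] [SFinite ν] {F G : Type*} [NormedAddCommGroup F]
    [NormedSpace ℝ F] [NormedAddCommGroup G]
    {f : α × β → F} {K : α × β → G} {ψ : β → ℝ}
    (hf : AEStronglyMeasurable f (μ.prod ν)) (hK : MemLp K 2 (μ.prod ν)) (hψ : MemLp ψ 2 ν)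
    (h : ∀ p, ‖f p‖ ≤ |ψ p.2| * ‖K p‖) : MemLp (fun a => ∫ b, f (a, b) ∂ν) 2 μ := by
  refine ⟨hf.integral_prod_right', ?_⟩
  have hfin : eLpNorm (fun a => ∫ b, f (a, b) ∂ν) 2 μ ^ 2 < ⊤ := by
    rw [eLpNorm_two_sq]
    have hKm : AEMeasurable (fun p => ‖K p‖ₑ ^ 2) (μ.prod ν) := hK.1.enorm.pow_const _
    have h1 : ∀ᵐ a ∂μ, ‖∫ b, f (a, b) ∂ν‖ₑ ^ 2 ≤
        (∫⁻ b, ‖ψ b‖ₑ ^ 2 ∂ν) * ∫⁻ b, ‖K (a, b)‖ₑ ^ 2 ∂ν := by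
      filter_upwards [hK.1.prodMk_left] with a ha
      calc ‖∫ b, f (a, b) ∂ν‖ₑ ^ 2 ≤ (∫⁻ b, ‖f (a, b)‖ₑ ∂ν) ^ 2 := by
            gcongr; exact enorm_integral_le_lintegral_enorm _
        _ ≤ (∫⁻ b, (fun b => ‖ψ b‖ₑ) b * ‖K (a, b)‖ₑ ∂ν) ^ 2 := by
            gcongr with b
            have h2 := h (a, b)
            rw [← Real.norm_eq_abs] at h2
            calc ‖f (a, b)‖ₑ ≤ ‖‖ψ b‖ * ‖K (a, b)‖‖ₑ := by
                  rw [enorm_le_iff_norm_le, Real.norm_of_nonneg (by positivity)]; exact h2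
              _ = ‖ψ b‖ₑ * ‖K (a, b)‖ₑ := by simp [enorm_mul]
        _ ≤ ((∫⁻ b, ‖ψ b‖ₑ ^ (2 : ℝ) ∂ν) ^ (1 / 2 : ℝ) *
              (∫⁻ b, ‖K (a, b)‖ₑ ^ (2 : ℝ) ∂ν) ^ (1 / 2 : ℝ)) ^ 2 := by
            gcongr
            exact ENNReal.lintegral_mul_le_Lp_mul_Lq ν Real.HolderConjugate.two_two
              hψ.1.enorm ha.enorm
        _ = _ := by
            rw [mul_pow, ← ENNReal.rpow_natCast, ← ENNReal.rpow_natCast, ← ENNReal.rpow_mul,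
              ← ENNReal.rpow_mul]
            norm_num
    refine (lintegral_mono_ae h1).trans_lt ?_
    rw [lintegral_const_mul'' _ hKm.lintegral_prod_right', ← lintegral_prod _ hKm,
      ← eLpNorm_two_sq, ← eLpNorm_two_sq]
    exact ENNReal.mul_lt_top (ENNReal.pow_lt_top hψ.2) (ENNReal.pow_lt_top hK.2)
  by_contra hcon
  simp only [not_lt, top_le_iff] at hcon
  rw [hcon] at hfin
  simp at hfin

end LTwo

/-! ### Determining classes, tensor products and slices -/

section Determining

variable {α β E : Type*} [MeasurableSpace α] [MeasurableSpace β] {μ : Measure α} {ν : Measure β}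
  [NormedAddCommGroup E] [InnerProductSpace ℝ E]

/-- A class of functions is determining for `L²(μ; E)` if only the zero element of `L²(μ; E)` is
orthogonal to all of its members. -/
def Determining (μ : Measure α) (𝒯 : Set (α → E)) : Prop :=
  ∀ k : α → E, MemLp k 2 μ → (∀ τ ∈ 𝒯, ∫ x, inner ℝ (τ x) (k x) ∂μ = 0) → k =ᵐ[μ] 0

theorem eLpNorm_tensor_sq [SFinite ν] {ψ : α → ℝ} {τ : β → E} (hψ : MemLp ψ 2 μ)
    (hτ : MemLp τ 2 ν) :
    eLpNorm (fun p : α × β => ψ p.1 • τ p.2) 2 (μ.prod ν) ^ 2 =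
      eLpNorm ψ 2 μ ^ 2 * eLpNorm τ 2 ν ^ 2 := by
  rw [eLpNorm_two_sq, eLpNorm_two_sq, eLpNorm_two_sq,
    ← lintegral_prod_mul (hψ.1.enorm.pow_const _) (hτ.1.enorm.pow_const _)]
  simp_rw [enorm_smul, mul_pow]

theorem memLp_tensor [SFinite μ] [SFinite ν] {ψ : α → ℝ} {τ : β → E} (hψ : MemLp ψ 2 μ)
    (hτ : MemLp τ 2 ν) : MemLp (fun p : α × β => ψ p.1 • τ p.2) 2 (μ.prod ν) := by
  refine ⟨hψ.1.comp_fst.smul hτ.1.comp_snd, ?_⟩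
  have h := eLpNorm_tensor_sq hψ hτ
  have h2 : eLpNorm (fun p : α × β => ψ p.1 • τ p.2) 2 (μ.prod ν) ^ 2 < ⊤ := by
    rw [h]; exact ENNReal.mul_lt_top (ENNReal.pow_lt_top hψ.2) (ENNReal.pow_lt_top hτ.2)
  by_contra hcon
  simp only [not_lt, top_le_iff] at hcon
  rw [hcon] at h2
  simp at h2

theorem ae_memLp_slice [SFinite μ] [SFinite ν] {F : Type*} [NormedAddCommGroup F] {k : α × β → F}
    (hk : MemLp k 2 (μ.prod ν)) : ∀ᵐ a ∂μ, MemLp (fun b => k (a, b)) 2 ν := by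
  have hm : AEMeasurable (fun p => ‖k p‖ₑ ^ 2) (μ.prod ν) := hk.1.enorm.pow_const _
  have hfin : ∫⁻ a, ∫⁻ b, ‖k (a, b)‖ₑ ^ 2 ∂ν ∂μ ≠ ⊤ := by
    rw [← lintegral_prod _ hm, ← eLpNorm_two_sq]
    exact (ENNReal.pow_lt_top hk.2).ne
  filter_upwards [ae_lt_top' hm.lintegral_prod_right' hfin, hk.1.prodMk_left] with a h1 h2
  refine ⟨h2, ?_⟩
  rw [← eLpNorm_two_sq (fun b => k (a, b))] at h1
  by_contra hcon
  simp only [not_lt, top_le_iff] at hcon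
  rw [hcon] at h1
  simp at h1

theorem memLp_comp_swap [SFinite μ] [SFinite ν] {F : Type*} [NormedAddCommGroup F] {k : α × β → F}
    (hk : MemLp k 2 (μ.prod ν)) : MemLp (fun p : β × α => k p.swap) 2 (ν.prod μ) :=
  hk.comp_measurePreserving Measure.measurePreserving_swap

theorem integral_inner_tensor_right [SFinite μ] [SFinite ν] {ψ : α → ℝ} {τ : β → E}
    {k : α × β → E} (hψ : MemLp ψ 2 μ) (hτ : MemLp τ 2 ν) (hk : MemLp k 2 (μ.prod ν)) :
    ∫ p, inner ℝ (ψ p.1 • τ p.2) (k p) ∂(μ.prod ν) =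
      ∫ a, ψ a * ∫ b, inner ℝ (τ b) (k (a, b)) ∂ν ∂μ := by
  rw [integral_prod _ (integrable_inner_of_memLp (memLp_tensor hψ hτ) hk)]
  simp_rw [real_inner_smul_left, integral_const_mul]

theorem integral_inner_tensor_left [CompleteSpace E] [SFinite μ] [SFinite ν] {ψ : α → ℝ}
    {τ : β → E} {k : α × β → E} (hψ : MemLp ψ 2 μ) (hτ : MemLp τ 2 ν)
    (hk : MemLp k 2 (μ.prod ν)) :
    ∫ p, inner ℝ (ψ p.1 • τ p.2) (k p) ∂(μ.prod ν) =
      ∫ b, inner ℝ (τ b) (∫ a, ψ a • k (a, b) ∂μ) ∂ν := by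
  rw [integral_prod_symm _ (integrable_inner_of_memLp (memLp_tensor hψ hτ) hk)]
  apply integral_congr_ae
  filter_upwards [ae_memLp_slice (memLp_comp_swap hk)] with b hb
  have hint : Integrable (fun a => ψ a • k (a, b)) μ := by
    have h1 := integrable_inner_of_memLp (E := ℝ) hψ.norm hb.norm
    refine h1.mono (hψ.1.smul hb.1) (Eventually.of_forall fun a => ?_)
    simp [norm_smul, mul_comm]
  rw [← integral_inner hint]
  simp_rw [real_inner_smul_left, real_inner_smul_right]

theorem memLp_integral_inner_right [SFinite μ] [SFinite ν] {τ : β → E} {k : α × β → E}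
    (hτ : MemLp τ 2 ν) (hk : MemLp k 2 (μ.prod ν)) :
    MemLp (fun a => ∫ b, (inner ℝ (τ b) (k (a, b)) : ℝ) ∂ν) 2 μ := by
  refine memLp_two_integral_right (f := fun p : α × β => (inner ℝ (τ p.2) (k p) : ℝ))
    (hτ.1.comp_snd.inner hk.1) hk hτ.norm fun p => ?_
  rw [abs_norm]
  exact abs_real_inner_le_norm _ _

theorem memLp_integral_smul_left [SFinite μ] [SFinite ν] {ψ : α → ℝ} {k : α × β → E}
    (hψ : MemLp ψ 2 μ) (hk : MemLp k 2 (μ.prod ν)) :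
    MemLp (fun b => ∫ a, ψ a • k (a, b) ∂μ) 2 ν := by
  refine memLp_two_integral_right (f := fun p : β × α => ψ p.2 • k p.swap)
    (hψ.1.comp_snd.smul (memLp_comp_swap hk).1) (memLp_comp_swap hk) hψ fun p => ?_
  rw [norm_smul, Real.norm_eq_abs]

theorem ae_eq_zero_of_forall_setIntegral_prod [IsFiniteMeasure μ] [IsFiniteMeasure ν]
    {k : α × β → ℝ} (hk : Integrable k (μ.prod ν))
    (h : ∀ (A : Set α) (B : Set β), MeasurableSet A → MeasurableSet B →
      ∫ p in A ×ˢ B, k p ∂(μ.prod ν) = 0) : k =ᵐ[μ.prod ν] 0 := by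
  refine hk.ae_eq_zero_of_forall_setIntegral_eq_zero fun s hs _ => ?_
  induction s, hs using MeasurableSpace.induction_on_inter generateFrom_prod.symm isPiSystem_prod with
  | empty => simp
  | basic t ht =>
    obtain ⟨A, hA, B, hB, rfl⟩ := ht
    exact h A B hA hB
  | compl t ht ih =>
    have h1 := h univ univ MeasurableSet.univ MeasurableSet.univ
    rw [univ_prod_univ, setIntegral_univ] at h1
    have h2 := integral_add_compl ht hk
    rw [h1, ih (measure_lt_top _ _)] at h2
    linarith
  | iUnion f hd hm ih =>
    rw [integral_iUnion hm hd hk.integrableOn]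
    simp [fun i => ih i (measure_lt_top _ _)]

/-- Products of members of two determining classes form a determining class. -/
theorem Determining.prod [CompleteSpace E] [SecondCountableTopology E] [IsFiniteMeasure μ]
    [IsFiniteMeasure ν] {𝒟 : Set (α → ℝ)} {𝒯 : Set (β → E)} (h𝒟 : Determining μ 𝒟)
    (h𝒯 : Determining ν 𝒯) (m𝒟 : ∀ ψ ∈ 𝒟, MemLp ψ 2 μ) (m𝒯 : ∀ τ ∈ 𝒯, MemLp τ 2 ν) :
    Determining (μ.prod ν) (image2 (fun ψ τ (p : α × β) => ψ p.1 • τ p.2) 𝒟 𝒯) := by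
  intro k hk h
  -- the two factors are freed one after the other
  have h1 : ∀ ψ ∈ 𝒟, ∀ τ : β → E, MemLp τ 2 ν →
      ∫ p, inner ℝ (ψ p.1 • τ p.2) (k p) ∂(μ.prod ν) = 0 := by
    intro ψ hψ τ hτ
    have h2 : (fun b => ∫ a, ψ a • k (a, b) ∂μ) =ᵐ[ν] 0 := by
      refine h𝒯 _ (memLp_integral_smul_left (m𝒟 ψ hψ) hk) fun σ hσ => ?_
      rw [← integral_inner_tensor_left (m𝒟 ψ hψ) (m𝒯 σ hσ) hk]
      exact h _ ⟨ψ, hψ, σ, hσ, rfl⟩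
    rw [integral_inner_tensor_left (m𝒟 ψ hψ) hτ hk]
    rw [integral_congr_ae (g := fun _ => (0 : ℝ)), integral_zero]
    filter_upwards [h2] with b hb
    simp only [Pi.zero_apply] at hb
    rw [hb, inner_zero_right]
  have h3 : ∀ ψ : α → ℝ, MemLp ψ 2 μ → ∀ τ : β → E, MemLp τ 2 ν →
      ∫ p, inner ℝ (ψ p.1 • τ p.2) (k p) ∂(μ.prod ν) = 0 := by
    intro ψ hψ τ hτ
    have h2 : (fun a => ∫ b, (inner ℝ (τ b) (k (a, b)) : ℝ) ∂ν) =ᵐ[μ] 0 := by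
      refine h𝒟 _ (memLp_integral_inner_right hτ hk) fun σ hσ => ?_
      have := integral_inner_tensor_right (m𝒟 σ hσ) hτ hk
      rw [h1 σ hσ τ hτ] at this
      rw [this]
      simp [mul_comm]
    rw [integral_inner_tensor_right hψ hτ hk]
    rw [integral_congr_ae (g := fun _ => (0 : ℝ)), integral_zero]
    filter_upwards [h2] with b hb
    simp only [Pi.zero_apply] at hb
    rw [hb, mul_zero]
  refine ae_eq_zero_of_forall_inner (𝕜 := ℝ) fun c => ?_
  refine ae_eq_zero_of_forall_setIntegral_prod
    ((hk.integrable (by norm_num)).const_inner c) fun A B hA hB => ?_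
  rw [← integral_indicator (hA.prod hB)]
  have h4 := h3 (A.indicator fun _ => 1) ((memLp_const 1).indicator hA)
    (B.indicator fun _ => c) ((memLp_const c).indicator hB)
  rw [← h4]
  congr 1; ext p
  by_cases h5 : p.1 ∈ A <;> by_cases h6 : p.2 ∈ B <;> simp [indicator, h5, h6]

/-- Orthogonality to all products `ψ ⊗ τ` passes to almost every slice, simultaneously for all
`τ`: this rests on the separability of `L²`. -/
theorem ae_forall_integral_inner_slice_eq_zero [SFinite μ] [SFinite ν]
    [MeasureTheory.IsSeparable ν] [TopologicalSpace.SeparableSpace E]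
    {𝒟 : Set (α → ℝ)} {𝒯 : Set (β → E)} (h𝒟 : Determining μ 𝒟)
    (m𝒟 : ∀ ψ ∈ 𝒟, MemLp ψ 2 μ) (m𝒯 : ∀ τ ∈ 𝒯, MemLp τ 2 ν)
    {k : α × β → E} (hk : MemLp k 2 (μ.prod ν))
    (h : ∀ ψ ∈ 𝒟, ∀ τ ∈ 𝒯, ∫ p, inner ℝ (ψ p.1 • τ p.2) (k p) ∂(μ.prod ν) = 0) :
    ∀ᵐ a ∂μ, MemLp (fun b => k (a, b)) 2 ν ∧
      ∀ τ ∈ 𝒯, ∫ b, inner ℝ (τ b) (k (a, b)) ∂ν = 0 := by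
  have : Fact ((2 : ℝ≥0∞) ≠ ⊤) := ⟨by norm_num⟩
  let S : Set (Lp E 2 ν) := {F | ∃ τ, ∃ hτ : τ ∈ 𝒯, F = (m𝒯 τ hτ).toLp τ}
  obtain ⟨D, hDS, hDc, hD⟩ := (TopologicalSpace.IsSeparable.of_separableSpace S).exists_countable_dense_subset
  have h1 : ∀ F ∈ D, ∀ᵐ a ∂μ, ∫ b, (inner ℝ (F b) (k (a, b)) : ℝ) ∂ν = 0 := by
    intro F hF
    refine h𝒟 _ (memLp_integral_inner_right (Lp.memLp F) hk) fun σ hσ => ?_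
    obtain ⟨τ, hτ, rfl⟩ := hDS hF
    have h2 := integral_inner_tensor_right (m𝒟 σ hσ) (m𝒯 τ hτ) hk
    rw [h σ hσ τ hτ] at h2
    rw [h2]
    congr 1; ext a
    simp only [RCLike.inner_apply, conj_trivial]
    rw [mul_comm]
    congr 1
    apply integral_congr_ae
    filter_upwards [(m𝒯 τ hτ).coeFn_toLp] with b hb
    rw [hb]
  filter_upwards [(ae_ball_iff hDc).2 h1, ae_memLp_slice hk] with a h2 h3
  refine ⟨h3, fun τ hτ => ?_⟩
  have h4 : (m𝒯 τ hτ).toLp τ ∈ closure D := hD ⟨τ, hτ, rfl⟩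
  have h5 : closure D ⊆ {F : Lp E 2 ν | inner ℝ F (h3.toLp _) = (0 : ℝ)} := by
    refine closure_minimal (fun F hF => ?_) (isClosed_eq (by fun_prop) continuous_const)
    have := h2 F hF
    simp only [mem_ofPred_eq]
    rw [L2.inner_def, ← this]
    apply integral_congr_ae
    filter_upwards [h3.coeFn_toLp] with b hb
    rw [hb]
  have h6 := h5 h4
  simp only [mem_ofPred_eq] at h6
  rwa [inner_toLp_eq_integral] at h6

/-- The `L²` norm is computed by duality with a determining vector space of functions. -/
theorem toReal_eLpNorm_le_of_forall_abs_integral_le {𝒟 : Submodule ℝ (α → ℝ)}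
    (h𝒟 : Determining μ (𝒟 : Set (α → ℝ))) (m𝒟 : ∀ ψ ∈ 𝒟, MemLp ψ 2 μ) {f : α → ℝ}
    (hf : MemLp f 2 μ) {M : ℝ} (hM : 0 ≤ M)
    (h : ∀ φ ∈ 𝒟, |∫ x, φ x * f x ∂μ| ≤ M * (eLpNorm φ 2 μ).toReal) :
    (eLpNorm f 2 μ).toReal ≤ M := by
  have h0 : ∀ φ, (hφ : φ ∈ 𝒟) → inner ℝ ((m𝒟 φ hφ).toLp φ) (hf.toLp f) = ∫ x, φ x * f x ∂μ := by
    intro φ hφ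
    rw [inner_toLp_eq_integral]
    simp [mul_comm]
  let S : Submodule ℝ (Lp ℝ 2 μ) :=
    { carrier := {F | ∃ φ, ∃ hφ : φ ∈ 𝒟, F = (m𝒟 φ hφ).toLp φ}
      add_mem' := by
        rintro _ _ ⟨φ, hφ, rfl⟩ ⟨χ, hχ, rfl⟩
        exact ⟨φ + χ, 𝒟.add_mem hφ hχ, rfl⟩
      zero_mem' := ⟨0, 𝒟.zero_mem, rfl⟩
      smul_mem' := by
        rintro c _ ⟨φ, hφ, rfl⟩
        exact ⟨c • φ, 𝒟.smul_mem c hφ, rfl⟩ }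
  have hS : Sᗮ = ⊥ := by
    rw [eq_bot_iff]
    intro G hG
    have h1 : (G : α → ℝ) =ᵐ[μ] 0 := by
      refine h𝒟 _ (Lp.memLp G) fun φ hφ => ?_
      have h2 := (Submodule.mem_orthogonal S G).1 hG _ ⟨φ, hφ, rfl⟩
      rw [L2.inner_def] at h2
      rw [← h2]
      apply integral_congr_ae
      filter_upwards [(m𝒟 φ hφ).coeFn_toLp] with b hb
      rw [hb]
    rw [Submodule.mem_bot]
    exact Lp.eq_zero_iff_ae_eq_zero.2 h1
  have hd := S.topologicalClosure_eq_top_iff.2 hS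
  have h1 : ∀ F : Lp ℝ 2 μ, |inner ℝ F (hf.toLp f)| ≤ M * ‖F‖ := by
    intro F
    have hF : F ∈ closure (S : Set (Lp ℝ 2 μ)) := by
      rw [← Submodule.topologicalClosure_coe, hd]; trivial
    have h5 : closure (S : Set (Lp ℝ 2 μ)) ⊆ {F | |inner ℝ F (hf.toLp f)| ≤ M * ‖F‖} := by
      refine closure_minimal ?_ (isClosed_le (by fun_prop) (by fun_prop))
      rintro _ ⟨φ, hφ, rfl⟩
      simp only [mem_ofPred_eq]
      rw [h0 φ hφ, Lp.norm_toLp]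
      exact h φ hφ
    exact h5 hF
  have h2 := h1 (hf.toLp f)
  rw [real_inner_self_eq_norm_sq, abs_of_nonneg (by positivity)] at h2
  rw [← Lp.norm_toLp f hf]
  by_contra hcon
  push Not at hcon
  nlinarith

end Determining

section TestFunctions

variable {V : Type*} [NormedAddCommGroup V] [NormedSpace ℝ V]

theorem IsTestFun.eq_zero {U : Set V} {φ : V → ℝ} (h : IsTestFun U φ) {x : V} (hx : x ∉ U) :
    φ x = 0 :=
  image_eq_zero_of_notMem_tsupport fun h' => hx (h.support_subset h')

theorem IsTestFun.mono {U U' : Set V} {φ : V → ℝ} (h : IsTestFun U φ) (hU : U ⊆ U') :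
    IsTestFun U' φ := ⟨h.smooth, h.compact, h.support_subset.trans hU⟩

/-- The vector space of test functions on a set. -/
def testSpace (U : Set V) : Submodule ℝ (V → ℝ) where
  carrier := {φ | IsTestFun U φ}
  add_mem' := by
    intro φ χ hφ hχ
    refine ⟨hφ.smooth.add hχ.smooth, hφ.compact.add hχ.compact, ?_⟩
    exact (tsupport_add φ χ).trans (union_subset hφ.support_subset hχ.support_subset)
  zero_mem' := ⟨contDiff_const, HasCompactSupport.zero, by simp [tsupport]⟩
  smul_mem' := by
    intro c φ hφ
    refine ⟨contDiff_const.smul hφ.smooth, hφ.compact.smul_left (f := fun _ => c), ?_⟩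
    exact (tsupport_smul_subset_right (fun _ => c) φ).trans hφ.support_subset

variable [MeasurableSpace V] [BorelSpace V] {μ : Measure V}
  [IsFiniteMeasureOnCompacts μ]

theorem IsTestFun.memLp {U : Set V} {φ : V → ℝ} (h : IsTestFun U φ) (p : ℝ≥0∞) (S : Set V) :
    MemLp φ p (μ.restrict S) :=
  (h.smooth.continuous.memLp_of_hasCompactSupport h.compact (p := p) (μ := μ)).restrict S

theorem determining_testSpace [FiniteDimensional ℝ V] {U : Set V} (hU : IsOpen U) :
    Determining (μ.restrict U) (testSpace U : Set (V → ℝ)) := by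
  intro k hk h
  have h1 : LocallyIntegrableOn k U μ :=
    locallyIntegrableOn_of_locallyIntegrable_restrict (hk.locallyIntegrable (by norm_num))
  have h2 := hU.ae_eq_zero_of_integral_contDiff_smul_eq_zero h1 fun g g1 g2 g3 => by
    have hg : IsTestFun U g := ⟨g1, g2, g3⟩
    rw [← h g hg, setIntegral_eq_integral_of_forall_compl_eq_zero]
    · simp [mul_comm]
    · intro x hx; simp [hg.eq_zero hx]
  exact (ae_restrict_iff' hU.measurableSet).2 h2

end TestFunctions

/-! ### Translations of Sobolev functions and the Poincaré inequality -/

section Poincare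

variable {N : ℕ}

/-- `w ∈ H¹(U)`, with weak gradient `g`. -/
structure MemH1 (U : Set (Euc N)) (w : Euc N → ℝ) (g : Euc N → Euc N) : Prop where
  memLp_fun : MemLp w 2 (volume.restrict U)
  memLp_grad : MemLp g 2 (volume.restrict U)
  weakGradient : IsWeakGradient U w g

theorem inner_gradient_eq_fderiv {φ : Euc N → ℝ} (x h : Euc N) :
    inner ℝ (gradient φ x) h = fderiv ℝ φ x h := by
  rw [gradient, InnerProductSpace.toDual_symm_apply]

theorem IsTestFun.continuous_gradient {U : Set (Euc N)} {φ : Euc N → ℝ} (hφ : IsTestFun U φ) :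
    Continuous (gradient φ) :=
  (InnerProductSpace.toDual ℝ (Euc N)).symm.continuous.comp (hφ.smooth.continuous_fderiv (by simp))

theorem IsTestFun.hasCompactSupport_gradient {U : Set (Euc N)} {φ : Euc N → ℝ}
    (hφ : IsTestFun U φ) : HasCompactSupport (gradient φ) :=
  (hφ.compact.fderiv (𝕜 := ℝ)).comp_left (map_zero _)

theorem MemH1.integral_mul_fderiv {U : Set (Euc N)} {w : Euc N → ℝ} {g : Euc N → Euc N}
    (h : MemH1 U w g) {φ : Euc N → ℝ} (hφ : IsTestFun U φ) (e : Euc N) :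
    ∫ x in U, w x * fderiv ℝ φ x e = - ∫ x in U, φ x * inner ℝ (g x) e := by
  have h1 := congrArg (fun v => (inner ℝ e v : ℝ)) (h.weakGradient.integral_eq φ hφ)
  have hgr : MemLp (gradient φ) 2 (volume.restrict U) :=
    (hφ.continuous_gradient.memLp_of_hasCompactSupport hφ.hasCompactSupport_gradient).restrict U
  have i1 : Integrable (fun x => w x • gradient φ x) (volume.restrict U) :=
    integrable_smul_of_memLp h.memLp_fun hgr
  have i2 : Integrable (fun x => φ x • g x) (volume.restrict U) :=
    integrable_smul_of_memLp (hφ.memLp 2 U) h.memLp_grad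
  simp only [inner_neg_right] at h1
  rw [← integral_inner i1, ← integral_inner i2] at h1
  simp_rw [real_inner_smul_right, real_inner_comm _ e] at h1
  simpa only [inner_gradient_eq_fderiv] using h1

theorem memLp_comp_add_right {F : Type*} [NormedAddCommGroup F] {f : Euc N → F} {A A' : Set (Euc N)}
    (hA' : MeasurableSet A') {h : Euc N} (hA : ∀ z ∈ A, z + h ∈ A')
    (hf : MemLp f 2 (volume.restrict A')) :
    MemLp (fun z => f (z + h)) 2 (volume.restrict A) ∧
      eLpNorm (fun z => f (z + h)) 2 (volume.restrict A) ≤ eLpNorm f 2 (volume.restrict A') := by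
  have mp := (measurePreserving_add_right (volume : Measure (Euc N)) h).restrict_preimage hA'
  have hsub : A ⊆ (fun z => z + h) ⁻¹' A' := hA
  have h1 := hf.comp_measurePreserving mp
  refine ⟨h1.mono_measure (Measure.restrict_mono hsub le_rfl), ?_⟩
  rw [← eLpNorm_comp_measurePreserving hf.1 mp]
  exact eLpNorm_mono_measure _ (Measure.restrict_mono hsub le_rfl)

/-- Translates of `φ` along a segment joining a set to `U` are test functions on `U`. -/
theorem IsTestFun.translate {A U : Set (Euc N)} {φ : Euc N → ℝ} (hφ : IsTestFun A φ) {e : Euc N}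
    (hA : ∀ z ∈ A, z + e ∈ U) : IsTestFun U (fun z => φ (z - e)) := by
  have hsupp : tsupport (fun z => φ (z - e)) = (fun z => z - e) ⁻¹' tsupport φ :=
    tsupport_comp_eq_preimage φ (Homeomorph.subRight e)
  refine ⟨hφ.smooth.comp (contDiff_id.sub contDiff_const),
    hφ.compact.comp_homeomorph (Homeomorph.subRight e), ?_⟩
  rw [hsupp]
  intro z hz
  simpa using hA _ (hφ.support_subset hz)

/-- The translation estimate `‖w(· + h) - w‖_{L²(A)} ≤ |h| ‖∇w‖_{L²(U)}`, for a set `A` such that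
all segments `[z, z + h]` with `z ∈ A` lie in `U`. By duality, it amounts to bounding the derivative
of `τ ↦ ∫ w(z) φ(z - τh) dz` for test functions `φ` on `A`. -/
theorem MemH1.translation_estimate {U A : Set (Euc N)} (hU : IsOpen U)
    (hfin : volume U ≠ ⊤) (hA : IsOpen A) {h : Euc N}
    (hAU : ∀ z ∈ A, ∀ τ ∈ Icc (0 : ℝ) 1, z + τ • h ∈ U) {w : Euc N → ℝ} {g : Euc N → Euc N}
    (hw : MemH1 U w g) :
    MemLp (fun z => w (z + h) - w z) 2 (volume.restrict A) ∧
    (eLpNorm (fun z => w (z + h) - w z) 2 (volume.restrict A)).toReal ≤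
      ‖h‖ * (eLpNorm g 2 (volume.restrict U)).toReal := by
  have : IsFiniteMeasure (volume.restrict U : Measure (Euc N)) := ⟨by simpa using hfin.lt_top⟩
  have hAU0 : A ⊆ U := fun z hz => by simpa using hAU z hz 0 (by simp)
  have hAU1 : ∀ z ∈ A, z + h ∈ U := fun z hz => by simpa using hAU z hz 1 (by simp)
  have m1 := (memLp_comp_add_right hU.measurableSet hAU1 hw.memLp_fun).1
  have m0 := hw.memLp_fun.mono_measure (Measure.restrict_mono hAU0 le_rfl)
  refine ⟨m1.sub m0, ?_⟩
  refine toReal_eLpNorm_le_of_forall_abs_integral_le (determining_testSpace hA)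
    (fun φ hφ => IsTestFun.memLp hφ 2 A) (m1.sub m0) (by positivity) fun φ hφ => ?_
  rw [SetLike.mem_coe.symm] at hφ
  have hφ : IsTestFun A φ := hφ
  have hwint : Integrable w (volume.restrict U) := hw.memLp_fun.integrable (by norm_num)
  -- the function whose increment over `[0, 1]` is the pairing with `φ`
  set m : ℝ → ℝ := fun τ => ∫ z in U, w z * φ (z - τ • h) with hm
  obtain ⟨K, hK⟩ := (hφ.smooth.continuous_fderiv (by simp)).bounded_above_of_compact_support
    (hφ.compact.fderiv (𝕜 := ℝ))
  obtain ⟨K0, hK0⟩ := hφ.smooth.continuous.bounded_above_of_compact_support hφ.compact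
  have hder : ∀ τ, HasDerivAt m (∫ z in U, w z * (- fderiv ℝ φ (z - τ • h) h)) τ := by
    intro τ
    have hφc := hφ.smooth.continuous
    have hφd := hφ.smooth.continuous_fderiv (n := ∞) (by simp)
    refine (hasDerivAt_integral_of_dominated_loc_of_deriv_le (μ := volume.restrict U)
      (F := fun τ z => w z * φ (z - τ • h))
      (F' := fun τ z => w z * (- fderiv ℝ φ (z - τ • h) h)) (s := univ) (x₀ := τ)
      (bound := fun z => ‖w z‖ * (K * ‖h‖)) univ_mem ?_ ?_ ?_ ?_ ?_ ?_).2
    · refine Eventually.of_forall fun σ => hwint.1.mul ?_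
      exact Continuous.aestronglyMeasurable (by fun_prop)
    · refine hwint.mul_bdd (c := K0) ?_ (Eventually.of_forall fun z => hK0 _)
      exact Continuous.aestronglyMeasurable (by fun_prop)
    · refine hwint.1.mul ?_
      refine Continuous.aestronglyMeasurable (Continuous.neg ?_)
      exact (hφd.comp (by fun_prop)).clm_apply continuous_const
    · refine Eventually.of_forall fun z σ _ => ?_
      rw [norm_mul, norm_neg]
      gcongr
      exact (ContinuousLinearMap.le_opNorm _ _).trans (by gcongr; exact hK _)
    · exact hwint.norm.mul_const _
    · refine Eventually.of_forall fun z σ _ => HasDerivAt.const_mul _ ?_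
      have h1 : HasDerivAt (fun σ : ℝ => z - σ • h) (-h) σ := by
        simpa using ((hasDerivAt_id σ).smul_const h).const_sub z
      have h2 := ((hφ.smooth.differentiable (by simp) (z - σ • h)).hasFDerivAt).comp_hasDerivAt σ h1
      rw [map_neg] at h2
      exact h2
  have hn : ∀ τ : ℝ, eLpNorm (fun z => φ (z - τ • h)) 2 (volume.restrict U) ≤
      eLpNorm φ 2 (volume.restrict A) := by
    intro τ
    refine (eLpNorm_mono_measure _ Measure.restrict_le_self).trans ?_
    have h1 := eLpNorm_comp_measurePreserving (p := 2) (hφ.smooth.continuous.aestronglyMeasurable)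
      (measurePreserving_sub_right (volume : Measure (Euc N)) (τ • h))
    refine (le_of_eq h1).trans ?_
    rw [← eLpNorm_indicator_eq_eLpNorm_restrict hA.measurableSet]
    refine le_of_eq (congrArg (fun f => eLpNorm f 2 volume) ?_)
    ext z
    by_cases hz : z ∈ A
    · simp [hz]
    · simp [hz, hφ.eq_zero hz]
  have hbound : ∀ τ ∈ Ico (0 : ℝ) 1, ‖∫ z in U, w z * (- fderiv ℝ φ (z - τ • h) h)‖ ≤
      ‖h‖ * (eLpNorm g 2 (volume.restrict U)).toReal *
        (eLpNorm φ 2 (volume.restrict A)).toReal := by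
    intro τ hτ
    have ht : IsTestFun U (fun z => φ (z - τ • h)) :=
      hφ.translate fun z hz => hAU z hz τ ⟨hτ.1, hτ.2.le⟩
    have h1 := hw.integral_mul_fderiv ht h
    have h2 : ∀ z, fderiv ℝ (fun z => φ (z - τ • h)) z = fderiv ℝ φ (z - τ • h) := fun z => by
      rw [fderiv_comp_sub]
    simp_rw [h2] at h1
    simp_rw [mul_neg, integral_neg]
    rw [h1, neg_neg, Real.norm_eq_abs]
    have hgh : MemLp (fun x => (inner ℝ (g x) h : ℝ)) 2 (volume.restrict U) :=
      hw.memLp_grad.inner_const h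
    have h3 := abs_integral_inner_le (E := ℝ) hgh (ht.memLp 2 U)
    simp only [RCLike.inner_apply, conj_trivial] at h3
    refine h3.trans ?_
    gcongr
    · have h4 : eLpNorm (fun x => (inner ℝ (g x) h : ℝ)) 2 (volume.restrict U) ≤
          ENNReal.ofReal ‖h‖ * eLpNorm g 2 (volume.restrict U) :=
        eLpNorm_le_mul_eLpNorm_of_ae_le_mul (Eventually.of_forall fun x => by
          rw [mul_comm]; exact norm_inner_le_norm _ _) 2
      have h5 := ENNReal.toReal_mono (ENNReal.mul_ne_top ENNReal.ofReal_ne_top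
        hw.memLp_grad.2.ne) h4
      rwa [ENNReal.toReal_mul, ENNReal.toReal_ofReal (norm_nonneg _)] at h5
    · exact (IsTestFun.memLp hφ 2 A).2.ne
    · exact hn τ
  have hfinal := norm_image_sub_le_of_norm_deriv_le_segment_01'
    (fun τ _ => (hder τ).hasDerivWithinAt) hbound
  have e1 : m 1 = ∫ z in A, φ z * w (z + h) := by
    have h1 : ∀ z, (U.indicator (fun z => w z * φ (z - h))) z =
        (fun z => (U.indicator w (z + h)) * φ z) (z - h) := by
      intro z; by_cases hz : z ∈ U <;> simp [hz]
    simp only [hm, one_smul]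
    rw [← integral_indicator hU.measurableSet]
    simp_rw [h1]
    rw [integral_sub_right_eq_self (fun z => (U.indicator w (z + h)) * φ z) h,
      ← setIntegral_eq_integral_of_forall_compl_eq_zero (s := A)]
    · refine setIntegral_congr_fun hA.measurableSet fun z hz => ?_
      simp [hAU1 z hz, mul_comm]
    · intro z hz; simp [hφ.eq_zero hz]
  have e0 : m 0 = ∫ z in A, φ z * w z := by
    simp only [hm, zero_smul, sub_zero]
    rw [← integral_indicator hU.measurableSet, ← integral_indicator hA.measurableSet]
    congr 1; ext z
    by_cases hz : z ∈ A
    · simp [hz, hAU0 hz, mul_comm]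
    · by_cases hz' : z ∈ U <;> simp [hz, hz', hφ.eq_zero hz]
  have hi1 : Integrable (fun z => φ z * w (z + h)) (volume.restrict A) :=
    integrable_smul_of_memLp (hφ.memLp 2 A) m1
  have hi0 : Integrable (fun z => φ z * w z) (volume.restrict A) :=
    integrable_smul_of_memLp (hφ.memLp 2 A) m0
  have e2 : ∫ z in A, φ z * (w (z + h) - w z) = m 1 - m 0 := by
    rw [e1, e0, ← integral_sub hi1 hi0]
    simp_rw [mul_sub]
  change |∫ z in A, φ z * (w (z + h) - w z)| ≤ _
  rw [e2]
  exact hfinal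

/-- The oscillation of `H¹(U)` functions on `A ∩ U` is controlled by that on `B` and by the
gradient. -/
def Controlled (U B A : Set (Euc N)) : Prop :=
  ∃ C : ℝ, 0 ≤ C ∧ ∀ (w : Euc N → ℝ) (g : Euc N → Euc N) (c : ℝ), MemH1 U w g →
    (eLpNorm (fun x => w x - c) 2 (volume.restrict (A ∩ U))).toReal ≤
      C * ((eLpNorm (fun x => w x - c) 2 (volume.restrict B)).toReal +
        (eLpNorm g 2 (volume.restrict U)).toReal)

theorem MemH1.memLp_sub_const {U : Set (Euc N)} (hfin : volume U ≠ ⊤) {w : Euc N → ℝ}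
    {g : Euc N → Euc N} (hw : MemH1 U w g) (c : ℝ) {A : Set (Euc N)} (hA : A ⊆ U) :
    MemLp (fun x => w x - c) 2 (volume.restrict A) := by
  have : IsFiniteMeasure (volume.restrict U : Measure (Euc N)) := ⟨by simpa using hfin.lt_top⟩
  exact (hw.memLp_fun.sub (memLp_const c)).mono_measure (Measure.restrict_mono hA le_rfl)

theorem Controlled.mono {U B A A' : Set (Euc N)} (hfin : volume U ≠ ⊤) (h : Controlled U B A)
    (hA : A' ⊆ A) : Controlled U B A' := by
  obtain ⟨C, hC, h⟩ := h
  refine ⟨C, hC, fun w g c hw => le_trans ?_ (h w g c hw)⟩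
  refine ENNReal.toReal_mono (hw.memLp_sub_const hfin c inter_subset_right).2.ne ?_
  exact eLpNorm_mono_measure _ (Measure.restrict_mono (inter_subset_inter_left _ hA) le_rfl)

theorem Controlled.union {U B A A' : Set (Euc N)} (hfin : volume U ≠ ⊤) (h : Controlled U B A)
    (h' : Controlled U B A') : Controlled U B (A ∪ A') := by
  obtain ⟨C, hC, h⟩ := h
  obtain ⟨C', hC', h'⟩ := h'
  refine ⟨C + C', by positivity, fun w g c hw => ?_⟩
  rw [add_mul]
  refine le_trans ?_ (add_le_add (h w g c hw) (h' w g c hw))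
  set f : Euc N → ℝ := fun x => w x - c
  have m1 := (hw.memLp_sub_const hfin c (A := A ∩ U) inter_subset_right).2.ne
  have m2 := (hw.memLp_sub_const hfin c (A := A' ∩ U) inter_subset_right).2.ne
  rw [← ENNReal.toReal_add m1 m2]
  refine ENNReal.toReal_mono (ENNReal.add_ne_top.2 ⟨m1, m2⟩) ?_
  refine (ENNReal.pow_le_pow_left_iff two_ne_zero).1 ?_
  calc _ ≤ eLpNorm f 2 (volume.restrict (A ∩ U)) ^ 2 +
        eLpNorm f 2 (volume.restrict (A' ∩ U)) ^ 2 := by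
        rw [eLpNorm_two_sq, eLpNorm_two_sq, eLpNorm_two_sq, union_inter_distrib_right]
        exact lintegral_union_le _ _ _
    _ ≤ _ := by
        rw [add_sq]
        gcongr
        exact le_self_add

theorem Controlled.of_translate {U B A A' : Set (Euc N)} (hU : IsOpen U) (hfin : volume U ≠ ⊤)
    (hA : IsOpen A) (hA' : IsOpen A') (h : Controlled U B A') {e : Euc N}
    (hAA' : ∀ z ∈ A ∩ U, z + e ∈ A')
    (hAU : ∀ z ∈ A ∩ U, ∀ τ ∈ Icc (0 : ℝ) 1, z + τ • e ∈ U) : Controlled U B A := by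
  obtain ⟨C, hC, h⟩ := h
  refine ⟨C + ‖e‖, by positivity, fun w g c hw => ?_⟩
  obtain ⟨t1, t2⟩ := hw.translation_estimate hU hfin (hA.inter hU) hAU
  have hAU1 : ∀ z ∈ A ∩ U, z + e ∈ A' ∩ U := fun z hz =>
    ⟨hAA' z hz, by simpa using hAU z hz 1 (by simp)⟩
  have m' := hw.memLp_sub_const hfin c (A := A' ∩ U) inter_subset_right
  obtain ⟨s1, s2⟩ := memLp_comp_add_right (hA'.inter hU).measurableSet hAU1 m'
  have h1 : eLpNorm (fun x => w x - c) 2 (volume.restrict (A ∩ U)) ≤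
      eLpNorm (fun z => w (z + e) - c) 2 (volume.restrict (A ∩ U)) +
        eLpNorm (fun z => w (z + e) - w z) 2 (volume.restrict (A ∩ U)) := by
    refine le_trans (le_of_eq (congrArg (fun f => eLpNorm f 2 _) ?_))
      (eLpNorm_sub_le s1.1 t1.1 (by norm_num))
    ext z; simp
  have h2 := ENNReal.toReal_mono (ENNReal.add_ne_top.2 ⟨s1.2.ne, t1.2.ne⟩) h1
  rw [ENNReal.toReal_add s1.2.ne t1.2.ne] at h2
  have h3 := ENNReal.toReal_mono m'.2.ne s2
  have h4 := h w g c hw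
  have h5 : 0 ≤ (eLpNorm (fun x => w x - c) 2 (volume.restrict B)).toReal := ENNReal.toReal_nonneg
  have h6 := norm_nonneg e
  nlinarith

/-- Poincaré inequality on a ball contained in `U`: on average over `z`, and hence for some `z`, the
constant `w z` is close to `w`. -/
theorem exists_const_ball {U : Set (Euc N)} (hU : IsOpen U) (hfin : volume U ≠ ⊤) {x₀ : Euc N}
    {ρ : ℝ} (hρ : 0 < ρ) (hB : Metric.ball x₀ ρ ⊆ U) :
    ∃ C : ℝ, 0 ≤ C ∧ ∀ (w : Euc N → ℝ) (g : Euc N → Euc N), MemH1 U w g → ∃ c : ℝ,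
      (eLpNorm (fun x => w x - c) 2 (volume.restrict (Metric.ball x₀ ρ))).toReal ≤
        C * (eLpNorm g 2 (volume.restrict U)).toReal := by
  set B := Metric.ball x₀ ρ with hBdef
  have hBpos : volume B ≠ 0 := (Metric.measure_ball_pos volume x₀ hρ).ne'
  have hBfin : volume B ≠ ⊤ := measure_ball_lt_top.ne
  have hBo : IsOpen B := Metric.isOpen_ball
  have hconv : Convex ℝ B := convex_ball x₀ ρ
  clear_value B
  set D : ℝ≥0∞ := volume (Metric.ball (0 : Euc N) (2 * ρ)) * ENNReal.ofReal (2 * ρ) ^ 2 /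
    volume B with hD
  have hDfin : D ≠ ⊤ := ENNReal.div_ne_top
    (ENNReal.mul_ne_top measure_ball_lt_top.ne (ENNReal.pow_ne_top ENNReal.ofReal_ne_top)) hBpos
  refine ⟨Real.sqrt D.toReal, Real.sqrt_nonneg _, fun w g hw => ?_⟩
  set G := eLpNorm g 2 (volume.restrict U) with hG
  have hGfin : G ≠ ⊤ := hw.memLp_grad.2.ne
  have hwB : AEStronglyMeasurable (B.indicator w) volume :=
    (aestronglyMeasurable_indicator_iff hBo.measurableSet).2
      (hw.memLp_fun.1.mono_measure (Measure.restrict_mono hB le_rfl))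
  -- the integrand of the double integral over `B × B`
  set F : Euc N × Euc N → ℝ≥0∞ := fun p =>
    (B ×ˢ B).indicator (fun p => ‖B.indicator w p.2 - B.indicator w p.1‖ₑ ^ 2) p with hF
  have hFm : AEMeasurable F (volume.prod volume) :=
    ((hwB.comp_snd.sub hwB.comp_fst).enorm.pow_const _).indicator
      (hBo.measurableSet.prod hBo.measurableSet)
  have hdouble : ∫⁻ z in B, ∫⁻ x in B, ‖w x - w z‖ₑ ^ 2 = ∫⁻ p, F p ∂(volume.prod volume) := by
    rw [lintegral_prod _ hFm, ← lintegral_indicator hBo.measurableSet]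
    congr 1; ext z
    by_cases hz : z ∈ B
    · rw [indicator_of_mem hz, ← lintegral_indicator hBo.measurableSet]
      congr 1; ext x
      by_cases hx : x ∈ B <;> simp [hF, hz, hx]
    · simp [hF, hz, indicator_of_notMem]
  have mp := measurePreserving_prod_add (volume : Measure (Euc N)) (volume : Measure (Euc N))
  have hshear : ∫⁻ p, F p ∂(volume.prod volume) = ∫⁻ h : Euc N, ∫⁻ z : Euc N, F (z, z + h) := by
    have hFm' := hFm.comp_quasiMeasurePreserving mp.quasiMeasurePreserving
    rw [← mp.map_eq] at hFm
    conv_lhs => rw [← mp.map_eq]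
    rw [lintegral_map' hFm mp.measurable.aemeasurable, lintegral_prod_symm]
    · exact hFm'
  have hslice : ∀ h : Euc N, ∫⁻ z : Euc N, F (z, z + h) ≤
      (Metric.ball (0 : Euc N) (2 * ρ)).indicator (fun _ => ENNReal.ofReal (2 * ρ) ^ 2 * G ^ 2) h := by
    intro h
    set A : Set (Euc N) := B ∩ (fun z => z + h) ⁻¹' B with hA
    have hAo : IsOpen A := hBo.inter (hBo.preimage (by fun_prop))
    have hFA : ∀ z, F (z, z + h) = A.indicator (fun z => ‖w (z + h) - w z‖ₑ ^ 2) z := by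
      intro z
      by_cases h1 : z ∈ B <;> by_cases h2 : z + h ∈ B <;> simp [hF, hA, h1, h2, indicator]
    simp_rw [hFA]
    rw [lintegral_indicator hAo.measurableSet]
    by_cases hh : h ∈ Metric.ball (0 : Euc N) (2 * ρ)
    · rw [indicator_of_mem hh]
      have hAU : ∀ z ∈ A, ∀ τ ∈ Icc (0 : ℝ) 1, z + τ • h ∈ U := fun z hz τ hτ => hB <| by
        have := hconv hz.1 hz.2 (sub_nonneg.2 hτ.2) hτ.1 (by ring)
        convert this using 1
        module
      obtain ⟨t1, t2⟩ := hw.translation_estimate hU hfin hAo hAU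
      rw [← eLpNorm_two_sq (fun z => w (z + h) - w z), ← mul_pow]
      gcongr
      rw [← ENNReal.toReal_le_toReal t1.2.ne (ENNReal.mul_ne_top ENNReal.ofReal_ne_top hGfin),
        ENNReal.toReal_mul, ENNReal.toReal_ofReal (by positivity)]
      refine t2.trans ?_
      gcongr
      exact (mem_ball_zero_iff.1 hh).le
    · rw [indicator_of_notMem hh]
      have : A = ∅ := by
        refine eq_empty_of_forall_notMem fun z hz => hh ?_
        have h1 := Metric.mem_ball.1 (hBdef ▸ hz.1 : z ∈ Metric.ball x₀ ρ)
        have h2 := Metric.mem_ball.1 (hBdef ▸ hz.2 : z + h ∈ Metric.ball x₀ ρ)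
        rw [mem_ball_zero_iff]
        have h3 : ‖h‖ = dist (z + h) z := by simp [dist_eq_norm]
        rw [h3]
        linarith [dist_triangle_right (z + h) z x₀]
      simp [this]
  have htot : ∫⁻ z in B, ∫⁻ x in B, ‖w x - w z‖ₑ ^ 2 ≤
      volume (Metric.ball (0 : Euc N) (2 * ρ)) * ENNReal.ofReal (2 * ρ) ^ 2 * G ^ 2 := by
    rw [hdouble, hshear]
    refine (lintegral_mono hslice).trans ?_
    rw [lintegral_indicator Metric.isOpen_ball.measurableSet, setLIntegral_const]
    exact le_of_eq (by ring)
  have hmeas : AEMeasurable (fun z => ∫⁻ x in B, ‖w x - w z‖ₑ ^ 2) (volume.restrict B) := by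
    have hwB' : AEStronglyMeasurable w (volume.restrict B) :=
      hw.memLp_fun.1.mono_measure (Measure.restrict_mono hB le_rfl)
    exact AEMeasurable.lintegral_prod_right'
      (f := fun p : Euc N × Euc N => ‖w p.2 - w p.1‖ₑ ^ 2)
      ((hwB'.comp_snd.sub hwB'.comp_fst).enorm.pow_const _)
  obtain ⟨z, hz, hle⟩ := exists_le_setLAverage hBpos hBfin hmeas
  refine ⟨w z, ?_⟩
  have h1 : eLpNorm (fun x => w x - w z) 2 (volume.restrict B) ^ 2 ≤ D * G ^ 2 := by
    rw [eLpNorm_two_sq]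
    refine hle.trans ?_
    rw [setLAverage_eq, hD, ENNReal.div_eq_inv_mul, ENNReal.div_eq_inv_mul, mul_assoc]
    gcongr
  have h2 := ENNReal.toReal_mono (ENNReal.mul_ne_top hDfin (ENNReal.pow_ne_top hGfin)) h1
  rw [ENNReal.toReal_pow, ENNReal.toReal_mul, ENNReal.toReal_pow] at h2
  rw [← Real.sqrt_sq (ENNReal.toReal_nonneg (a := G)), ← Real.sqrt_mul ENNReal.toReal_nonneg]
  exact Real.le_sqrt_of_sq_le h2

/-- The Poincaré inequality on a bounded connected open set every closure point of which can be
pushed into the set together with its neighbourhood. The ball estimate is propagated by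
translations, along chains of balls in the interior and inwards at the boundary. -/
theorem poincare {U : Set (Euc N)} (hU : IsOpen U) (hbdd : Bornology.IsBounded U)
    (hconn : IsConnected U)
    (hshift : ∀ x ∈ closure U, ∃ e : Euc N, ∃ δ > 0, x + e ∈ U ∧
      ∀ z ∈ Metric.ball x δ ∩ U, ∀ τ ∈ Icc (0 : ℝ) 1, z + τ • e ∈ U) :
    ∃ C : ℝ, 0 ≤ C ∧ ∀ (w : Euc N → ℝ) (g : Euc N → Euc N), MemH1 U w g → ∃ c : ℝ,
      (eLpNorm (fun x => w x - c) 2 (volume.restrict U)).toReal ≤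
        C * (eLpNorm g 2 (volume.restrict U)).toReal := by
  have hfin : volume U ≠ ⊤ := hbdd.measure_lt_top.ne
  obtain ⟨x₀, hx₀⟩ := hconn.nonempty
  obtain ⟨ρ, hρ, hB⟩ := Metric.isOpen_iff.1 hU x₀ hx₀
  set B := Metric.ball x₀ ρ
  have hBB : Controlled U B B := by
    refine ⟨1, zero_le_one, fun w g c hw => ?_⟩
    rw [inter_eq_self_of_subset_left hB, one_mul]
    exact le_add_of_nonneg_right ENNReal.toReal_nonneg
  set S : Set (Euc N) := {x | ∃ δ > 0, Controlled U B (Metric.ball x δ)} with hS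
  have hSo : IsOpen S := by
    refine Metric.isOpen_iff.2 fun x ⟨δ, hδ, h⟩ => ⟨δ / 2, by positivity, fun y hy => ?_⟩
    refine ⟨δ / 2, by positivity, h.mono hfin (Metric.ball_subset_ball' ?_)⟩
    linarith [Metric.mem_ball.1 hy]
  have hUS : U ⊆ S := by
    refine hconn.isPreconnected.subset_of_closure_inter_subset hSo ⟨x₀, hx₀, ρ, hρ, hBB⟩ ?_
    rintro x ⟨hxS, hxU⟩
    obtain ⟨σ, hσ, hball⟩ := Metric.isOpen_iff.1 hU x hxU
    obtain ⟨y, ⟨δ, hδ, hy⟩, hyx⟩ := Metric.mem_closure_iff.1 hxS (σ / 2) (by positivity)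
    refine ⟨min δ (σ / 2), by positivity, hy.of_translate hU hfin Metric.isOpen_ball
      Metric.isOpen_ball (e := y - x) (fun z hz => ?_) fun z hz τ hτ => hball ?_⟩
    · have := Metric.mem_ball.1 hz.1
      rw [Metric.mem_ball, dist_eq_norm] at *
      rw [show z + (y - x) - y = z - x by abel]
      exact this.trans_le (min_le_left _ _)
    · have h1 := Metric.mem_ball.1 hz.1
      have h2 := h1.trans_le (min_le_right _ _)
      rw [Metric.mem_ball, dist_eq_norm] at *
      rw [show z + τ • (y - x) - x = (z - x) + τ • (y - x) by abel]
      refine (norm_add_le _ _).trans_lt ?_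
      rw [norm_smul, Real.norm_of_nonneg hτ.1, norm_sub_rev y x]
      nlinarith [hτ.2, norm_nonneg (x - y)]
  have hcl : Controlled U B (closure U) := by
    have hcomp : IsCompact (closure U) := hbdd.isCompact_closure
    refine hcomp.induction_on (p := Controlled U B) ⟨0, le_rfl, fun w g c _ => by simp⟩
      (fun s t hst ht => ht.mono hfin hst) (fun s t hs ht => hs.union hfin ht) fun x hx => ?_
    obtain ⟨e, δ, hδ, he, hshift⟩ := hshift x hx
    obtain ⟨δ', hδ', h⟩ := hUS he
    refine ⟨Metric.ball x (min δ δ'), mem_nhdsWithin_of_mem_nhds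
      (Metric.ball_mem_nhds x (by positivity)), ?_⟩
    refine h.of_translate hU hfin Metric.isOpen_ball Metric.isOpen_ball (e := e)
      (fun z hz => ?_) fun z hz => hshift z ⟨Metric.ball_subset_ball (min_le_left _ _) hz.1, hz.2⟩
    have := Metric.ball_subset_ball (min_le_right _ _) hz.1
    simpa using this
  obtain ⟨C, hC, h⟩ := hcl
  obtain ⟨C', hC', h'⟩ := exists_const_ball hU hfin hρ hB
  refine ⟨C * (C' + 1), by positivity, fun w g hw => ?_⟩
  obtain ⟨c, hc⟩ := h' w g hw
  refine ⟨c, ?_⟩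
  have h1 := h w g c hw
  rw [inter_eq_self_of_subset_right subset_closure] at h1
  refine h1.trans ?_
  rw [mul_assoc, add_mul, one_mul]
  gcongr

end Poincare

/-! ### Lattices, tilings and periodization -/

section Lattice

variable {ι V F : Type*} [AddCommGroup ι] [NormedAddCommGroup V]
  [NormedAddCommGroup F]

/-- The homomorphism `l` embeds `ι` as a lattice in `V`, the translates of the half-open cell `Q`
tile `V`, and `fl x` is the index of the tile that contains `x`. -/
structure IsTiling (l : ι →+ V) (fl : V → ι) (Q : Set V) : Prop where
  sub_mem : ∀ x, x - l (fl x) ∈ Q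
  floor_add : ∀ y ∈ Q, ∀ k, fl (y + l k) = k
  finite : ∀ R : ℝ, {k | ‖l k‖ ≤ R}.Finite
  bounded : Bornology.IsBounded Q

/-- The periodization `∑ₖ χ (· + l k)` of `χ`. -/
noncomputable def periodize (l : ι →+ V) (χ : V → F) (y : V) : F := ∑ᶠ k, χ (y + l k)

namespace IsTiling

variable {l : ι →+ V} {fl : V → ι} {Q : Set V}

theorem mem_iff (h : IsTiling l fl Q) {y : V} : y ∈ Q ↔ fl y = 0 := by
  constructor
  · intro hy; simpa using h.floor_add y hy 0
  · intro hy; simpa [hy] using h.sub_mem y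

theorem floor_add_lattice (h : IsTiling l fl Q) (x : V) (k : ι) : fl (x + l k) = fl x + k := by
  have := h.floor_add _ (h.sub_mem x) (fl x + k)
  rwa [map_add, ← add_assoc, sub_add_cancel] at this

theorem exists_finset (h : IsTiling l fl Q) {S S' : Set V} (hS : Bornology.IsBounded S)
    (hS' : Bornology.IsBounded S') : ∃ K : Finset ι, ∀ y ∈ S, ∀ k, y + l k ∈ S' → k ∈ K := by
  obtain ⟨R, hR⟩ := hS.exists_norm_le
  obtain ⟨R', hR'⟩ := hS'.exists_norm_le
  refine ⟨(h.finite (R + R')).toFinset, fun y hy k hk => ?_⟩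
  simp only [Finite.mem_toFinset, mem_ofPred_eq]
  calc ‖l k‖ = ‖(y + l k) - y‖ := by simp
    _ ≤ ‖y + l k‖ + ‖y‖ := norm_sub_le _ _
    _ ≤ R + R' := by linarith [hR y hy, hR' _ hk]

theorem exists_finset_periodize (h : IsTiling l fl Q) {χ : V → F} (hχ : HasCompactSupport χ)
    {S : Set V} (hS : Bornology.IsBounded S) :
    ∃ K : Finset ι, (∀ y ∈ S, ∀ k ∉ K, χ (y + l k) = 0) ∧
      ∀ y ∈ S, periodize l χ y = ∑ k ∈ K, χ (y + l k) := by
  obtain ⟨K, hK⟩ := h.exists_finset hS hχ.isCompact.isBounded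
  have h0 : ∀ y ∈ S, ∀ k ∉ K, χ (y + l k) = 0 := fun y hy k hk =>
    image_eq_zero_of_notMem_tsupport fun h' => hk (hK y hy k h')
  refine ⟨K, h0, fun y hy => ?_⟩
  refine finsum_eq_sum_of_support_subset _ fun k hk => ?_
  by_contra hk'
  exact hk (h0 y hy k hk')

theorem periodize_add (χ : V → F) (y : V) (m : ι) :
    periodize l χ (y + l m) = periodize l χ y := by
  rw [periodize, periodize, ← finsum_comp_equiv (f := fun k => χ (y + l k)) (Equiv.addLeft m)]
  simp only [Equiv.coe_addLeft, map_add, add_assoc]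

theorem lintegral_eq_tsum [MeasurableSpace V] [BorelSpace V] {μ : Measure V}
    [μ.IsAddLeftInvariant] [Countable ι] (h : IsTiling l fl Q) (hQ : MeasurableSet Q)
    (f : V → ℝ≥0∞) : ∫⁻ x, f x ∂μ = ∑' k, ∫⁻ y in Q, f (y + l k) ∂μ := by
  have hm : ∀ k, MeasurableSet ((fun z => z - l k) ⁻¹' Q) := fun k =>
    hQ.preimage (by fun_prop)
  have hU : (⋃ k, (fun z => z - l k) ⁻¹' Q) = univ :=
    eq_univ_of_forall fun x => mem_iUnion.2 ⟨fl x, h.sub_mem x⟩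
  rw [← setLIntegral_univ, ← hU, lintegral_iUnion hm]
  · congr 1; ext k
    rw [← lintegral_indicator (hm k), ← lintegral_indicator hQ,
      ← lintegral_add_right_eq_self _ (l k)]
    congr 1; ext y
    by_cases hy : y ∈ Q <;> simp [hy, indicator]
  · intro k k' hk
    refine disjoint_left.2 fun x h1 h2 => hk ?_
    have e1 := h.floor_add _ h1 k
    have e2 := h.floor_add _ h2 k'
    simp only [sub_add_cancel] at e1 e2
    rw [← e1, e2]

/-- Freezing the lattice part of the first variable and using the second one as cell variable
preserves the measure. -/
theorem measurePreserving_unfold [MeasurableSpace V] [BorelSpace V] {μ : Measure V}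
    [μ.IsAddLeftInvariant] [Countable ι] [MeasurableSpace ι] [MeasurableSingletonClass ι]
    [SecondCountableTopology V] [SFinite μ]
    (h : IsTiling l fl Q) (hQ : MeasurableSet Q) (hfl : Measurable fl) (h1 : μ Q = 1) :
    MeasurePreserving (fun p : V × V => l (fl p.1) + p.2) (μ.prod (μ.restrict Q)) μ := by
  have hl : Measurable fun p : V × V => l (fl p.1) + p.2 :=
    ((measurable_of_countable l).comp (hfl.comp measurable_fst)).add measurable_snd
  refine ⟨hl, ?_⟩
  ext S hS
  rw [Measure.map_apply hl hS, Measure.prod_apply (hl hS), h.lintegral_eq_tsum hQ]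
  have h2 : ∀ k, ∫⁻ y in Q, (μ.restrict Q) (Prod.mk (y + l k) ⁻¹'
      ((fun p : V × V => l (fl p.1) + p.2) ⁻¹' S)) ∂μ =
      ∫⁻ y in Q, S.indicator 1 (y + l k) ∂μ := by
    intro k
    have h3 : ∀ y ∈ Q, (μ.restrict Q) (Prod.mk (y + l k) ⁻¹'
      ((fun p : V × V => l (fl p.1) + p.2) ⁻¹' S)) = (μ.restrict Q) ((fun z => z + l k) ⁻¹' S) := by
      intro y hy
      congr 1; ext z
      simp [h.floor_add y hy k, add_comm]
    rw [setLIntegral_congr_fun hQ h3, lintegral_const, Measure.restrict_apply_univ, h1, mul_one]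
    have h4 : MeasurableSet ((fun z => z + l k) ⁻¹' S) := hS.preimage (by fun_prop)
    rw [← lintegral_indicator_one h4]
    rfl
  simp_rw [h2]
  rw [← h.lintegral_eq_tsum hQ, lintegral_indicator_one hS]

theorem tsupport_periodize_subset (h : IsTiling l fl Q) {χ : V → F} (hχ : HasCompactSupport χ)
    {O : Set V} (hO : ∀ y k, y + l k ∈ O → y ∈ O) (hs : tsupport χ ⊆ O) :
    tsupport (periodize l χ) ⊆ O := by
  intro y
  contrapose!
  intro hy
  obtain ⟨K, -, hK⟩ := h.exists_finset_periodize hχ (Metric.isBounded_ball (x := y) (r := 1))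
  rw [notMem_tsupport_iff_eventuallyEq]
  have h1 : ∀ k ∈ K, ∀ᶠ z in 𝓝 y, χ (z + l k) = 0 := by
    intro k _
    have h2 : y + l k ∉ tsupport χ := fun h' => hy (hO y k (hs h'))
    have h3 := notMem_tsupport_iff_eventuallyEq.1 h2
    have h4 : Tendsto (fun z => z + l k) (𝓝 y) (𝓝 (y + l k)) :=
      (continuous_id.add continuous_const).tendsto y
    exact h4.eventually h3
  filter_upwards [Metric.ball_mem_nhds y one_pos, (Filter.eventually_all_finset K).2 h1] with z hz h2
  rw [hK z hz, Pi.zero_apply]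
  exact Finset.sum_eq_zero h2

variable [NormedSpace ℝ F]

/-- Integration of a periodic function against a compactly supported one: the latter may be
periodized. -/
theorem integral_smul_eq_periodize [MeasurableSpace V] [BorelSpace V] {μ : Measure V}
    [μ.IsAddLeftInvariant] (h : IsTiling l fl Q) (hQ : MeasurableSet Q) {χ : V → ℝ}
    (hχ : HasCompactSupport χ) {w : V → F} (hw : ∀ y k, w (y + l k) = w y)
    (hint : Integrable (fun x => χ x • w x) μ) :
    ∫ x, χ x • w x ∂μ = ∫ y in Q, periodize l χ y • w y ∂μ := by
  obtain ⟨K, h0, hK⟩ := h.exists_finset_periodize hχ h.bounded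
  have hm : ∀ k, MeasurableSet ((fun z => z - l k) ⁻¹' Q) := fun k =>
    hQ.preimage (by fun_prop)
  have h1 : ∀ x, χ x • w x =
      ∑ k ∈ K, ((fun z => z - l k) ⁻¹' Q).indicator (fun x => χ x • w x) x := by
    intro x
    by_cases hx : fl x ∈ K
    · rw [Finset.sum_eq_single_of_mem _ hx]
      · rw [indicator_of_mem]; exact h.sub_mem x
      · intro k _ hk
        refine indicator_of_notMem (fun h' => hk ?_) _
        have := h.floor_add _ h' k
        simpa using this.symm
    · have := h0 _ (h.sub_mem x) _ hx
      rw [sub_add_cancel] at this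
      simp [this, indicator]
  have h2 : ∀ k, ∫ x, ((fun z => z - l k) ⁻¹' Q).indicator (fun x => χ x • w x) x ∂μ =
      ∫ y in Q, χ (y + l k) • w y ∂μ := by
    intro k
    rw [← integral_indicator hQ, ← integral_add_right_eq_self _ (l k)]
    congr 1; ext y
    by_cases hy : y ∈ Q <;> simp [hy, indicator, hw]
  calc ∫ x, χ x • w x ∂μ = ∑ k ∈ K, ∫ y in Q, χ (y + l k) • w y ∂μ := by
        simp_rw [← h2]
        rw [← integral_finsetSum _ fun k _ => hint.indicator (hm k)]
        congr 1; ext x; exact h1 x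
    _ = ∫ y in Q, ∑ k ∈ K, χ (y + l k) • w y ∂μ := by
        rw [integral_finsetSum _ fun k _ => ?_]
        have h3 := (hint.indicator (hm k)).comp_add_right (l k)
        refine (integrable_indicator_iff hQ).1 (h3.congr (Eventually.of_forall fun y => ?_))
        by_cases hy : y ∈ Q <;> simp [hy, indicator, hw]
    _ = _ := by
        refine setIntegral_congr_fun hQ fun y hy => ?_
        simp only [hK y hy, Finset.sum_smul]

variable [NormedSpace ℝ V]

/-- Periodization preserves smoothness, as it is locally a finite sum. -/
theorem contDiff_periodize (h : IsTiling l fl Q) {χ : V → F} (hχ : HasCompactSupport χ)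
    {n : ℕ∞ω} (hs : ContDiff ℝ n χ) : ContDiff ℝ n (periodize l χ) := by
  refine contDiff_iff_contDiffAt.2 fun y => ?_
  obtain ⟨K, -, hK⟩ := h.exists_finset_periodize hχ (Metric.isBounded_ball (x := y) (r := 1))
  have h1 : periodize l χ =ᶠ[𝓝 y] fun y => ∑ k ∈ K, χ (y + l k) := by
    filter_upwards [Metric.ball_mem_nhds y one_pos] with z hz using hK z hz
  refine ContDiffAt.congr_of_eventuallyEq ?_ h1
  exact ContDiffAt.sum fun k _ => (hs.comp (contDiff_id.add contDiff_const)).contDiffAt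

theorem fderiv_periodize (h : IsTiling l fl Q) {χ : V → F} (hχ : HasCompactSupport χ)
    (hs : Differentiable ℝ χ) (y e : V) :
    fderiv ℝ (periodize l χ) y e = periodize l (fun z => fderiv ℝ χ z e) y := by
  obtain ⟨K, h0, hK⟩ := h.exists_finset_periodize hχ (Metric.isBounded_ball (x := y) (r := 1))
  have hy : y ∈ Metric.ball y 1 := Metric.mem_ball_self one_pos
  have h1 : periodize l χ =ᶠ[𝓝 y] fun y => ∑ k ∈ K, χ (y + l k) := by
    filter_upwards [Metric.ball_mem_nhds y one_pos] with z hz using hK z hz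
  rw [h1.fderiv_eq, fderiv_fun_sum fun k _ => by fun_prop]
  simp only [fderiv_comp_add_right, FunLike.coe_sum, Finset.sum_apply]
  rw [periodize, finsum_eq_sum_of_support_subset]
  intro k hk
  by_contra hk'
  refine hk ?_
  have h2 : (fun z => χ (z + l k)) =ᶠ[𝓝 y] fun _ => 0 := by
    filter_upwards [Metric.ball_mem_nhds y one_pos] with z hz using h0 z hz k hk'
  have h3 := h2.fderiv_eq (𝕜 := ℝ)
  rw [fderiv_comp_add_right] at h3
  simp [h3]

variable [MeasurableSpace V] [BorelSpace V] {μ : Measure V}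

theorem measurePreserving_unfold_smul [FiniteDimensional ℝ V] [Countable ι] [MeasurableSpace ι]
    [MeasurableSingletonClass ι] [μ.IsAddHaarMeasure]
    (h : IsTiling l fl Q) (hQ : MeasurableSet Q) (hfl : Measurable fl) (h1 : μ Q = 1)
    {ε : ℝ} (hε : 0 < ε) :
    MeasurePreserving (fun p : V × V => ε • (l (fl (ε⁻¹ • p.1)) + p.2))
      (μ.prod (μ.restrict Q)) μ := by
  have hs : ∀ δ : ℝ, 0 < δ → MeasurePreserving (fun x : V => δ • x) μ
      (ENNReal.ofReal ((δ ^ Module.finrank ℝ V)⁻¹) • μ) := fun δ hδ => by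
    refine ⟨by fun_prop, ?_⟩
    rw [Measure.map_addHaar_smul _ hδ.ne', abs_of_pos (by positivity)]
  have e1 := (hs ε⁻¹ (by positivity)).prod (MeasurePreserving.id (μ.restrict Q))
  have e2 := (h.measurePreserving_unfold (μ := μ) hQ hfl h1).smul_measure
    (ENNReal.ofReal ((ε⁻¹ ^ Module.finrank ℝ V)⁻¹))
  rw [← Measure.prod_smul_left] at e2
  have e3 := (hs ε hε).smul_measure (ENNReal.ofReal ((ε⁻¹ ^ Module.finrank ℝ V)⁻¹))
  have e4 := e3.comp (e2.comp e1)
  have h2 : (ε⁻¹ ^ Module.finrank ℝ V)⁻¹ * (ε ^ Module.finrank ℝ V)⁻¹ = 1 := by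
    rw [inv_pow, inv_inv]; exact mul_inv_cancel₀ (by positivity)
  rw [smul_smul, ← ENNReal.ofReal_mul (by positivity), h2, ENNReal.ofReal_one, one_smul] at e4
  exact e4

end IsTiling

end Lattice

/-! ### The perforated unit cell -/

section Geometry

variable {N : ℕ}

/-- `latticeVec` as a homomorphism. -/
noncomputable def latticeHom (N : ℕ) : (Fin N → ℤ) →+ Euc N where
  toFun := latticeVec
  map_zero' := by ext i; simp [latticeVec]
  map_add' k m := by ext i; simp [latticeVec]

theorem latticeHom_apply (k : Fin N → ℤ) : latticeHom N k = latticeVec k := rfl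

theorem latticeVec_add (k m : Fin N → ℤ) : latticeVec (k + m) = latticeVec k + latticeVec m :=
  map_add (latticeHom N) k m

theorem latticeVec_sub (k m : Fin N → ℤ) : latticeVec (k - m) = latticeVec k - latticeVec m :=
  map_sub (latticeHom N) k m

theorem latticeVec_coord (k : Fin N → ℤ) (i : Fin N) : latticeVec k i = k i := rfl

/-- The index of the lattice cell containing `x`. -/
noncomputable def cellIndex (x : Euc N) : Fin N → ℤ := fun i => ⌊x i⌋

/-- The half-open unit cube `[0,1)^N`. -/
def halfOpenCell (N : ℕ) : Set (Euc N) := {y | ∀ i, y i ∈ Ico (0 : ℝ) 1}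

theorem unitCell_subset_halfOpenCell : unitCell N ⊆ halfOpenCell N :=
  fun _ hy i => ⟨(hy i).1.le, (hy i).2⟩

theorem norm_le_of_mem_halfOpenCell {y : Euc N} (hy : y ∈ halfOpenCell N) : ‖y‖ ≤ √N := by
  rw [EuclideanSpace.norm_eq]
  apply Real.sqrt_le_sqrt
  calc ∑ i, ‖y i‖ ^ 2 ≤ ∑ _i : Fin N, (1 : ℝ) := by
        refine Finset.sum_le_sum fun i _ => ?_
        rw [Real.norm_of_nonneg (hy i).1]
        exact pow_le_one₀ (hy i).1 (hy i).2.le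
    _ = N := by simp

theorem isTiling_latticeHom : IsTiling (latticeHom N) cellIndex (halfOpenCell N) where
  sub_mem x i := by
    simp only [latticeHom_apply, PiLp.sub_apply, latticeVec_coord, cellIndex]
    exact ⟨Int.fract_nonneg _, Int.fract_lt_one _⟩
  floor_add y hy k := by
    ext i
    simp only [cellIndex, latticeHom_apply, PiLp.add_apply, latticeVec_coord, Int.floor_add_intCast]
    rw [Int.floor_eq_zero_iff.2 (hy i), zero_add]
  finite R := by
    refine (Set.finite_Icc (fun _ : Fin N => -⌈R⌉) (fun _ => ⌈R⌉)).subset fun k hk => ?_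
    have h : ∀ i, |(k i : ℝ)| ≤ R := fun i => (PiLp.norm_apply_le (latticeVec k) i).trans hk
    refine ⟨fun i => ?_, fun i => ?_⟩
    · have := (abs_le.1 (h i)).1
      have h2 := Int.le_ceil R
      have h3 : (-⌈R⌉ : ℝ) ≤ k i := by linarith
      exact_mod_cast h3
    · have := (abs_le.1 (h i)).2
      have h2 := Int.le_ceil R
      have h3 : (k i : ℝ) ≤ ⌈R⌉ := by linarith
      exact_mod_cast h3
  bounded := isBounded_iff_forall_norm_le.2 ⟨√N, fun _ hy => norm_le_of_mem_halfOpenCell hy⟩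

theorem isTiling_intCast : IsTiling (Int.castAddHom ℝ) Int.floor (Ico (0 : ℝ) 1) where
  sub_mem x := ⟨Int.fract_nonneg x, Int.fract_lt_one x⟩
  floor_add y hy k := by simp [Int.floor_eq_zero_iff.2 hy]
  finite R := by
    refine (Set.finite_Icc (-⌈R⌉) ⌈R⌉).subset fun k hk => ?_
    have h : |(k : ℝ)| ≤ R := hk
    have h2 := Int.le_ceil R
    constructor
    · have h3 : (-⌈R⌉ : ℝ) ≤ k := by linarith [(abs_le.1 h).1]
      exact_mod_cast h3
    · have h3 : (k : ℝ) ≤ ⌈R⌉ := by linarith [(abs_le.1 h).2]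
      exact_mod_cast h3
  bounded := Metric.isBounded_Ico 0 1

theorem measurable_cellIndex : Measurable (cellIndex : Euc N → Fin N → ℤ) :=
  measurable_pi_lambda _ fun i => Int.measurable_floor.comp (by fun_prop)

theorem measurableSet_halfOpenCell : MeasurableSet (halfOpenCell N) := by
  rw [halfOpenCell, ofPred_forall]
  exact MeasurableSet.iInter fun i => measurableSet_Ico.preimage (by fun_prop)

theorem isOpen_unitCell : IsOpen (unitCell N) := by
  rw [unitCell, ofPred_forall]
  exact isOpen_iInter_of_finite fun i => isOpen_Ioo.preimage (by fun_prop)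

theorem unitCell_ae_eq : unitCell N =ᵐ[volume] halfOpenCell N := by
  have mp := EuclideanSpace.volume_preserving_symm_measurableEquiv_toLp (Fin N)
  have h1 : (univ.pi fun _ : Fin N => Ioo (0 : ℝ) 1) =ᵐ[volume] univ.pi fun _ => Ico (0 : ℝ) 1 :=
    (Measure.univ_pi_Ioo_ae_eq_Icc (f := fun _ : Fin N => (0 : ℝ)) (g := fun _ => 1)).trans
      (Measure.univ_pi_Ico_ae_eq_Icc (f := fun _ : Fin N => (0 : ℝ)) (g := fun _ => 1)).symm
  have h2 := mp.quasiMeasurePreserving.preimage_ae_eq h1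
  have e1 : unitCell N = (MeasurableEquiv.toLp 2 (Fin N → ℝ)).symm ⁻¹'
      (univ.pi fun _ : Fin N => Ioo (0 : ℝ) 1) := by ext y; simp [unitCell]
  have e2 : halfOpenCell N = (MeasurableEquiv.toLp 2 (Fin N → ℝ)).symm ⁻¹'
      (univ.pi fun _ : Fin N => Ico (0 : ℝ) 1) := by ext y; simp [halfOpenCell]
  rw [e1, e2]
  exact h2

theorem volume_halfOpenCell : volume (halfOpenCell N) = 1 := by
  have mp := EuclideanSpace.volume_preserving_symm_measurableEquiv_toLp (Fin N)
  have h : halfOpenCell N = (MeasurableEquiv.toLp 2 (Fin N → ℝ)).symm ⁻¹'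
      (univ.pi fun _ : Fin N => Ico (0 : ℝ) 1) := by
    ext y; simp [halfOpenCell]
  rw [h, mp.measure_preimage_equiv, Real.volume_pi_Ico]
  simp

theorem volume_unitCell : volume (unitCell N) = 1 := by
  rw [measure_congr unitCell_ae_eq, volume_halfOpenCell]

theorem restrict_unitCell_eq :
    (volume : Measure (Euc N)).restrict (unitCell N) = volume.restrict (halfOpenCell N) :=
  Measure.restrict_congr_set unitCell_ae_eq

variable {YH : Set (Euc N)}

theorem mem_perStar_iff (hsub : YH ⊆ unitCell N) {y : Euc N} :
    y ∈ perStar YH ↔ y - latticeVec (cellIndex y) ∉ YH := by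
  refine ⟨fun h => h _, fun h k hk => h ?_⟩
  have := isTiling_latticeHom.floor_add _ (unitCell_subset_halfOpenCell (hsub hk)) k
  rw [latticeHom_apply, sub_add_cancel] at this
  rwa [this]

theorem perStar_add_iff {y : Euc N} {k : Fin N → ℤ} :
    y + latticeVec k ∈ perStar YH ↔ y ∈ perStar YH := by
  constructor
  · intro h m hm
    refine h (m + k) ?_
    rw [latticeVec_add]
    convert hm using 1; abel
  · intro h m hm
    refine h (m - k) ?_
    rw [latticeVec_sub]
    convert hm using 1; abel

theorem isOpen_perStar (hc : IsCompact YH) : IsOpen (perStar YH) := by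
  refine isOpen_iff_mem_nhds.2 fun y hy => ?_
  obtain ⟨K, hK⟩ := isTiling_latticeHom.exists_finset hc.isBounded
    (Metric.isBounded_ball (x := y) (r := 1))
  have h1 : ∀ k ∈ K, ∀ᶠ z in 𝓝 y, z - latticeVec k ∉ YH := fun k _ =>
    (hc.isClosed.isOpen_compl.preimage (by fun_prop : Continuous fun z => z - latticeVec k)).mem_nhds
      (hy k)
  filter_upwards [(Filter.eventually_all_finset K).2 h1, Metric.ball_mem_nhds y one_pos] with z hz hb
  intro k hk
  refine hz k (hK _ hk k ?_) hk
  rwa [latticeHom_apply, sub_add_cancel]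

theorem cellStar_eq (hsub : YH ⊆ unitCell N) : cellStar YH = unitCell N ∩ perStar YH := by
  ext y
  simp only [cellStar, Set.mem_sdiff, mem_inter_iff, and_congr_right_iff]
  intro hy
  rw [mem_perStar_iff hsub, isTiling_latticeHom.mem_iff.1 (unitCell_subset_halfOpenCell hy),
    ← latticeHom_apply, map_zero, sub_zero]

theorem isOpen_cellStar (hc : IsCompact YH) : IsOpen (cellStar YH) :=
  isOpen_unitCell.sdiff hc.isClosed

theorem isBounded_cellStar : Bornology.IsBounded (cellStar YH) :=
  isTiling_latticeHom.bounded.subset (sdiff_subset.trans unitCell_subset_halfOpenCell)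

theorem volume_cellStar_lt_top : volume (cellStar YH) < ⊤ := isBounded_cellStar.measure_lt_top

instance : IsFiniteMeasure (volume.restrict (cellStar YH)) := ⟨by simpa using volume_cellStar_lt_top⟩

/-- Near a boundary point of a set with smooth boundary, the complement of the set is pushed into
itself by small shifts in a direction in which the defining function increases. -/
theorem HasSmoothBoundary.exists_shift (hs : HasSmoothBoundary YH) (hcl : IsClosed YH) {x : Euc N}
    (hx : x ∈ frontier YH) {σ : ℝ} (hσ : 0 < σ) : ∃ e : Euc N, ∃ δ > 0, ‖e‖ < σ ∧ x + e ∉ YH ∧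
      ∀ z ∈ Metric.ball x δ, z ∉ YH → ∀ τ ∈ Icc (0 : ℝ) 1, z + τ • e ∉ YH := by
  obtain ⟨V, hV, hxV, ρ, hρ, hρ', hint, hclos⟩ := hs x hx
  rw [hcl.closure_eq] at hclos
  have hout : ∀ y ∈ V, y ∉ YH ↔ 0 < ρ y := by
    intro y hy
    have := Set.ext_iff.1 hclos y
    simp only [mem_inter_iff, hy, and_true, mem_ofPred_eq, true_and] at this
    rw [this, not_le]
  have hρx : 0 ≤ ρ x := by
    have h1 : x ∉ interior YH := hx.2
    have := Set.ext_iff.1 hint x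
    simp only [mem_inter_iff, hxV, and_true, mem_ofPred_eq, true_and] at this
    rw [this, not_lt] at h1
    exact h1
  obtain ⟨v, hv⟩ : ∃ v, 0 < fderiv ℝ ρ x v := by
    by_contra! h
    refine hρ' x hxV (ContinuousLinearMap.ext fun v => le_antisymm (h v) ?_)
    have := h (-v)
    rw [map_neg] at this
    simpa using this
  have hcont : ContinuousOn (fun y => fderiv ℝ ρ y v) V :=
    (hρ.continuousOn_fderiv_of_isOpen hV (by simp)).clm_apply continuousOn_const
  have hev : ∀ᶠ y in 𝓝 x, y ∈ V ∧ 0 < fderiv ℝ ρ y v :=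
    Filter.Eventually.and (hV.mem_nhds hxV)
      ((hcont.continuousAt (hV.mem_nhds hxV)).eventually (lt_mem_nhds hv))
  obtain ⟨δ, hδ, hball⟩ := Metric.eventually_nhds_iff_ball.1 hev
  have hv0 : v ≠ 0 := by rintro rfl; simp at hv
  have hvn : 0 < ‖v‖ := norm_pos_iff.2 hv0
  set c : ℝ := min (δ / 2) (σ / 2) / ‖v‖ with hc
  have hcpos : 0 < c := by positivity
  have hcv : ‖c • v‖ = min (δ / 2) (σ / 2) := by
    rw [norm_smul, Real.norm_of_nonneg hcpos.le, hc, div_mul_cancel₀ _ hvn.ne']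
  have hcv1 : ‖c • v‖ ≤ δ / 2 := hcv.trans_le (min_le_left _ _)
  have hcv2 : ‖c • v‖ ≤ σ / 2 := hcv.trans_le (min_le_right _ _)
  have hmem : ∀ z ∈ Metric.ball x (δ / 2), ∀ τ ∈ Icc (0 : ℝ) 1,
      z + τ • c • v ∈ Metric.ball x δ := by
    intro z hz τ hτ
    rw [Metric.mem_ball, dist_eq_norm] at *
    rw [show z + τ • c • v - x = (z - x) + τ • c • v by abel]
    refine (norm_add_le _ _).trans_lt ?_
    rw [norm_smul τ, Real.norm_of_nonneg hτ.1]
    nlinarith [hτ.2, norm_nonneg (c • v)]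
  -- on segments in the direction `v` the defining function increases
  have hmono : ∀ z ∈ Metric.ball x (δ / 2), StrictMonoOn (fun τ : ℝ => ρ (z + τ • c • v))
      (Icc 0 1) := by
    intro z hz
    have hd : ∀ τ ∈ Icc (0 : ℝ) 1, HasDerivAt (fun τ : ℝ => ρ (z + τ • c • v))
        (c * fderiv ℝ ρ (z + τ • c • v) v) τ := by
      intro τ hτ
      have hV' := (hball _ (hmem z hz τ hτ)).1
      have h1 : HasDerivAt (fun τ : ℝ => z + τ • c • v) (c • v) τ := by
        simpa using ((hasDerivAt_id τ).smul_const (c • v)).const_add z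
      have h2 := ((hρ.contDiffAt (hV.mem_nhds hV')).differentiableAt (by simp)).hasFDerivAt
      have h3 := h2.comp_hasDerivAt τ h1
      rw [map_smul, smul_eq_mul] at h3
      exact h3
    refine strictMonoOn_of_deriv_pos (convex_Icc 0 1)
      (fun τ hτ => (hd τ hτ).continuousAt.continuousWithinAt) fun τ hτ => ?_
    rw [interior_Icc] at hτ
    have hτ' := Ioo_subset_Icc_self hτ
    rw [(hd τ hτ').deriv]
    exact mul_pos hcpos (hball _ (hmem z hz τ hτ')).2
  refine ⟨c • v, δ / 2, by positivity, by linarith, ?_, fun z hz hzY τ hτ => ?_⟩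
  · have hxb : x ∈ Metric.ball x (δ / 2) := Metric.mem_ball_self (by positivity)
    have h1 := hmono x hxb (left_mem_Icc.2 zero_le_one) (right_mem_Icc.2 zero_le_one) one_pos
    have h2 := hmem x hxb 1 (by simp)
    simp only [zero_smul, add_zero, one_smul] at h1 h2
    exact (hout _ (hball _ h2).1).2 (hρx.trans_lt h1)
  · have h1 := (hmono z hz).monotoneOn (left_mem_Icc.2 zero_le_one) hτ hτ.1
    have hzV : z ∈ V := (hball z (Metric.ball_subset_ball (by linarith) hz)).1
    simp only [zero_smul, add_zero] at h1
    exact (hout _ (hball _ (hmem z hz τ hτ)).1).2 (((hout z hzV).1 hzY).trans_le h1)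

theorem closure_unitCell_subset : closure (unitCell N) ⊆ {y | ∀ i, y i ∈ Icc (0 : ℝ) 1} := by
  refine closure_minimal (fun y hy i => Ioo_subset_Icc_self (hy i)) ?_
  rw [ofPred_forall]
  exact isClosed_iInter fun i => isClosed_Icc.preimage (by fun_prop)

/-- Poincaré inequality on the perforated unit cell. -/
theorem poincare_cellStar (hc : IsCompact YH) (hsub : YH ⊆ unitCell N)
    (hs : HasSmoothBoundary YH) (hconn : IsConnected (cellStar YH)) :
    ∃ C : ℝ, 0 ≤ C ∧ ∀ (w : Euc N → ℝ) (g : Euc N → Euc N), MemH1 (cellStar YH) w g → ∃ c : ℝ,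
      (eLpNorm (fun x => w x - c) 2 (volume.restrict (cellStar YH))).toReal ≤
        C * (eLpNorm g 2 (volume.restrict (cellStar YH))).toReal := by
  refine poincare (isOpen_cellStar hc) isBounded_cellStar hconn fun x hx => ?_
  have hxY : x ∉ interior YH := by
    intro h
    obtain ⟨z, hz, hz'⟩ := mem_closure_iff.1 hx _ isOpen_interior h
    exact hz'.2 (interior_subset hz)
  by_cases hxc : x ∈ unitCell N
  · by_cases hxH : x ∈ YH
    · -- a point on the boundary of the hole is pushed away from the hole, staying in the cube
      obtain ⟨σ, hσ, hball⟩ := Metric.isOpen_iff.1 isOpen_unitCell x hxc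
      obtain ⟨e, δ, hδ, he, hxe, h⟩ := hs.exists_shift hc.isClosed
        ⟨subset_closure hxH, hxY⟩ (half_pos hσ)
      refine ⟨e, min δ (σ / 2), by positivity, ⟨hball ?_, hxe⟩, fun z hz τ hτ => ⟨hball ?_, ?_⟩⟩
      · simp only [Metric.mem_ball, dist_self_add_left]; linarith
      · have h1 := (Metric.mem_ball.1 hz.1).trans_le (min_le_right _ _)
        rw [Metric.mem_ball, dist_eq_norm] at *
        rw [show z + τ • e - x = (z - x) + τ • e by abel]
        refine (norm_add_le _ _).trans_lt ?_
        rw [norm_smul τ, Real.norm_of_nonneg hτ.1]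
        nlinarith [hτ.2, norm_nonneg e, hτ.1]
      · exact h z (Metric.ball_subset_ball (min_le_left _ _) hz.1) hz.2.2 τ hτ
    · refine ⟨0, 1, one_pos, by simpa using ⟨hxc, hxH⟩, fun z hz τ _ => by simpa using hz.2⟩
  · -- a point on the faces of the cube is pushed towards the centre
    have hxH : x ∉ YH := fun h => hxc (hsub h)
    have hx01 := closure_unitCell_subset (closure_mono sdiff_subset hx)
    obtain ⟨σ, hσ, hball⟩ := Metric.isOpen_iff.1 hc.isClosed.isOpen_compl x hxH
    set o : Euc N := WithLp.toLp 2 fun _ => (1 / 2 : ℝ) with ho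
    set c : ℝ := min (1 / 2) (σ / (4 * (‖o - x‖ + 1))) with hcdef
    have hcpos : 0 < c := by positivity
    have hc1 : c ≤ 1 / 2 := min_le_left _ _
    have hcn : ‖c • (o - x)‖ < σ / 2 := by
      rw [norm_smul, Real.norm_of_nonneg hcpos.le]
      have h1 : c * (4 * (‖o - x‖ + 1)) ≤ σ := by
        have := min_le_right (1 / 2) (σ / (4 * (‖o - x‖ + 1)))
        rwa [← hcdef, le_div_iff₀ (by positivity)] at this
      nlinarith [norm_nonneg (o - x)]
    have hcoord : ∀ (z : Euc N) (τ : ℝ) (i : Fin N),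
        (z + τ • c • (o - x)) i = z i + τ * (c * (1 / 2 - x i)) := by
      intro z τ i; simp [ho]
    have hn : ∀ z ∈ Metric.ball x (min (σ / 2) (1 / 4)), ∀ τ ∈ Icc (0 : ℝ) 1,
        z + τ • c • (o - x) ∉ YH := by
      intro z hz τ hτ
      refine hball ?_
      have h1 := (Metric.mem_ball.1 hz).trans_le (min_le_left _ _)
      rw [Metric.mem_ball, dist_eq_norm] at *
      rw [show z + τ • c • (o - x) - x = (z - x) + τ • c • (o - x) by abel]
      refine (norm_add_le _ _).trans_lt ?_
      rw [norm_smul τ, Real.norm_of_nonneg hτ.1]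
      nlinarith [hτ.2, norm_nonneg (c • (o - x)), hτ.1]
    refine ⟨c • (o - x), min (σ / 2) (1 / 4), by positivity, ⟨fun i => ?_, ?_⟩,
      fun z hz τ hτ => ⟨fun i => ?_, hn z hz.1 τ hτ⟩⟩
    · have := hcoord x 1 i
      rw [one_smul, one_mul] at this
      rw [this]
      have h2 := hx01 i
      constructor <;> nlinarith [h2.1, h2.2]
    · simpa using hn x (Metric.mem_ball_self (by positivity)) 1 (by simp)
    · rw [hcoord]
      have h2 := hx01 i
      have h3 := hz.2.1 i
      have h4 : |z i - x i| < 1 / 4 := by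
        have h5 := (Metric.mem_ball.1 hz.1).trans_le (min_le_right _ _)
        rw [dist_eq_norm] at h5
        exact (PiLp.norm_apply_le (z - x) i).trans_lt h5
      rw [abs_lt] at h4
      have h6 : 0 ≤ τ * c := mul_nonneg hτ.1 hcpos.le
      have h7 : τ * c ≤ 1 / 2 := by nlinarith [hτ.1, hτ.2]
      rw [← mul_assoc]
      rcases le_total (x i) (1 / 2) with h8 | h8
      · refine ⟨by nlinarith [h3.1], ?_⟩
        nlinarith [h2.1, h2.2]
      · refine ⟨?_, by nlinarith [h3.2]⟩
        nlinarith [h2.1, h2.2]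

end Geometry

/-! ### Periodic Sobolev functions on the perforated cell -/

section Cell

variable {N : ℕ} {YH : Set (Euc N)}

/-- The space `ℝ × ℝ^N` with its Hilbert norm, in which a function and its gradient take their
joint values. -/
abbrev Jet (N : ℕ) : Type := WithLp 2 (ℝ × Euc N)

/-- The element of `Jet N` with given components. -/
def jet (a : ℝ) (v : Euc N) : Jet N := WithLp.toLp 2 (a, v)

@[simp] theorem jet_fst (a : ℝ) (v : Euc N) : (jet a v).fst = a := rfl

@[simp] theorem jet_snd (a : ℝ) (v : Euc N) : (jet a v).snd = v := rfl

theorem inner_jet (j k : Jet N) : (inner ℝ j k : ℝ) = j.fst * k.fst + inner ℝ j.snd k.snd := by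
  rw [WithLp.prod_inner_apply]
  simp [mul_comm]

theorem norm_jet_sq (j : Jet N) : ‖j‖ ^ 2 = ‖j.fst‖ ^ 2 + ‖j.snd‖ ^ 2 :=
  WithLp.prod_norm_sq_eq_of_L2 j

theorem norm_jet_fst_le (j : Jet N) : ‖j.fst‖ ≤ ‖j‖ := by
  refine le_of_sq_le_sq ?_ (norm_nonneg _)
  rw [norm_jet_sq]; nlinarith [sq_nonneg ‖j.snd‖]

theorem norm_jet_snd_le (j : Jet N) : ‖j.snd‖ ≤ ‖j‖ := by
  refine le_of_sq_le_sq ?_ (norm_nonneg _)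
  rw [norm_jet_sq]; nlinarith [sq_nonneg ‖j.fst‖]

theorem norm_jet_le (a : ℝ) (v : Euc N) : ‖jet a v‖ ≤ ‖a‖ + ‖v‖ := by
  refine le_of_sq_le_sq ?_ (by positivity)
  rw [norm_jet_sq]; simp only [jet_fst, jet_snd]; nlinarith [mul_nonneg (norm_nonneg a) (norm_nonneg v)]

theorem continuous_jet_fst : Continuous fun j : Jet N => j.fst :=
  continuous_fst.comp (WithLp.prod_continuous_ofLp 2 ℝ (Euc N))

theorem continuous_jet_snd : Continuous fun j : Jet N => j.snd :=
  continuous_snd.comp (WithLp.prod_continuous_ofLp 2 ℝ (Euc N))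

theorem continuous_jet : Continuous fun p : ℝ × Euc N => jet p.1 p.2 :=
  WithLp.prod_continuous_toLp 2 ℝ (Euc N)

section Measurability

variable {α : Type*} [MeasurableSpace α] {μ : Measure α}

theorem memLp_jet_fst {k : α → Jet N} (hk : MemLp k 2 μ) : MemLp (fun x => (k x).fst) 2 μ :=
  hk.mono (continuous_jet_fst.comp_aestronglyMeasurable hk.1)
    (Eventually.of_forall fun _ => norm_jet_fst_le _)

theorem memLp_jet_snd {k : α → Jet N} (hk : MemLp k 2 μ) : MemLp (fun x => (k x).snd) 2 μ :=
  hk.mono (continuous_jet_snd.comp_aestronglyMeasurable hk.1)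
    (Eventually.of_forall fun _ => norm_jet_snd_le _)

theorem aestronglyMeasurable_jet {f : α → ℝ} {g : α → Euc N} (hf : AEStronglyMeasurable f μ)
    (hg : AEStronglyMeasurable g μ) : AEStronglyMeasurable (fun x => jet (f x) (g x)) μ :=
  continuous_jet.comp_aestronglyMeasurable (hf.prodMk hg)

theorem memLp_jet {f : α → ℝ} {g : α → Euc N} (hf : MemLp f 2 μ) (hg : MemLp g 2 μ) :
    MemLp (fun x => jet (f x) (g x)) 2 μ := by
  refine (hf.norm.add hg.norm).mono (aestronglyMeasurable_jet hf.1 hg.1)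
    (Eventually.of_forall fun x => ?_)
  refine (norm_jet_le _ _).trans ?_
  exact le_abs_self (‖f x‖ + ‖g x‖)

theorem integral_inner_jet {j k : α → Jet N} (hj : MemLp j 2 μ) (hk : MemLp k 2 μ) :
    ∫ x, inner ℝ (j x) (k x) ∂μ =
      ∫ x, (j x).fst * (k x).fst ∂μ + ∫ x, inner ℝ (j x).snd (k x).snd ∂μ := by
  rw [← integral_add]
  · simp_rw [inner_jet]
  · exact integrable_smul_of_memLp (memLp_jet_fst hj) (memLp_jet_fst hk)
  · exact integrable_inner_of_memLp (memLp_jet_snd hj) (memLp_jet_snd hk)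

end Measurability

/-- Smooth periodic functions supported away from the holes. -/
structure IsPerTest (YH : Set (Euc N)) (η : Euc N → ℝ) : Prop where
  smooth : ContDiff ℝ ∞ η
  periodic : ∀ y k, η (y + latticeVec k) = η y
  support_subset : tsupport η ⊆ perStar YH

/-- The pairs `(∂ₑη, η e)`, with `η` a smooth periodic function supported away from the holes.
A pair `(w, g)` is orthogonal to all of them in `L²(Y*)` exactly if `g` is the weak gradient of
the periodic extension of `w`. -/
def cellTests (YH : Set (Euc N)) : Set (Euc N → Jet N) :=
  {τ | ∃ (η : Euc N → ℝ) (e : Euc N), IsPerTest YH η ∧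
    τ = fun y => jet (fderiv ℝ η y e) (η y • e)}

theorem exists_bound_of_periodic {F : Type*} [NormedAddCommGroup F] {f : Euc N → F}
    (hf : Continuous f) (hp : ∀ y k, f (y + latticeVec k) = f y) : ∃ C, ∀ y, ‖f y‖ ≤ C := by
  obtain ⟨C, hC⟩ := (isTiling_latticeHom (N := N)).bounded.isCompact_closure.exists_bound_of_continuousOn
    hf.continuousOn
  refine ⟨C, fun y => ?_⟩
  have h := hC _ (subset_closure (isTiling_latticeHom.sub_mem y))
  rw [← hp _ (cellIndex y), latticeHom_apply, sub_add_cancel] at h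
  exact h

theorem IsPerTest.fderiv_periodic {η : Euc N → ℝ} (h : IsPerTest YH η) (e y : Euc N)
    (k : Fin N → ℤ) : fderiv ℝ η (y + latticeVec k) e = fderiv ℝ η y e := by
  have : (fun z => η (z + latticeVec k)) = η := funext fun z => h.periodic z k
  conv_rhs => rw [← this, fderiv_comp_add_right]

theorem IsPerTest.continuous_fderiv {η : Euc N → ℝ} (h : IsPerTest YH η) (e : Euc N) :
    Continuous fun y => fderiv ℝ η y e :=
  (h.smooth.continuous_fderiv (by simp)).clm_apply continuous_const

theorem memLp_of_periodic {F : Type*} [NormedAddCommGroup F] [SecondCountableTopology F]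
    {f : Euc N → F}
    (hf : Continuous f) (hp : ∀ y k, f (y + latticeVec k) = f y) :
    MemLp f 2 (volume.restrict (cellStar YH)) := by
  obtain ⟨C, hC⟩ := exists_bound_of_periodic hf hp
  exact MemLp.of_bound hf.aestronglyMeasurable C (Eventually.of_forall hC)

theorem memLp_cellTests : ∀ τ ∈ cellTests YH, MemLp τ 2 (volume.restrict (cellStar YH)) := by
  rintro _ ⟨η, e, hη, rfl⟩
  refine memLp_jet (memLp_of_periodic (hη.continuous_fderiv e) (hη.fderiv_periodic e))
    (memLp_of_periodic (hη.smooth.continuous.smul continuous_const) fun y k => ?_)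
  rw [hη.periodic]

/-- The periodic extension of a function on the perforated cell, by zero in the holes and, as a
convention of no consequence, on the faces of the cells. -/
noncomputable def perExt {F : Type*} [Zero F] (YH : Set (Euc N)) (f : Euc N → F) (y : Euc N) : F :=
  (cellStar YH).indicator f (y - latticeVec (cellIndex y))

section PerExt

variable {F : Type*} [NormedAddCommGroup F]

theorem perExt_periodic (f : Euc N → F) (y : Euc N) (k : Fin N → ℤ) :
    perExt YH f (y + latticeVec k) = perExt YH f y := by
  have := isTiling_latticeHom.floor_add_lattice y k
  rw [latticeHom_apply] at this
  rw [perExt, perExt, this, latticeVec_add]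
  congr 1; abel

theorem perExt_of_mem {f : Euc N → F} {y : Euc N} (hy : y ∈ cellStar YH) :
    perExt YH f y = f y := by
  have := isTiling_latticeHom.mem_iff.1 (unitCell_subset_halfOpenCell hy.1)
  rw [perExt, this, ← latticeHom_apply, map_zero, sub_zero, indicator_of_mem hy]

theorem perExt_of_mem_halfOpenCell {f : Euc N → F} {y : Euc N} (hy : y ∈ halfOpenCell N) :
    perExt YH f y = (cellStar YH).indicator f y := by
  have := isTiling_latticeHom.mem_iff.1 hy
  rw [perExt, this, ← latticeHom_apply, map_zero, sub_zero]

theorem integrableOn_perExt (hc : IsCompact YH) {f : Euc N → F}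
    (hf : IntegrableOn f (cellStar YH)) {S : Set (Euc N)} (hS : Bornology.IsBounded S)
    (hSm : MeasurableSet S) : IntegrableOn (perExt YH f) S := by
  obtain ⟨K, hK⟩ := isTiling_latticeHom.exists_finset (isTiling_latticeHom (N := N)).bounded hS
  have h1 : ∀ y ∈ S, perExt YH f y = ∑ k ∈ K, (cellStar YH).indicator f (y - latticeVec k) := by
    intro y hy
    have hmem : cellIndex y ∈ K := by
      refine hK _ (isTiling_latticeHom.sub_mem y) _ ?_
      rwa [sub_add_cancel]
    rw [Finset.sum_eq_single_of_mem _ hmem]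
    · rfl
    · intro k _ hk
      refine indicator_of_notMem (fun h => hk ?_) _
      have := isTiling_latticeHom.floor_add _ (unitCell_subset_halfOpenCell h.1) k
      rw [latticeHom_apply, sub_add_cancel] at this
      exact this.symm
  have hint : Integrable ((cellStar YH).indicator f) :=
    hf.integrable_indicator (isOpen_cellStar hc).measurableSet
  have h2 : Integrable (fun y => ∑ k ∈ K, (cellStar YH).indicator f (y - latticeVec k)) :=
    integrable_finsetSum _ fun k _ => hint.comp_sub_right _
  exact h2.integrableOn.congr_fun (fun y hy => (h1 y hy).symm) hSm

theorem locallyIntegrable_perExt (hc : IsCompact YH) {f : Euc N → F}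
    (hf : IntegrableOn f (cellStar YH)) : LocallyIntegrable (perExt YH f) := fun x =>
  ⟨Metric.ball x 1, Metric.ball_mem_nhds x one_pos,
    integrableOn_perExt hc hf Metric.isBounded_ball Metric.isOpen_ball.measurableSet⟩

end PerExt

theorem IsWeakGradient.mono {U U' : Set (Euc N)} {w : Euc N → ℝ} {g : Euc N → Euc N}
    (h : IsWeakGradient U w g) (hU : U' ⊆ U) : IsWeakGradient U' w g := by
  refine ⟨h.locInt_fun.mono_set hU, h.locInt_grad.mono_set hU, fun φ hφ => ?_⟩
  have h1 := h.integral_eq φ (hφ.mono hU)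
  have hg : ∀ x ∉ U', gradient φ x = 0 := fun x hx => by
    have : x ∉ tsupport (fderiv ℝ φ) := fun h' =>
      hx (hφ.support_subset (tsupport_fderiv_subset ℝ h'))
    rw [gradient, image_eq_zero_of_notMem_tsupport this, map_zero]
  rw [setIntegral_eq_integral_of_forall_compl_eq_zero fun x hx => by rw [hg x hx, smul_zero],
    setIntegral_eq_integral_of_forall_compl_eq_zero fun x hx => by rw [hφ.eq_zero hx, zero_smul]]
  rwa [setIntegral_eq_integral_of_forall_compl_eq_zero fun x hx => by
      rw [hg x fun h' => hx (hU h'), smul_zero],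
    setIntegral_eq_integral_of_forall_compl_eq_zero fun x hx => by
      rw [hφ.eq_zero fun h' => hx (hU h'), zero_smul]] at h1

theorem IsWeakGradient.congr {U : Set (Euc N)} (hU : MeasurableSet U) {w w' : Euc N → ℝ}
    {g g' : Euc N → Euc N} (h : IsWeakGradient U w g) (hw : ∀ x ∈ U, w x = w' x)
    (hg : ∀ x ∈ U, g x = g' x) : IsWeakGradient U w' g' := by
  refine ⟨?_, ?_, fun φ hφ => ?_⟩
  · intro x hx
    obtain ⟨s, hs, hi⟩ := h.locInt_fun x hx
    exact ⟨s ∩ U, inter_mem hs self_mem_nhdsWithin, (hi.mono_set inter_subset_left).congr_fun_ae <|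
      ae_restrict_of_ae_restrict_of_subset inter_subset_right <|
        (ae_restrict_iff' hU).2 (Eventually.of_forall hw)⟩
  · intro x hx
    obtain ⟨s, hs, hi⟩ := h.locInt_grad x hx
    exact ⟨s ∩ U, inter_mem hs self_mem_nhdsWithin, (hi.mono_set inter_subset_left).congr_fun_ae <|
      ae_restrict_of_ae_restrict_of_subset inter_subset_right <|
        (ae_restrict_iff' hU).2 (Eventually.of_forall hg)⟩
  · have e1 : ∫ x in U, w' x • gradient φ x = ∫ x in U, w x • gradient φ x :=
      setIntegral_congr_fun hU fun x hx => by simp only [hw x hx]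
    have e2 : ∫ x in U, φ x • g' x = ∫ x in U, φ x • g x :=
      setIntegral_congr_fun hU fun x hx => by simp only [hg x hx]
    rw [e1, e2]
    exact h.integral_eq φ hφ

/-- Membership in `H¹_♯(Y*)` can be tested on the cell, with periodic test functions. -/
theorem isWeakGradient_perExt (hc : IsCompact YH) {w : Euc N → ℝ} {g : Euc N → Euc N} (hw : MemLp w 2 (volume.restrict (cellStar YH)))
    (hg : MemLp g 2 (volume.restrict (cellStar YH)))
    (h : ∀ τ ∈ cellTests YH, ∫ y in cellStar YH, inner ℝ (τ y) (jet (w y) (g y)) = 0) :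
    IsWeakGradient (perStar YH) (perExt YH w) (perExt YH g) := by
  have hY : MeasurableSet (cellStar YH) := (isOpen_cellStar hc).measurableSet
  have lw := locallyIntegrable_perExt hc
    (show IntegrableOn w (cellStar YH) volume from hw.integrable (by norm_num))
  have lg := locallyIntegrable_perExt hc
    (show IntegrableOn g (cellStar YH) volume from hg.integrable (by norm_num))
  refine ⟨lw.locallyIntegrableOn _, lg.locallyIntegrableOn _, fun χ hχ => ?_⟩
  have hper : IsPerTest YH (periodize (latticeHom N) χ) :=
    ⟨isTiling_latticeHom.contDiff_periodize hχ.compact hχ.smooth,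
      fun y k => IsTiling.periodize_add χ y k,
      isTiling_latticeHom.tsupport_periodize_subset hχ.compact
        (fun y k => perStar_add_iff.1) hχ.support_subset⟩
  -- both sides are reduced to the cell, in each direction `e`
  have key : ∀ (F : Type) [NormedAddCommGroup F] [NormedSpace ℝ F] (f : Euc N → F) (χ : Euc N → ℝ),
      Continuous χ → HasCompactSupport χ → LocallyIntegrable (perExt YH f) →
      ∫ x, χ x • perExt YH f x =
        ∫ y in cellStar YH, periodize (latticeHom N) χ y • f y := by
    intro F _ _ f χ hχc hχs hl
    rw [isTiling_latticeHom.integral_smul_eq_periodize measurableSet_halfOpenCell hχs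
      (perExt_periodic f) (hl.integrable_smul_left_of_hasCompactSupport hχc hχs),
      ← integral_indicator measurableSet_halfOpenCell, ← integral_indicator hY]
    congr 1; ext y
    by_cases h1 : y ∈ halfOpenCell N
    · rw [indicator_of_mem h1, perExt_of_mem_halfOpenCell h1]
      by_cases h2 : y ∈ cellStar YH <;> simp [h2]
    · rw [indicator_of_notMem h1, indicator_of_notMem]
      exact fun h2 => h1 (unitCell_subset_halfOpenCell h2.1)
  have hgr : ∀ x ∉ perStar YH, gradient χ x = 0 := fun x hx => by
    have : x ∉ tsupport (fderiv ℝ χ) := fun h' =>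
      hx (hχ.support_subset (tsupport_fderiv_subset ℝ h'))
    rw [gradient, image_eq_zero_of_notMem_tsupport this, map_zero]
  rw [setIntegral_eq_integral_of_forall_compl_eq_zero fun x hx => by rw [hgr x hx, smul_zero],
    setIntegral_eq_integral_of_forall_compl_eq_zero fun x hx => by rw [hχ.eq_zero hx, zero_smul]]
  refine ext_inner_left ℝ fun e => ?_
  have i1 : Integrable fun x => perExt YH w x • gradient χ x :=
    lw.integrable_smul_right_of_hasCompactSupport hχ.continuous_gradient
      hχ.hasCompactSupport_gradient
  have i2 : Integrable fun x => χ x • perExt YH g x :=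
    lg.integrable_smul_left_of_hasCompactSupport hχ.smooth.continuous hχ.compact
  rw [inner_neg_right, ← integral_inner i1, ← integral_inner i2]
  have e1 : ∫ x, (inner ℝ e (perExt YH w x • gradient χ x) : ℝ) =
      ∫ y in cellStar YH, fderiv ℝ (periodize (latticeHom N) χ) y e * w y := by
    simp_rw [isTiling_latticeHom.fderiv_periodize hχ.compact
      (hχ.smooth.differentiable (by simp))]
    have h1 := key ℝ w (fun z => fderiv ℝ χ z e)
      ((hχ.smooth.continuous_fderiv (by simp)).clm_apply continuous_const)
      ((hχ.compact.fderiv (𝕜 := ℝ)).comp_left (g := fun L : Euc N →L[ℝ] ℝ => L e) rfl) lw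
    simp only [smul_eq_mul] at h1
    rw [← h1]
    congr 1; ext x
    rw [real_inner_smul_right, real_inner_comm, inner_gradient_eq_fderiv, mul_comm]
  have e2 : ∫ x, (inner ℝ e (χ x • perExt YH g x) : ℝ) =
      ∫ y in cellStar YH, inner ℝ (periodize (latticeHom N) χ y • e) (g y) := by
    rw [integral_inner i2, key _ g χ hχ.smooth.continuous hχ.compact lg, ← integral_inner]
    · simp_rw [real_inner_smul_left, real_inner_smul_right]
    · exact integrable_smul_of_memLp (memLp_of_periodic hper.smooth.continuous hper.periodic) hg
  have h1 := h _ ⟨_, e, hper, rfl⟩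
  rw [integral_inner_jet (memLp_cellTests _ ⟨_, e, hper, rfl⟩) (memLp_jet hw hg)] at h1
  simp only [jet_fst, jet_snd] at h1
  rw [e1, e2]
  linarith

theorem memH1_of_forall_cellTests (hc : IsCompact YH) (hsub : YH ⊆ unitCell N)
    {k : Euc N → Jet N} (hk : MemLp k 2 (volume.restrict (cellStar YH)))
    (h : ∀ τ ∈ cellTests YH, ∫ y in cellStar YH, inner ℝ (τ y) (k y) = 0) :
    MemH1 (cellStar YH) (fun y => (k y).fst) (fun y => (k y).snd) := by
  refine ⟨memLp_jet_fst hk, memLp_jet_snd hk, ?_⟩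
  have h1 := isWeakGradient_perExt hc (memLp_jet_fst hk) (memLp_jet_snd hk) h
  refine (h1.mono ?_).congr (isOpen_cellStar hc).measurableSet
    (fun y hy => perExt_of_mem hy) fun y hy => perExt_of_mem hy
  rw [cellStar_eq hsub]; exact inter_subset_right

/-- Poincaré inequality for periodic functions of mean zero. -/
theorem poincare_cellTests (hc : IsCompact YH) (hsub : YH ⊆ unitCell N)
    (hs : HasSmoothBoundary YH) (hconn : IsConnected (cellStar YH)) :
    ∃ C : ℝ≥0, ∀ k : Euc N → Jet N, MemLp k 2 (volume.restrict (cellStar YH)) →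
      (∀ τ ∈ cellTests YH, ∫ y in cellStar YH, inner ℝ (τ y) (k y) = 0) →
      ∫ y in cellStar YH, (k y).fst = 0 →
      eLpNorm (fun y => (k y).fst) 2 (volume.restrict (cellStar YH)) ≤
        C * eLpNorm (fun y => (k y).snd) 2 (volume.restrict (cellStar YH)) := by
  obtain ⟨C, hC, h⟩ := poincare_cellStar hc hsub hs hconn
  lift C to ℝ≥0 using hC
  refine ⟨C, fun k hk horth hmean => ?_⟩
  obtain ⟨c, hc'⟩ := h _ _ (memH1_of_forall_cellTests hc hsub hk horth)
  have hw := memLp_jet_fst hk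
  have hg := memLp_jet_snd hk
  set w := fun y => (k y).fst
  have hwc : MemLp (fun y => w y - c) 2 (volume.restrict (cellStar YH)) := hw.sub (memLp_const c)
  have h1 := abs_integral_inner_le hw hwc
  have h2 : ∫ y in cellStar YH, (inner ℝ (w y) (w y - c) : ℝ) =
      (eLpNorm w 2 (volume.restrict (cellStar YH))).toReal ^ 2 := by
    rw [sq_toReal_eLpNorm_two hw]
    simp_rw [inner_sub_right]
    rw [integral_sub (integrable_inner_of_memLp hw hw)
      (integrable_inner_of_memLp hw (memLp_const c))]
    simp only [RCLike.inner_apply, conj_trivial]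
    rw [integral_const_mul, hmean, mul_zero, sub_zero]
  rw [h2, abs_of_nonneg (by positivity)] at h1
  have h3 : (eLpNorm w 2 (volume.restrict (cellStar YH))).toReal ≤
      C * (eLpNorm (fun y => (k y).snd) 2 (volume.restrict (cellStar YH))).toReal := by
    refine le_trans ?_ hc'
    by_contra hcon
    push Not at hcon
    nlinarith [(ENNReal.toReal_nonneg :
      0 ≤ (eLpNorm (fun y => w y - c) 2 (volume.restrict (cellStar YH))).toReal)]
  rw [← ENNReal.toReal_le_toReal hw.2.ne (ENNReal.mul_ne_top ENNReal.coe_ne_top hg.2.ne),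
    ENNReal.toReal_mul, ENNReal.coe_toReal]
  exact h3

end Cell

/-! ### Corrector fields depending on parameters -/

section Corrector

variable {N : ℕ} {YH : Set (Euc N)}

/-- Square integrable fields on the perforated cell that are weakly divergence free and tangential
to the hole: those orthogonal to the gradients of all functions of `H¹_♯(Y*)`. -/
structure IsSolenoidal (YH : Set (Euc N)) (θ : Euc N → Euc N) : Prop where
  memLp : MemLp θ 2 (volume.restrict (cellStar YH))
  orthogonal : ∀ k : Euc N → Jet N, MemLp k 2 (volume.restrict (cellStar YH)) →
    (∀ τ ∈ cellTests YH, ∫ y in cellStar YH, inner ℝ (τ y) (k y) = 0) →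
    ∫ y in cellStar YH, inner ℝ (θ y) (k y).snd = 0

/-- The tests that characterize mean zero functions of `H¹_♯(Y*)`. -/
def meanZeroTests (YH : Set (Euc N)) : Set (Euc N → Jet N) :=
  insert (fun _ => jet 1 0) (cellTests YH)

theorem memLp_meanZeroTests :
    ∀ τ ∈ meanZeroTests YH, MemLp τ 2 (volume.restrict (cellStar YH)) := by
  rintro τ (rfl | hτ)
  · exact memLp_const _
  · exact memLp_cellTests τ hτ

theorem integral_inner_jet_one {k : Euc N → Jet N} :
    ∫ y in cellStar YH, inner ℝ (jet 1 0) (k y) = ∫ y in cellStar YH, (k y).fst := by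
  simp_rw [inner_jet]
  simp

/-- The integral of a periodic function over a cell is invariant under translations. -/
theorem IsTiling.setIntegral_add_right {ι V : Type*} [AddCommGroup ι] [NormedAddCommGroup V]
    [ProperSpace V] [MeasurableSpace V] [BorelSpace V] {μ : Measure V} [μ.IsAddLeftInvariant]
    {l : ι →+ V} {fl : V → ι} {Q : Set V} (h : IsTiling l fl Q) (hQ : MeasurableSet Q)
    {w : V → ℝ} (hw : ∀ y k, w (y + l k) = w y) (hl : ∀ z, IntegrableOn (fun y => w (y + z)) Q μ)
    (z : V) : ∫ y in Q, w (y + z) ∂μ = ∫ y in Q, w y ∂μ := by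
  -- the indicator function of `Q + z` has periodization one
  have hm : MeasurableSet ((fun x => x - z) ⁻¹' Q) := hQ.preimage (by fun_prop)
  have hb : Bornology.IsBounded ((fun x => x - z) ⁻¹' Q) := by
    obtain ⟨R, hR⟩ := h.bounded.exists_norm_le
    refine isBounded_iff_forall_norm_le.2 ⟨R + ‖z‖, fun x hx => ?_⟩
    calc ‖x‖ = ‖(x - z) + z‖ := by simp
      _ ≤ R + ‖z‖ := (norm_add_le _ _).trans (by gcongr; exact hR _ hx)
  have hχ : HasCompactSupport (((fun x => x - z) ⁻¹' Q).indicator fun _ => (1 : ℝ)) :=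
    HasCompactSupport.intro' hb.isCompact_closure isClosed_closure fun x hx =>
      indicator_of_notMem (fun h' => hx (subset_closure h')) _
  have hp : ∀ y, periodize l (((fun x => x - z) ⁻¹' Q).indicator fun _ => (1 : ℝ)) y = 1 := by
    intro y
    rw [periodize, finsum_eq_single _ (-fl (y - z))]
    · refine indicator_of_mem ?_ _
      have := h.sub_mem (y - z)
      simp only [mem_preimage, map_neg]
      convert this using 1; abel
    · intro k hk
      refine indicator_of_notMem (fun h' => hk ?_) _
      have h1 := h.mem_iff.1 h'
      simp only [show y + l k - z = y - z + l k by abel] at h1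
      rw [h.floor_add_lattice] at h1
      exact (neg_eq_of_add_eq_zero_right h1).symm
  have h1 : ∀ x, ((fun x => x - z) ⁻¹' Q).indicator (fun _ => (1 : ℝ)) x • w x =
      Q.indicator (fun y => w (y + z)) (x - z) := by
    intro x
    by_cases hx : x - z ∈ Q <;> simp [hx, indicator]
  have hint : Integrable (fun x => ((fun x => x - z) ⁻¹' Q).indicator (fun _ => (1 : ℝ)) x • w x) μ := by
    simp_rw [h1]
    exact ((hl z).integrable_indicator hQ).comp_sub_right z
  have h2 := h.integral_smul_eq_periodize hQ hχ hw hint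
  simp_rw [hp, one_smul, h1] at h2
  rw [← h2, integral_sub_right_eq_self (fun x => Q.indicator (fun y => w (y + z)) x) z,
    integral_indicator hQ]

/-- Constants belong to `H¹_♯(Y*)`, with gradient zero. -/
theorem integral_cellTests_const (hsub : YH ⊆ unitCell N)
    {τ : Euc N → Jet N} (hτ : τ ∈ cellTests YH)
    (c : ℝ) : ∫ y in cellStar YH, inner ℝ (τ y) (jet c 0) = 0 := by
  obtain ⟨η, e, hη, rfl⟩ := hτ
  simp_rw [inner_jet]
  simp only [jet_fst, jet_snd, inner_zero_right, add_zero]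
  rw [integral_mul_const, mul_eq_zero]
  left
  have hQ := measurableSet_halfOpenCell (N := N)
  have h0 : ∫ y in cellStar YH, fderiv ℝ η y e = ∫ y in halfOpenCell N, fderiv ℝ η y e := by
    have h1 : ∫ y in unitCell N, fderiv ℝ η y e = ∫ y in cellStar YH, fderiv ℝ η y e := by
      refine setIntegral_eq_of_subset_of_forall_sdiff_eq_zero isOpen_unitCell.measurableSet
        sdiff_subset fun y hy => ?_
      have h2 : y ∉ tsupport (fderiv ℝ η) := fun h' => by
        have h3 := hη.support_subset (tsupport_fderiv_subset ℝ h')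
        rw [cellStar_eq hsub] at hy
        exact hy.2 ⟨hy.1, h3⟩
      rw [image_eq_zero_of_notMem_tsupport h2]; rfl
    rw [← h1, restrict_unitCell_eq]
  rw [h0]
  have : IsFiniteMeasure (volume.restrict (halfOpenCell N)) := ⟨by simp [volume_halfOpenCell]⟩
  obtain ⟨C, hC⟩ := exists_bound_of_periodic hη.smooth.continuous hη.periodic
  obtain ⟨C', hC'⟩ := exists_bound_of_periodic (hη.continuous_fderiv e) (hη.fderiv_periodic e)
  -- the derivative of the constant function `a ↦ ∫_Y η (y + a e) dy`
  have h1 : HasDerivAt (fun a : ℝ => ∫ y in halfOpenCell N, η (y + a • e))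
      (∫ y in halfOpenCell N, fderiv ℝ η (y + (0 : ℝ) • e) e) 0 := by
    refine (hasDerivAt_integral_of_dominated_loc_of_deriv_le (F := fun a y => η (y + a • e))
      (F' := fun a y => fderiv ℝ η (y + a • e) e) (bound := fun _ => C') univ_mem
      (Eventually.of_forall fun a => ?_) ?_ ?_ ?_ (integrable_const _) ?_).2
    · exact (hη.smooth.continuous.comp (by fun_prop)).aestronglyMeasurable
    · exact .of_bound (hη.smooth.continuous.comp (by fun_prop)).aestronglyMeasurable C
        (Eventually.of_forall fun y => hC _)
    · exact ((hη.continuous_fderiv e).comp (g := fun y => fderiv ℝ η y e)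
        (f := fun y => y + (0 : ℝ) • e) (by fun_prop)).aestronglyMeasurable
    · exact Eventually.of_forall fun y a _ => hC' _
    · refine Eventually.of_forall fun y a _ => ?_
      have h2 : HasDerivAt (fun a : ℝ => y + a • e) e a := by
        simpa using ((hasDerivAt_id a).smul_const e).const_add y
      exact ((hη.smooth.differentiable (by simp)).differentiableAt.hasFDerivAt).comp_hasDerivAt a h2
  have h2 : (fun a : ℝ => ∫ y in halfOpenCell N, η (y + a • e)) =
      fun _ => ∫ y in halfOpenCell N, η y := funext fun a =>
    isTiling_latticeHom.setIntegral_add_right hQ hη.periodic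
      (fun z => .of_bound (by simp [volume_halfOpenCell])
        (hη.smooth.continuous.comp (by fun_prop)).aestronglyMeasurable C
        (Eventually.of_forall fun y => hC _)) _
  rw [h2] at h1
  simpa using h1.unique (hasDerivAt_const _ _)

theorem volume_real_cellStar_ne_zero (hc : IsCompact YH) (hconn : IsConnected (cellStar YH)) :
    volume.real (cellStar YH) ≠ 0 :=
  (ENNReal.toReal_pos ((isOpen_cellStar hc).measure_pos volume hconn.nonempty).ne'
    volume_cellStar_lt_top.ne).ne'

/-- A field orthogonal to all gradients of mean zero functions is orthogonal to all gradients, as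
constants may be subtracted; so it is solenoidal, and orthogonal to itself if it is orthogonal to all
solenoidal fields. -/
theorem determining_solenoidal_union_gradient (hsub : YH ⊆ unitCell N)
    (hpos : (volume.real (cellStar YH)) ≠ 0) :
    Determining (volume.restrict (cellStar YH)) ({θ | IsSolenoidal YH θ} ∪
      {g | ∃ w : Euc N → ℝ, MemLp (fun y => jet (w y) (g y)) 2 (volume.restrict (cellStar YH)) ∧
        ∀ τ ∈ meanZeroTests YH, ∫ y in cellStar YH, inner ℝ (τ y) (jet (w y) (g y)) = 0}) := by
  intro h hh horth
  have hsol : IsSolenoidal YH h := by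
    refine ⟨hh, fun k hk hkt => ?_⟩
    have hw := memLp_jet_fst hk
    set m : ℝ := (∫ y in cellStar YH, (k y).fst) / volume.real (cellStar YH) with hm
    have hmem : MemLp (fun y => jet ((k y).fst - m) (k y).snd) 2
        (volume.restrict (cellStar YH)) := memLp_jet (hw.sub (memLp_const m)) (memLp_jet_snd hk)
    have := horth (fun y => (k y).snd) (Or.inr ⟨fun y => (k y).fst - m, hmem, ?_⟩)
    · simpa only [real_inner_comm] using this
    · rintro τ (rfl | hτ)
      · rw [integral_inner_jet_one]
        simp only [jet_fst]
        rw [integral_sub (hw.integrable (by norm_num)) (integrable_const _), integral_const,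
          smul_eq_mul, hm]
        simp only [measureReal_restrict_apply_univ]
        field_simp
        simp
      · have e1 : ∀ y, (jet ((k y).fst - m) (k y).snd : Jet N) = k y - jet m 0 := fun y =>
          WithLp.ofLp_injective 2 (Prod.ext rfl (sub_zero _).symm)
        simp_rw [e1, inner_sub_right]
        rw [integral_sub (integrable_inner_of_memLp (memLp_cellTests τ hτ) hk)
          (integrable_inner_of_memLp (memLp_cellTests τ hτ) (memLp_const _)), hkt τ hτ,
          integral_cellTests_const hsub hτ, sub_zero]
  exact ae_eq_zero_of_integral_inner_self hh (horth h (Or.inl hsol))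

variable {P : Type*} [MeasurableSpace P] {μ : Measure P}

/-- A field which is orthogonal to all `ψ ⊗ θ` with `θ` solenoidal is a parameter dependent gradient
of a periodic function of mean zero on the cell. The gradients form a closed subspace by
the Poincaré inequality; the component of the field orthogonal to it vanishes, being orthogonal
both to the solenoidal fields and to the gradients. -/
theorem exists_corrector [IsFiniteMeasure μ] (hc : IsCompact YH) (hsub : YH ⊆ unitCell N)
    (hs : HasSmoothBoundary YH) (hconn : IsConnected (cellStar YH)) {𝒟 : Set (P → ℝ)}
    (h𝒟 : Determining μ 𝒟) (m𝒟 : ∀ ψ ∈ 𝒟, MemLp ψ 2 μ) {F : P × Euc N → Euc N}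
    (hF : MemLp F 2 (μ.prod (volume.restrict (cellStar YH))))
    (horth : ∀ ψ ∈ 𝒟, ∀ θ, IsSolenoidal YH θ →
      ∫ p, inner ℝ (ψ p.1 • θ p.2) (F p) ∂(μ.prod (volume.restrict (cellStar YH))) = 0) :
    ∃ w : P × Euc N → ℝ, MemLp w 2 (μ.prod (volume.restrict (cellStar YH))) ∧
      ∀ᵐ p ∂μ, MemLp (fun y => jet (w (p, y)) (F (p, y))) 2 (volume.restrict (cellStar YH)) ∧
        ∀ τ ∈ meanZeroTests YH,
          ∫ y in cellStar YH, inner ℝ (τ y) (jet (w (p, y)) (F (p, y))) = 0 := by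
  have hvol : volume.real (cellStar YH) ≠ 0 := volume_real_cellStar_ne_zero hc hconn
  obtain ⟨C, hC⟩ := poincare_cellTests hc hsub hs hconn
  set ν := (volume : Measure (Euc N)).restrict (cellStar YH) with hν
  -- `𝓢` consists of the functions of mean zero in `y`, paired with their `y`-gradients
  let S : Set (Lp (Jet N) 2 (μ.prod ν)) := {f | ∃ ψ, ∃ hψ : ψ ∈ 𝒟, ∃ τ, ∃ hτ : τ ∈ meanZeroTests YH,
    f = (memLp_tensor (m𝒟 ψ hψ) (memLp_meanZeroTests τ hτ)).toLp _}
  let 𝓢 : Submodule ℝ (Lp (Jet N) 2 (μ.prod ν)) := (Submodule.span ℝ S)ᗮ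
  have mem𝓢 : ∀ f : Lp (Jet N) 2 (μ.prod ν), f ∈ 𝓢 ↔ ∀ ψ ∈ 𝒟, ∀ τ ∈ meanZeroTests YH,
      ∫ p, inner ℝ (ψ p.1 • τ p.2) (f p) ∂(μ.prod ν) = 0 := by
    intro f
    have e1 : ∀ ψ, (hψ : ψ ∈ 𝒟) → ∀ τ, (hτ : τ ∈ meanZeroTests YH) →
        inner ℝ ((memLp_tensor (m𝒟 ψ hψ) (memLp_meanZeroTests τ hτ)).toLp _) f =
          ∫ p, inner ℝ (ψ p.1 • τ p.2) (f p) ∂(μ.prod ν) := by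
      intro ψ hψ τ hτ
      rw [L2.inner_def]
      apply integral_congr_ae
      filter_upwards [(memLp_tensor (m𝒟 ψ hψ) (memLp_meanZeroTests τ hτ)).coeFn_toLp] with p hp
      rw [hp]
    constructor
    · intro hf ψ hψ τ hτ
      rw [← e1 ψ hψ τ hτ]
      exact (Submodule.mem_orthogonal _ _).1 hf _ (Submodule.subset_span ⟨ψ, hψ, τ, hτ, rfl⟩)
    · intro hf
      rw [Submodule.mem_orthogonal]
      intro u hu
      induction hu using Submodule.span_induction with
      | mem x hx =>
        obtain ⟨ψ, hψ, τ, hτ, rfl⟩ := hx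
        rw [e1 ψ hψ τ hτ, hf ψ hψ τ hτ]
      | zero => simp
      | add x y _ _ hx hy => rw [inner_add_left, hx, hy, add_zero]
      | smul a x _ hx => rw [inner_smul_left, hx, mul_zero]
  have slice𝓢 : ∀ f ∈ 𝓢, ∀ᵐ p ∂μ, MemLp (fun y => f (p, y)) 2 ν ∧
      ∀ τ ∈ meanZeroTests YH, ∫ y, inner ℝ (τ y) (f (p, y)) ∂ν = 0 := fun f hf =>
    ae_forall_integral_inner_slice_eq_zero h𝒟 m𝒟 memLp_meanZeroTests (Lp.memLp f) ((mem𝓢 f).1 hf)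
  let sndL : Jet N →L[ℝ] Euc N := WithLp.sndL 2 ℝ ℝ (Euc N)
  let T : Lp (Jet N) 2 (μ.prod ν) →L[ℝ] Lp (Euc N) 2 (μ.prod ν) := sndL.compLpL 2 (μ.prod ν)
  have hT : ∀ f : Lp (Jet N) 2 (μ.prod ν), (T f : P × Euc N → Euc N) =ᵐ[μ.prod ν]
      fun p => (f p).snd := fun f => ContinuousLinearMap.coeFn_compLpL sndL f
  -- the Poincaré inequality, integrated over the parameters
  have hbound : ∀ f ∈ 𝓢, ‖f‖ ≤ (C + 1 : ℝ≥0) * ‖T f‖ := by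
    intro f hf
    have hfm := Lp.memLp f
    have h1 : eLpNorm (fun p => (f p).fst) 2 (μ.prod ν) ^ 2 ≤
        C ^ 2 * eLpNorm (fun p => (f p).snd) 2 (μ.prod ν) ^ 2 := by
      rw [eLpNorm_two_sq, eLpNorm_two_sq, lintegral_prod _ ((memLp_jet_fst hfm).1.enorm.pow_const _),
        lintegral_prod _ ((memLp_jet_snd hfm).1.enorm.pow_const _), ← lintegral_const_mul' _ _
          (by simp)]
      refine lintegral_mono_ae ?_
      filter_upwards [slice𝓢 f hf] with p hp
      have h2 := hC _ hp.1 (fun τ hτ => hp.2 τ (Or.inr hτ))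
        (by rw [← integral_inner_jet_one]; exact hp.2 _ (Or.inl rfl))
      have h3 := pow_le_pow_left' h2 2
      rwa [mul_pow, eLpNorm_two_sq, eLpNorm_two_sq] at h3
    have h2 : eLpNorm f 2 (μ.prod ν) ^ 2 ≤
        ((C + 1 : ℝ≥0) * eLpNorm (fun p => (f p).snd) 2 (μ.prod ν)) ^ 2 := by
      have h3 : eLpNorm f 2 (μ.prod ν) ^ 2 = eLpNorm (fun p => (f p).fst) 2 (μ.prod ν) ^ 2 +
          eLpNorm (fun p => (f p).snd) 2 (μ.prod ν) ^ 2 := by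
        rw [eLpNorm_two_sq, eLpNorm_two_sq, eLpNorm_two_sq,
          ← lintegral_add_left' ((memLp_jet_fst hfm).1.enorm.pow_const _)]
        congr 1; ext p
        have := norm_jet_sq (f p)
        simp only [← ofReal_norm]
        rw [← ENNReal.ofReal_pow (norm_nonneg _), ← ENNReal.ofReal_pow (norm_nonneg _),
          ← ENNReal.ofReal_pow (norm_nonneg _), ← ENNReal.ofReal_add (by positivity) (by positivity),
          this]
      rw [h3, mul_pow]
      refine (add_le_add_left h1 _).trans ?_
      rw [← one_mul (eLpNorm (fun p => (f p).snd) 2 (μ.prod ν) ^ 2), ← mul_assoc, ← add_mul,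
        ← mul_assoc]
      gcongr
      rw [mul_one, mul_one]
      have : (C : ℝ≥0∞) ^ 2 + 1 ≤ ((C + 1 : ℝ≥0) : ℝ≥0∞) ^ 2 := by
        norm_cast
        rw [add_sq, one_pow]
        gcongr
        exact le_self_add
      exact this
    have h4 := (ENNReal.pow_le_pow_left_iff two_ne_zero).1 h2
    rw [Lp.norm_def, Lp.norm_def, eLpNorm_congr_ae (hT f)]
    have h5 := ENNReal.toReal_mono
      (ENNReal.mul_ne_top ENNReal.coe_ne_top (memLp_jet_snd hfm).2.ne) h4
    rwa [ENNReal.toReal_mul, ENNReal.coe_toReal] at h5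
  let T𝓢 : 𝓢 →L[ℝ] Lp (Euc N) 2 (μ.prod ν) := T.comp 𝓢.subtypeL
  have hcl𝓢 : IsClosed (𝓢 : Set (Lp (Jet N) 2 (μ.prod ν))) := Submodule.isClosed_orthogonal _
  have : CompleteSpace 𝓢 := hcl𝓢.completeSpace_coe
  have hanti : AntilipschitzWith (C + 1) T𝓢 :=
    AddMonoidHomClass.antilipschitz_of_bound T𝓢 fun f => hbound f f.2
  let 𝒢 : Submodule ℝ (Lp (Euc N) 2 (μ.prod ν)) := T𝓢.range
  have hcl𝒢 : IsClosed (𝒢 : Set (Lp (Euc N) 2 (μ.prod ν))) := by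
    have := hanti.isClosed_range T𝓢.uniformContinuous
    convert this using 1
    ext x; simp [𝒢]
  have : CompleteSpace 𝒢 := hcl𝒢.completeSpace_coe
  obtain ⟨g₀, hg₀, F', hF', hsum⟩ := 𝒢.exists_add_mem_mem_orthogonal (hF.toLp F)
  -- the orthogonal component vanishes
  have hF'0 : (F' : P × Euc N → Euc N) =ᵐ[μ.prod ν] 0 := by
    refine (h𝒟.prod (determining_solenoidal_union_gradient hsub hvol) m𝒟 ?_) F' (Lp.memLp F') ?_
    · rintro τ (hτ | ⟨w, hw, -⟩)
      · exact hτ.memLp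
      · exact memLp_jet_snd hw
    · rintro _ ⟨ψ, hψ, τ, hτ | ⟨w, hw, hwt⟩, rfl⟩
      · -- both the field and its component in `𝒢` are orthogonal to solenoidal fields
        obtain ⟨f, hf⟩ := hg₀
        have hten := memLp_tensor (m𝒟 ψ hψ) hτ.memLp
        have e0 : ∫ p, inner ℝ (ψ p.1 • τ p.2) ((f : Lp (Jet N) 2 (μ.prod ν)) p).snd ∂(μ.prod ν)
            = 0 := by
          rw [integral_inner_tensor_right (m𝒟 ψ hψ) hτ.memLp (memLp_jet_snd (Lp.memLp _))]
          rw [integral_congr_ae (g := fun _ => (0 : ℝ)), integral_zero]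
          filter_upwards [slice𝓢 f f.2] with p hp
          rw [hτ.orthogonal _ hp.1 fun σ hσ => hp.2 σ (Or.inr hσ), mul_zero]
        have e1 := horth ψ hψ τ hτ
        have e2 : ∫ p, inner ℝ (ψ p.1 • τ p.2) (F p) ∂(μ.prod ν) =
            ∫ p, inner ℝ (ψ p.1 • τ p.2) ((f : Lp (Jet N) 2 (μ.prod ν)) p).snd ∂(μ.prod ν) +
              ∫ p, inner ℝ (ψ p.1 • τ p.2) (F' p) ∂(μ.prod ν) := by
          rw [← integral_add (integrable_inner_of_memLp hten (memLp_jet_snd (Lp.memLp _)))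
            (integrable_inner_of_memLp hten (Lp.memLp _))]
          apply integral_congr_ae
          have hf' : g₀ = T f := hf.symm
          rw [hf'] at hsum
          have hae : F =ᵐ[μ.prod ν] ((T f + F' : Lp (Euc N) 2 (μ.prod ν)) : P × Euc N → Euc N) := by
            rw [← hsum]; exact hF.coeFn_toLp.symm
          filter_upwards [hae, Lp.coeFn_add (T f) F', hT f] with p h1 h2 h3
          rw [h1, h2, Pi.add_apply, h3, inner_add_right]
        rw [e1, e0, zero_add] at e2
        exact e2.symm
      · have hten := memLp_tensor (m𝒟 ψ hψ) hw
        have hmem : hten.toLp _ ∈ 𝓢 := by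
          rw [mem𝓢]
          intro ψ' hψ' σ hσ
          have e1 : ∫ p, inner ℝ (ψ' p.1 • σ p.2) (hten.toLp _ p) ∂(μ.prod ν) =
              ∫ p, inner ℝ (ψ' p.1 • σ p.2) (ψ p.1 • jet (w p.2) (τ p.2)) ∂(μ.prod ν) := by
            apply integral_congr_ae
            filter_upwards [hten.coeFn_toLp] with p hp
            rw [hp]
          rw [e1, integral_inner_tensor_right (m𝒟 ψ' hψ') (memLp_meanZeroTests σ hσ) hten]
          simp_rw [real_inner_smul_right, integral_const_mul]
          rw [hwt σ hσ]; simp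
        have h1 := (Submodule.mem_orthogonal _ _).1 hF' (T (hten.toLp _)) ⟨⟨_, hmem⟩, rfl⟩
        rw [L2.inner_def] at h1
        rw [← h1]
        apply integral_congr_ae
        filter_upwards [hT (hten.toLp _), hten.coeFn_toLp] with p h1 h2
        rw [h1, h2]
        simp
  obtain ⟨f, hf⟩ := hg₀
  have hae : F =ᵐ[μ.prod ν] fun p => ((f : Lp (Jet N) 2 (μ.prod ν)) p).snd := by
    have hf' : g₀ = T f := hf.symm
    have h0 : F' = 0 := Lp.eq_zero_iff_ae_eq_zero.2 hF'0
    rw [h0, add_zero, hf'] at hsum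
    exact (hF.coeFn_toLp.symm.trans (by rw [hsum])).trans (hT f)
  refine ⟨fun p => ((f : Lp (Jet N) 2 (μ.prod ν)) p).fst, memLp_jet_fst (Lp.memLp _), ?_⟩
  filter_upwards [slice𝓢 f f.2, Measure.ae_ae_of_ae_prod hae] with p h1 h2
  have h3 : (fun y => jet (((f : Lp (Jet N) 2 (μ.prod ν)) (p, y)).fst) (F (p, y))) =ᵐ[ν]
      fun y => (f : Lp (Jet N) 2 (μ.prod ν)) (p, y) := by
    filter_upwards [h2] with y hy
    rw [hy]; rfl
  refine ⟨(memLp_congr_ae h3).2 h1.1, fun τ hτ => ?_⟩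
  rw [← h1.2 τ hτ]
  apply integral_congr_ae
  filter_upwards [h3] with y hy
  rw [hy]

end Corrector

/-! ### Unfolding -/

section Unfolding

variable {N : ℕ}

/-- The unfolding map `((x, t, s), y) ↦ (ε ([x/ε] + y), δ ([t/δ] + s))`: the cell variables `y` and
`s` replace the fractional parts of `x/ε` and `t/δ`. -/
noncomputable def unfolding (ε δ : ℝ) (p : (Euc N × ℝ × ℝ) × Euc N) : Euc N × ℝ :=
  (ε • (latticeVec (cellIndex (ε⁻¹ • p.1.1)) + p.2), δ * (⌊δ⁻¹ * p.1.2.1⌋ + p.1.2.2))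

/-- Lebesgue measure for the variables `(x, t, s)`, with `0 < s < 1`. -/
noncomputable abbrev paramMeasure (N : ℕ) : Measure (Euc N × ℝ × ℝ) :=
  volume.prod (volume.prod (volume.restrict (Ioo 0 1)))

/-- Lebesgue measure for the variables `((x, t, s), y)`, with `0 < s < 1` and `y` in the unit
cell. -/
noncomputable abbrev unfoldMeasure (N : ℕ) : Measure ((Euc N × ℝ × ℝ) × Euc N) :=
  (paramMeasure N).prod (volume.restrict (unitCell N))

theorem measurePreserving_unfolding {ε δ : ℝ} (hε : 0 < ε) (hδ : 0 < δ) :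
    MeasurePreserving (unfolding ε δ) (unfoldMeasure N) volume := by
  have h1 := isTiling_latticeHom.measurePreserving_unfold_smul (μ := (volume : Measure (Euc N)))
    measurableSet_halfOpenCell measurable_cellIndex volume_halfOpenCell hε
  have h2 := isTiling_intCast.measurePreserving_unfold_smul (μ := (volume : Measure ℝ))
    measurableSet_Ico Int.measurable_floor (by simp) hδ
  rw [← restrict_unitCell_eq] at h1
  rw [← Measure.restrict_congr_set Ioo_ae_eq_Ico] at h2
  have h3 := (measurePreserving_prodAssoc (volume : Measure (Euc N))
    ((volume : Measure ℝ).prod (volume.restrict (Ioo (0 : ℝ) 1))) (volume.restrict (unitCell N)))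
  have h4 := (MeasurePreserving.id (volume : Measure (Euc N))).prod
    (Measure.measurePreserving_swap (μ := (volume : Measure ℝ).prod (volume.restrict (Ioo (0 : ℝ) 1)))
      (ν := (volume : Measure (Euc N)).restrict (unitCell N)))
  have h5 := (measurePreserving_prodAssoc (volume : Measure (Euc N))
    (volume.restrict (unitCell N)) ((volume : Measure ℝ).prod (volume.restrict (Ioo (0 : ℝ) 1)))).symm
  have h6 := (h1.prod h2).comp (h5.comp (h4.comp h3))
  exact h6

theorem unfolding_fst_index {ε δ : ℝ} (hε : ε ≠ 0) (p : Euc N × ℝ × ℝ) {y : Euc N} :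
    ε⁻¹ • (unfolding ε δ (p, y)).1 = y + latticeVec (cellIndex (ε⁻¹ • p.1)) := by
  simp [unfolding, smul_smul, hε, add_comm]

theorem unfolding_snd_index {ε δ : ℝ} (hδ : δ ≠ 0) (p : Euc N × ℝ × ℝ) {y : Euc N} :
    (unfolding ε δ (p, y)).2 / δ = p.2.2 + (⌊δ⁻¹ * p.2.1⌋ : ℤ) := by
  simp [unfolding, hδ, add_comm]

theorem norm_unfolding_fst_sub_le {ε δ : ℝ} (hε : 0 < ε) (p : Euc N × ℝ × ℝ) {y : Euc N}
    (hy : y ∈ unitCell N) : ‖(unfolding ε δ (p, y)).1 - p.1‖ ≤ ε * (2 * √N) := by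
  have h1 : (unfolding ε δ (p, y)).1 - p.1 =
      ε • (y - (ε⁻¹ • p.1 - latticeHom N (cellIndex (ε⁻¹ • p.1)))) := by
    simp only [unfolding, latticeHom_apply, smul_sub, smul_add, smul_smul, mul_inv_cancel₀ hε.ne',
      one_smul]
    abel
  rw [h1, norm_smul, Real.norm_of_nonneg hε.le]
  gcongr
  refine (norm_sub_le _ _).trans ?_
  have h2 := norm_le_of_mem_halfOpenCell (unitCell_subset_halfOpenCell hy)
  have h3 := norm_le_of_mem_halfOpenCell (isTiling_latticeHom.sub_mem (ε⁻¹ • p.1))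
  linarith

theorem norm_unfolding_snd_sub_le {ε δ : ℝ} (hδ : 0 < δ) (p : Euc N × ℝ × ℝ) {y : Euc N}
    (hs : p.2.2 ∈ Ioo (0 : ℝ) 1) : ‖(unfolding ε δ (p, y)).2 - p.2.1‖ ≤ δ := by
  have h1 : (unfolding ε δ (p, y)).2 - p.2.1 = δ * (p.2.2 - Int.fract (δ⁻¹ * p.2.1)) := by
    rw [Int.fract]
    simp only [unfolding]
    field_simp
    ring
  rw [h1, norm_mul, Real.norm_of_nonneg hδ.le, Real.norm_eq_abs]
  have h2 := Int.fract_nonneg (δ⁻¹ * p.2.1)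
  have h3 := Int.fract_lt_one (δ⁻¹ * p.2.1)
  have : |p.2.2 - Int.fract (δ⁻¹ * p.2.1)| ≤ 1 := by
    rw [abs_le]; constructor <;> linarith [hs.1, hs.2]
  nlinarith

theorem norm_unfolding_sub_le {ε δ : ℝ} (hε : 0 < ε) (hδ : 0 < δ)
    {m : (Euc N × ℝ × ℝ) × Euc N} (hm : m.1.2.2 ∈ Ioo (0 : ℝ) 1 ∧ m.2 ∈ unitCell N) :
    ‖unfolding ε δ m - (m.1.1, m.1.2.1)‖ ≤ ε * (2 * √N) + δ := by
  have h1 := norm_unfolding_fst_sub_le (δ := δ) hε m.1 hm.2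
  have h2 := norm_unfolding_snd_sub_le (ε := ε) (y := m.2) hδ m.1 hm.1
  have : 0 ≤ ε * (2 * √N) := by positivity
  exact norm_prod_le_iff.2 ⟨h1.trans (by linarith), h2.trans (by linarith)⟩

theorem ae_unfoldMeasure : ∀ᵐ m ∂(unfoldMeasure N), m.1.2.2 ∈ Ioo (0 : ℝ) 1 ∧ m.2 ∈ unitCell N := by
  have h1 : ∀ᵐ s ∂((volume : Measure ℝ).restrict (Ioo 0 1)), s ∈ Ioo (0 : ℝ) 1 :=
    ae_restrict_mem measurableSet_Ioo
  have h2 : ∀ᵐ y ∂((volume : Measure (Euc N)).restrict (unitCell N)), y ∈ unitCell N :=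
    ae_restrict_mem isOpen_unitCell.measurableSet
  have h3 : ∀ᵐ p ∂(paramMeasure N), p.2.2 ∈ Ioo (0 : ℝ) 1 :=
    (Measure.quasiMeasurePreserving_snd.comp Measure.quasiMeasurePreserving_snd).ae h1
  filter_upwards [Measure.quasiMeasurePreserving_fst.ae h3,
    Measure.quasiMeasurePreserving_snd.ae h2] with m h h' using ⟨h, h'⟩

variable {ε δ : ℕ → ℝ}

theorem tendsto_unfolding (hε : ∀ n, 0 < ε n) (hδ : ∀ n, 0 < δ n) (hε0 : Tendsto ε atTop (𝓝 0))
    (hδ0 : Tendsto δ atTop (𝓝 0)) {m : (Euc N × ℝ × ℝ) × Euc N}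
    (hm : m.1.2.2 ∈ Ioo (0 : ℝ) 1 ∧ m.2 ∈ unitCell N) :
    Tendsto (fun n => unfolding (ε n) (δ n) m) atTop (𝓝 (m.1.1, m.1.2.1)) := by
  rw [tendsto_iff_norm_sub_tendsto_zero]
  refine squeeze_zero (fun _ => norm_nonneg _)
    (fun n => norm_unfolding_sub_le (hε n) (hδ n) hm) ?_
  simpa using (hε0.mul_const (2 * √N)).add hδ0

theorem memLp_paramMeasure_ball (R : ℝ) : MemLp (fun p : Euc N × ℝ × ℝ =>
    (Metric.closedBall (0 : Euc N × ℝ) R).indicator (fun _ => (1 : ℝ)) (p.1, p.2.1)) 2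
    (paramMeasure N) := by
  have h1 : (fun p : Euc N × ℝ × ℝ =>
      (Metric.closedBall (0 : Euc N × ℝ) R).indicator (fun _ => (1 : ℝ)) (p.1, p.2.1)) =
      (Metric.closedBall (0 : Euc N) R ×ˢ Metric.closedBall (0 : ℝ) R ×ˢ univ).indicator
        fun _ => 1 := by
    ext p
    have : ((p.1, p.2.1) ∈ Metric.closedBall (0 : Euc N × ℝ) R) ↔
        p ∈ Metric.closedBall (0 : Euc N) R ×ˢ Metric.closedBall (0 : ℝ) R ×ˢ univ := by
      simp [mem_prod]
    by_cases h : (p.1, p.2.1) ∈ Metric.closedBall (0 : Euc N × ℝ) R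
    · rw [indicator_of_mem h, indicator_of_mem (this.1 h)]
    · rw [indicator_of_notMem h, indicator_of_notMem (mt this.2 h)]
  rw [h1]
  refine memLp_indicator_const 2 ?_ 1 (Or.inr ?_)
  · exact Metric.isClosed_closedBall.measurableSet.prod
      (Metric.isClosed_closedBall.measurableSet.prod MeasurableSet.univ)
  · rw [Measure.prod_prod, Measure.prod_prod]
    refine ENNReal.mul_ne_top measure_closedBall_lt_top.ne
      (ENNReal.mul_ne_top measure_closedBall_lt_top.ne (by simp))

variable {H : Type*} [NormedAddCommGroup H]

/-- Functions of `(x, t; s, y)` that are continuous with compact support in `(x, t)` are, after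
unfolding of `(x, t)`, strongly approximated in `L²`. -/
theorem tendsto_eLpNorm_unfolding (hε : ∀ n, 0 < ε n) (hδ : ∀ n, 0 < δ n)
    (hε0 : Tendsto ε atTop (𝓝 0)) (hδ0 : Tendsto δ atTop (𝓝 0))
    {q : Euc N × ℝ → ℝ × Euc N → H} {b : Euc N → ℝ} {R : ℝ}
    (hqc : ∀ w, Continuous fun z => q z w)
    (hqm : ∀ n, AEStronglyMeasurable (fun m => q (unfolding (ε n) (δ n) m) (m.1.2.2, m.2))
      (unfoldMeasure N))
    (hb : MemLp b 2 (volume.restrict (unitCell N)))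
    (hqb : ∀ z, ∀ s ∈ Ioo (0 : ℝ) 1, ∀ y ∈ unitCell N, ‖q z (s, y)‖ ≤ b y)
    (hqR : ∀ z w, R < ‖z‖ → q z w = 0) :
    (∀ n, MemLp (fun m => q (unfolding (ε n) (δ n) m) (m.1.2.2, m.2)) 2 (unfoldMeasure N)) ∧
    MemLp (fun m => q (m.1.1, m.1.2.1) (m.1.2.2, m.2)) 2 (unfoldMeasure N) ∧
    Tendsto (fun n => eLpNorm (fun m => q (unfolding (ε n) (δ n) m) (m.1.2.2, m.2) -
      q (m.1.1, m.1.2.1) (m.1.2.2, m.2)) 2 (unfoldMeasure N)) atTop (𝓝 0) := by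
  obtain ⟨E, hE⟩ := hε0.bddAbove_range
  obtain ⟨D, hD⟩ := hδ0.bddAbove_range
  set R' := R + (E * (2 * √N) + D) with hR'
  have hB : MemLp (fun m : (Euc N × ℝ × ℝ) × Euc N =>
      (Metric.closedBall (0 : Euc N × ℝ) R').indicator (fun _ => (1 : ℝ))
      (m.1.1, m.1.2.1) • b m.2) 2 (unfoldMeasure N) := memLp_tensor (memLp_paramMeasure_ball R') hb
  have hdom : ∀ n, ∀ᵐ m ∂(unfoldMeasure N), ‖q (unfolding (ε n) (δ n) m) (m.1.2.2, m.2)‖ ≤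
      (Metric.closedBall (0 : Euc N × ℝ) R').indicator (fun _ => (1 : ℝ))
      (m.1.1, m.1.2.1) • b m.2 := by
    intro n
    filter_upwards [ae_unfoldMeasure] with m hm
    have hbm := hqb (unfolding (ε n) (δ n) m) _ hm.1 _ hm.2
    by_cases hz : (m.1.1, m.1.2.1) ∈ Metric.closedBall (0 : Euc N × ℝ) R'
    · rw [indicator_of_mem hz, one_smul]
      exact hbm
    · rw [indicator_of_notMem hz, zero_smul, hqR, norm_zero]
      by_contra hcon
      push Not at hcon
      refine hz ?_
      rw [mem_closedBall_zero_iff, hR']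
      have hEn : ε n ≤ E := hE ⟨n, rfl⟩
      have hDn : δ n ≤ D := hD ⟨n, rfl⟩
      have h3 : ‖unfolding (ε n) (δ n) m - (m.1.1, m.1.2.1)‖ ≤ E * (2 * √N) + D :=
        (norm_unfolding_sub_le (hε n) (hδ n) hm).trans (by gcongr)
      calc ‖(m.1.1, m.1.2.1)‖ = ‖unfolding (ε n) (δ n) m -
            (unfolding (ε n) (δ n) m - (m.1.1, m.1.2.1))‖ := by rw [sub_sub_cancel]
        _ ≤ _ := (norm_sub_le _ _).trans (add_le_add hcon h3)
  have hlim : ∀ᵐ m ∂(unfoldMeasure N), Tendsto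
      (fun n => q (unfolding (ε n) (δ n) m) (m.1.2.2, m.2)) atTop
      (𝓝 (q (m.1.1, m.1.2.1) (m.1.2.2, m.2))) := by
    filter_upwards [ae_unfoldMeasure] with m hm
    exact ((hqc _).tendsto _).comp (tendsto_unfolding hε hδ hε0 hδ0 hm)
  have hmem : ∀ n, MemLp (fun m => q (unfolding (ε n) (δ n) m) (m.1.2.2, m.2)) 2
      (unfoldMeasure N) := fun n => hB.mono (hqm n) <| by
    filter_upwards [hdom n] with m hm using hm.trans (le_abs_self _)
  refine ⟨hmem, ?_, tendsto_eLpNorm_two_of_dominated hqm hB hdom hlim⟩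
  refine hB.mono (aestronglyMeasurable_of_tendsto_ae _ hqm hlim) ?_
  filter_upwards [hlim, ae_all_iff.2 hdom] with m h1 h2
  exact (le_of_tendsto' h1.norm h2).trans (le_abs_self _)

end Unfolding

/-! ### Two-scale limits on perforated domains -/

section Sequence

variable {N : ℕ} {Ω YH : Set (Euc N)}

theorem isOpen_epsCell (ε : ℝ) (k : Fin N → ℤ) : IsOpen (epsCell ε k) :=
  isOpen_unitCell.preimage (by fun_prop)

theorem isOpen_perforated (hΩ : IsOpen Ω) (hc : IsCompact YH) (ε : ℝ) :
    IsOpen (perforated Ω YH ε) := by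
  refine (hΩ.inter ((isOpen_perStar hc).preimage (by fun_prop))).union ?_
  have : {x ∈ Ω | ∃ k : Fin N → ℤ, x ∈ epsCell ε k ∧ (epsCell ε k ∩ frontier Ω).Nonempty} =
      Ω ∩ ⋃ (k : Fin N → ℤ) (_ : (epsCell ε k ∩ frontier Ω).Nonempty), epsCell ε k := by
    ext x
    simp only [mem_ofPred_eq, mem_inter_iff, mem_iUnion, exists_prop]
    constructor
    · rintro ⟨h1, k, h2, h3⟩; exact ⟨h1, k, h3, h2⟩
    · rintro ⟨h1, k, h2, h3⟩; exact ⟨h1, k, h3, h2⟩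
  rw [this]
  exact hΩ.inter (isOpen_iUnion fun k => isOpen_iUnion fun _ => isOpen_epsCell ε k)

theorem perforated_subset (ε : ℝ) : perforated Ω YH ε ⊆ Ω := by
  rintro x (h | h) <;> exact h.1

/-- The pair of a function of `(t, x)` and its gradient, as a function of `(x, t)` extended by zero
from `A × (0, T)`. -/
noncomputable def jetExt (A : Set (Euc N)) (T : ℝ) (u : ℝ → Euc N → ℝ) (g : ℝ → Euc N → Euc N) :
    Euc N × ℝ → Jet N :=
  (A ×ˢ Ioo 0 T).indicator fun z => jet (u z.2 z.1) (g z.2 z.1)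

section JetExt

variable {A : Set (Euc N)} {T : ℝ} {u : ℝ → Euc N → ℝ} {g : ℝ → Euc N → Euc N}

theorem memLp_swap_restrict {F : Type*} [NormedAddCommGroup F] {h : ℝ → Euc N → F}
    (hh : MemLp (Function.uncurry h) 2
      ((volume.restrict (Ioo 0 T)).prod (volume.restrict A))) :
    MemLp (fun z : Euc N × ℝ => h z.2 z.1) 2 (volume.restrict (A ×ˢ Ioo 0 T)) := by
  have h1 := memLp_comp_swap hh
  rw [Measure.prod_restrict] at h1
  exact h1

theorem memLp_jetExt (hA : IsOpen A)
    (h : MemL2H1 (volume.restrict (Ioo 0 T)) A u g) : MemLp (jetExt A T u g) 2 volume := by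
  rw [jetExt, memLp_indicator_iff_restrict (hA.measurableSet.prod measurableSet_Ioo)]
  exact memLp_jet (memLp_swap_restrict h.memLp_fun) (memLp_swap_restrict h.memLp_grad)

theorem eLpNorm_jetExt_le (hA : IsOpen A)
    (h : MemL2H1 (volume.restrict (Ioo 0 T)) A u g) : eLpNorm (jetExt A T u g) 2 volume ≤
      eLpNorm (Function.uncurry u) 2 ((volume.restrict (Ioo 0 T)).prod (volume.restrict A)) +
      eLpNorm (Function.uncurry g) 2 ((volume.restrict (Ioo 0 T)).prod (volume.restrict A)) := by
  have hm : MeasurePreserving (Prod.swap : Euc N × ℝ → ℝ × Euc N)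
      (volume.restrict (A ×ˢ Ioo 0 T)) ((volume.restrict (Ioo 0 T)).prod (volume.restrict A)) := by
    have h1 := Measure.measurePreserving_swap (μ := (volume : Measure (Euc N)).restrict A)
      (ν := (volume : Measure ℝ).restrict (Ioo 0 T))
    have h2 := Measure.prod_restrict (μ := (volume : Measure (Euc N))) (ν := (volume : Measure ℝ))
      A (Ioo 0 T)
    rwa [h2] at h1
  have h1 := memLp_swap_restrict h.memLp_fun
  have h2 := memLp_swap_restrict h.memLp_grad
  rw [jetExt, eLpNorm_indicator_eq_eLpNorm_restrict (hA.measurableSet.prod measurableSet_Ioo),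
    ← eLpNorm_comp_measurePreserving h.memLp_fun.1 hm,
    ← eLpNorm_comp_measurePreserving h.memLp_grad.1 hm,
    ← eLpNorm_norm (Function.uncurry u ∘ Prod.swap), ← eLpNorm_norm (Function.uncurry g ∘ Prod.swap)]
  refine le_trans ?_ (eLpNorm_add_le h1.1.norm h2.1.norm (by norm_num))
  refine eLpNorm_mono fun z => (norm_jet_le _ _).trans (le_abs_self _)

/-- An iterated integral of `(u, ∇u)` as an integral over the whole space. -/
theorem integral_inner_jetExt (hA : IsOpen A) (h : MemL2H1 (volume.restrict (Ioo 0 T)) A u g)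
    {Q : Euc N × ℝ → Jet N} (hQ : MemLp Q 2 (volume.restrict (A ×ˢ Ioo 0 T))) :
    ∫ z, inner ℝ (jetExt A T u g z) (Q z) =
      ∫ t in Ioo 0 T, ∫ x in A, inner ℝ (jet (u t x) (g t x)) (Q (x, t)) := by
  have h1 : ∀ z, (inner ℝ (jetExt A T u g z) (Q z) : ℝ) = (A ×ˢ Ioo 0 T).indicator
      (fun z => inner ℝ (jet (u z.2 z.1) (g z.2 z.1)) (Q z)) z := by
    intro z
    rw [jetExt]
    by_cases hz : z ∈ A ×ˢ Ioo 0 T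
    · rw [indicator_of_mem hz, indicator_of_mem hz]
    · rw [indicator_of_notMem hz, indicator_of_notMem hz, inner_zero_left]
  simp_rw [h1]
  rw [integral_indicator (hA.measurableSet.prod measurableSet_Ioo)]
  have h2 := integrable_inner_of_memLp (memLp_jet (memLp_swap_restrict h.memLp_fun)
    (memLp_swap_restrict h.memLp_grad)) hQ
  rw [Measure.volume_eq_prod, ← Measure.prod_restrict] at h2 ⊢
  rw [integral_prod_symm _ h2]

theorem integral_inner_jetExt_fderiv (hA : IsOpen A)
    (h : MemL2H1 (volume.restrict (Ioo 0 T)) A u g) {χ : Euc N → ℝ} (hχ : IsTestFun A χ)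
    (e : Euc N) {c : ℝ → ℝ} (hc : IsTestFun (Ioo 0 T) c) :
    ∫ z, inner ℝ (jetExt A T u g z) (c z.2 • jet (fderiv ℝ χ z.1 e) (χ z.1 • e)) = 0 := by
  have hd : Continuous fun x => fderiv ℝ χ x e :=
    (hχ.smooth.continuous_fderiv (by simp)).clm_apply continuous_const
  have hd' : HasCompactSupport fun x => fderiv ℝ χ x e :=
    (hχ.compact.fderiv (𝕜 := ℝ)).comp_left (g := fun L : Euc N →L[ℝ] ℝ => L e) rfl
  have hJ : MemLp (fun x => jet (fderiv ℝ χ x e) (χ x • e)) 2 (volume.restrict A) :=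
    memLp_jet ((hd.memLp_of_hasCompactSupport hd').restrict A)
      (((hχ.smooth.continuous.smul continuous_const).memLp_of_hasCompactSupport
        (hχ.compact.smul_right)).restrict A)
  rw [integral_inner_jetExt hA h]
  · rw [integral_congr_ae (g := fun _ => (0 : ℝ)), integral_zero]
    filter_upwards [ae_memLp_slice h.memLp_fun, ae_memLp_slice h.memLp_grad, h.weakGradient]
      with t h1 h2 h3
    simp only [Function.uncurry] at h1 h2
    simp only [inner_smul_right]
    rw [integral_const_mul, integral_inner_jet (memLp_jet h1 h2) hJ]
    have h4 := (MemH1.mk h1 h2 h3).integral_mul_fderiv hχ e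
    simp only [jet_fst, jet_snd] at h4 ⊢
    rw [h4]
    simp_rw [inner_smul_right]
    rw [neg_add_cancel, mul_zero]
  · rw [Measure.volume_eq_prod, ← Measure.prod_restrict]
    have h1 := memLp_tensor (hc.memLp (μ := volume) 2 (Ioo 0 T)) hJ
    exact memLp_comp_swap h1

end JetExt

/-- The sequence `f n`, composed of the functions `u` and their gradients on perforated domains of
period `ε n`, converges weakly after unfolding, with time scale `δ n`, to `Z`; the rapid
oscillations of `u` in time are controlled. -/
structure IsTwoScaleLimit (Ω YH : Set (Euc N)) (T : ℝ) (ε δ : ℕ → ℝ)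
    (f : ℕ → Euc N × ℝ → Jet N) (Z : (Euc N × ℝ × ℝ) × Euc N → Jet N) : Prop where
  ε_pos : ∀ n, 0 < ε n
  δ_pos : ∀ n, 0 < δ n
  ε_lim : Tendsto ε atTop (𝓝 0)
  δ_lim : Tendsto δ atTop (𝓝 0)
  memLp : ∀ n, MemLp (f n) 2 volume
  bounded : ∃ C : ℝ≥0, ∀ n, eLpNorm (f n) 2 volume ≤ C
  eq_zero : ∀ n z, z.1 ∉ perforated Ω YH (ε n) → f n z = 0
  integral_fderiv : ∀ n χ e c, IsTestFun (perforated Ω YH (ε n)) χ → IsTestFun (Ioo 0 T) c →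
    ∫ z, inner ℝ (f n z) (c z.2 • jet (fderiv ℝ χ z.1 e) (χ z.1 • e)) = 0
  oscillation : ∀ (v : Euc N → ℝ) (c₁ c₂ : ℝ → ℝ), IsTestFun Ω v → IsTestFun (Ioo 0 T) c₁ →
    ContDiff ℝ ∞ c₂ → Function.Periodic c₂ 1 →
    Tendsto (fun n => ∫ z, inner ℝ (f n z)
      (jet (v z.1 * (δ n * deriv (fun τ => c₁ τ * c₂ (τ / δ n)) z.2)) 0)) atTop (𝓝 0)
  memLp_lim : MemLp Z 2 (unfoldMeasure N)
  weak : ∀ q, MemLp q 2 (unfoldMeasure N) →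
    Tendsto (fun n => ∫ m, inner ℝ (f n (unfolding (ε n) (δ n) m)) (q m) ∂(unfoldMeasure N)) atTop
      (𝓝 (∫ m, inner ℝ (Z m) (q m) ∂(unfoldMeasure N)))

/-- The weak limit exists along a subsequence, as unfolding preserves the norms of `L²`. -/
theorem exists_isTwoScaleLimit {T r : ℝ} (hr : 0 < r) (hΩ : IsOpen Ω)
    (hc : IsCompact YH) {ε : ℕ → ℝ} (hε_pos : ∀ n, 0 < ε n) (hε_lim : Tendsto ε atTop (𝓝 0))
    {uε : ℕ → ℝ → Euc N → ℝ} {guε : ℕ → ℝ → Euc N → Euc N}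
    (huε : ∀ n, MemL2H1 (volume.restrict (Ioo 0 T)) (perforated Ω YH (ε n)) (uε n) (guε n))
    (hbdd : ∃ C : ℝ≥0, ∀ n,
      eLpNorm (Function.uncurry (uε n)) 2
        ((volume.restrict (Ioo 0 T)).prod (volume.restrict (perforated Ω YH (ε n)))) ≤ C ∧
      eLpNorm (Function.uncurry (guε n)) 2
        ((volume.restrict (Ioo 0 T)).prod (volume.restrict (perforated Ω YH (ε n)))) ≤ C)
    (hcond : ∀ (v₁ : Euc N → ℝ) (c₁ c₂ : ℝ → ℝ), IsTestFun Ω v₁ → IsTestFun (Ioo 0 T) c₁ →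
      ContDiff ℝ ∞ c₂ → Function.Periodic c₂ 1 →
      Tendsto (fun n => ε n ^ r * ∫ t in Ioo 0 T, ∫ x in perforated Ω YH (ε n),
        uε n t x * v₁ x * deriv (fun τ => c₁ τ * c₂ (τ / ε n ^ r)) t) atTop (𝓝 0)) :
    ∃ φ : ℕ → ℕ, StrictMono φ ∧ ∃ Z : (Euc N × ℝ × ℝ) × Euc N → Jet N,
      IsTwoScaleLimit Ω YH T (fun j => ε (φ j)) (fun j => ε (φ j) ^ r)
        (fun j => jetExt (perforated Ω YH (ε (φ j))) T (uε (φ j)) (guε (φ j))) Z := by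
  obtain ⟨C, hC⟩ := hbdd
  have hA := fun n => isOpen_perforated hΩ hc (ε n)
  have hδ_pos : ∀ n, 0 < ε n ^ r := fun n => Real.rpow_pos_of_pos (hε_pos n) r
  have hδ_lim : Tendsto (fun n => ε n ^ r) atTop (𝓝 0) := by
    have := hε_lim.rpow_const (p := r) (Or.inr hr.le)
    rwa [Real.zero_rpow hr.ne'] at this
  have hmp := fun n => measurePreserving_unfolding (N := N) (hε_pos n) (hδ_pos n)
  have hmem := fun n => memLp_jetExt (hA n) (huε n)
  have hbound : ∀ n, eLpNorm (jetExt (perforated Ω YH (ε n)) T (uε n) (guε n)) 2 volume ≤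
      ((C + C : ℝ≥0) : ℝ≥0∞) := fun n =>
    (eLpNorm_jetExt_le (hA n) (huε n)).trans (by
      rw [ENNReal.coe_add]; exact add_le_add (hC n).1 (hC n).2)
  have hcg : MeasurableSpace.CountablyGenerated ((Euc N × ℝ × ℝ) × Euc N) := inferInstance
  have hsf : SFinite (unfoldMeasure N) := inferInstance
  have : MeasureTheory.IsSeparable (unfoldMeasure N) := inferInstance
  obtain ⟨φ, hφ, Z, hZ, hlim⟩ := exists_weak_limit (μ := unfoldMeasure N)
    (fun n m => jetExt (perforated Ω YH (ε n)) T (uε n) (guε n) (unfolding (ε n) (ε n ^ r) m)) (C + C)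
    (fun n => (hmem n).comp_measurePreserving (hmp n))
    (fun n => (eLpNorm_comp_measurePreserving (hmem n).1 (hmp n)).trans_le (hbound n))
  refine ⟨φ, hφ, Z, fun n => hε_pos _, fun n => hδ_pos _, hε_lim.comp hφ.tendsto_atTop,
    hδ_lim.comp hφ.tendsto_atTop, fun n => hmem _, ⟨_, fun n => hbound _⟩, ?_, ?_, ?_, hZ, hlim⟩
  · intro n z hz
    exact indicator_of_notMem (fun h' => hz h'.1) _
  · intro n χ e c hχ hc
    exact integral_inner_jetExt_fderiv (hA _) (huε _) hχ e hc
  · intro v c₁ c₂ hv hc₁ hc₂ hper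
    refine ((hcond v c₁ c₂ hv hc₁ hc₂ hper).comp hφ.tendsto_atTop).congr fun n => ?_
    have hd : IsTestFun (Ioo 0 T) fun τ => c₁ τ * c₂ (τ / ε (φ n) ^ r) :=
      ⟨hc₁.smooth.mul (hc₂.comp (contDiff_id.div_const _)), hc₁.compact.mul_right,
        (tsupport_mul_subset_left).trans hc₁.support_subset⟩
    have hv' : MemLp v 2 (volume.restrict (perforated Ω YH (ε (φ n)))) := hv.memLp 2 _
    have hd' : MemLp (fun t => ε (φ n) ^ r * deriv (fun τ => c₁ τ * c₂ (τ / ε (φ n) ^ r)) t) 2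
        (volume.restrict (Ioo 0 T)) :=
      ((hd.smooth.continuous_deriv (by simp)).memLp_of_hasCompactSupport
        hd.compact.deriv).restrict _ |>.const_mul _
    rw [integral_inner_jetExt (hA _) (huε _)]
    · simp only [Function.comp_apply]
      rw [← integral_const_mul]
      congr 1; ext t
      rw [← integral_const_mul]
      congr 1; ext x
      rw [inner_jet]
      simp only [jet_fst, jet_snd, inner_zero_right]
      ring
    · refine memLp_jet ?_ MemLp.zero'
      rw [Measure.volume_eq_prod, ← Measure.prod_restrict]
      exact memLp_tensor hv' hd'

end Sequence

/-! ### Consequences of the equations on the perforated domains -/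

section Limit

variable {N : ℕ} {Ω YH : Set (Euc N)} {T : ℝ} {ε δ : ℕ → ℝ}
  {f : ℕ → Euc N × ℝ → Jet N} {Z : (Euc N × ℝ × ℝ) × Euc N → Jet N}

theorem integral_comp_of_measurePreserving {α β F : Type*} [MeasurableSpace α]
    [MeasurableSpace β] [NormedAddCommGroup F] [NormedSpace ℝ F] {μ : Measure α} {ν : Measure β}
    {Φ : α → β} (h : MeasurePreserving Φ μ ν) {g : β → F} (hg : AEStronglyMeasurable g ν) :
    ∫ a, g (Φ a) ∂μ = ∫ b, g b ∂ν := by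
  rw [← h.map_eq] at hg ⊢
  exact (integral_map h.aemeasurable hg).symm

namespace IsTwoScaleLimit

theorem measurePreserving (h : IsTwoScaleLimit Ω YH T ε δ f Z) (n : ℕ) :
    MeasurePreserving (unfolding (ε n) (δ n)) (unfoldMeasure N) volume :=
  measurePreserving_unfolding (h.ε_pos n) (h.δ_pos n)

theorem memLp_unfolded (h : IsTwoScaleLimit Ω YH T ε δ f Z) (n : ℕ) :
    MemLp (fun m => f n (unfolding (ε n) (δ n) m)) 2 (unfoldMeasure N) :=
  (h.memLp n).comp_measurePreserving (h.measurePreserving n)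

theorem integral_unfold (h : IsTwoScaleLimit Ω YH T ε δ f Z) (n : ℕ) {Q : Euc N × ℝ → Jet N}
    (hQ : AEStronglyMeasurable Q volume) : ∫ z, inner ℝ (f n z) (Q z) =
      ∫ m, inner ℝ (f n (unfolding (ε n) (δ n) m)) (Q (unfolding (ε n) (δ n) m))
        ∂(unfoldMeasure N) :=
  (integral_comp_of_measurePreserving (h.measurePreserving n) ((h.memLp n).1.inner hQ)).symm

theorem tendsto_of_strong (h : IsTwoScaleLimit Ω YH T ε δ f Z)
    {q : ℕ → (Euc N × ℝ × ℝ) × Euc N → Jet N} {q₀ : (Euc N × ℝ × ℝ) × Euc N → Jet N}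
    (hq : ∀ n, MemLp (q n) 2 (unfoldMeasure N)) (hq₀ : MemLp q₀ 2 (unfoldMeasure N))
    (hlim : Tendsto (fun n => eLpNorm (fun m => q n m - q₀ m) 2 (unfoldMeasure N)) atTop (𝓝 0)) :
    Tendsto (fun n => ∫ m, inner ℝ (f n (unfolding (ε n) (δ n) m)) (q n m) ∂(unfoldMeasure N)) atTop
      (𝓝 (∫ m, inner ℝ (Z m) (q₀ m) ∂(unfoldMeasure N))) := by
  obtain ⟨C, hC⟩ := h.bounded
  exact tendsto_integral_inner h.memLp_unfolded (fun n =>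
    (eLpNorm_comp_measurePreserving (h.memLp n).1 (h.measurePreserving n)).trans_le (hC n))
    h.weak hq hq₀ hlim

/-- In the holes, the limit vanishes. -/
theorem lim_eq_zero_of_mem_hole (h : IsTwoScaleLimit Ω YH T ε δ f Z) (hΩ : IsOpen Ω)
    (hc : IsCompact YH) (hsub : YH ⊆ unitCell N) :
    ∀ᵐ m ∂(unfoldMeasure N), m.1.1 ∈ Ω → m.2 ∈ YH → Z m = 0 := by
  set S : Set ((Euc N × ℝ × ℝ) × Euc N) := {m | m.1.1 ∈ Ω ∧ m.2 ∈ YH} with hS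
  have hSm : MeasurableSet S :=
    (hΩ.measurableSet.preimage (measurable_fst.comp measurable_fst)).inter
      (hc.isClosed.measurableSet.preimage measurable_snd)
  -- the points in cells that may stick out of `Ω`
  set A : ℕ → Set ((Euc N × ℝ × ℝ) × Euc N) := fun n =>
    {m | Metric.infEDist m.1.1 Ωᶜ ≤ ENNReal.ofReal (ε n * (2 * √N))} with hA
  have hAm : ∀ n, MeasurableSet (A n) := fun n =>
    measurableSet_le (Metric.continuous_infEDist.measurable.comp
      (measurable_fst.comp measurable_fst)) measurable_const
  have hZS : MemLp (S.indicator Z) 2 (unfoldMeasure N) := h.memLp_lim.indicator hSm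
  have hzero : ∀ n m, m ∈ S → m ∉ A n → f n (unfolding (ε n) (δ n) m) = 0 := by
    intro n m hmS hmA
    refine h.eq_zero n _ fun hmem => ?_
    have hy := hsub hmS.2
    have hsubΩ : ∀ y ∈ unitCell N, (unfolding (ε n) (δ n) (m.1, y)).1 ∈ Ω := by
      intro y hy
      by_contra hcon
      refine hmA ?_
      have h1 := norm_unfolding_fst_sub_le (δ := δ n) (h.ε_pos n) m.1 hy
      refine (Metric.infEDist_le_edist_of_mem hcon).trans ?_
      rw [edist_comm, edist_dist, dist_eq_norm]
      exact ENNReal.ofReal_le_ofReal h1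
    have hidx := unfolding_fst_index (δ := δ n) (h.ε_pos n).ne' m.1 (y := m.2)
    -- a point in a hole of a cell inside `Ω` belongs to the perforated domain only if the cell
    -- meets `∂Ω`, which is impossible as `Ω` is open
    rcases hmem with hmem | ⟨-, k, hk, x, hx, hxf⟩
    · refine hmem.2 (cellIndex ((ε n)⁻¹ • m.1.1)) ?_
      rw [hidx, add_sub_cancel_right]
      exact hmS.2
    · have hkk : cellIndex ((ε n)⁻¹ • m.1.1) = k := by
        have h1 := isTiling_latticeHom.floor_add _ (unitCell_subset_halfOpenCell hk) k
        have h2 := isTiling_latticeHom.floor_add _ (unitCell_subset_halfOpenCell hy)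
          (cellIndex ((ε n)⁻¹ • m.1.1))
        rw [latticeHom_apply] at h1 h2
        rw [sub_add_cancel, hidx] at h1
        rw [← h1, h2]
      have h1 := hsubΩ _ hx
      have h2 : (unfolding (ε n) (δ n) (m.1, (ε n)⁻¹ • x - latticeVec k)).1 = x := by
        simp [unfolding, hkk, smul_smul, (h.ε_pos n).ne']
      rw [h2] at h1
      exact (disjoint_left.1 (disjoint_frontier_iff_isOpen.2 hΩ).symm h1 hxf)
  have hlim : Tendsto (fun n => ∫ m, inner ℝ (f n (unfolding (ε n) (δ n) m))
      ((A n).indicator (S.indicator Z) m) ∂(unfoldMeasure N)) atTop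
      (𝓝 (∫ m, inner ℝ (Z m) (0 : Jet N) ∂(unfoldMeasure N))) := by
    refine h.tendsto_of_strong (q₀ := fun _ => 0) (fun n => hZS.indicator (hAm n)) MemLp.zero' ?_
    refine tendsto_eLpNorm_two_of_dominated (fun n => (hZS.indicator (hAm n)).1) hZS.norm
      (fun n => Eventually.of_forall fun m => norm_indicator_le_norm_self _ _)
      (Eventually.of_forall fun m => ?_)
    by_cases hm : m ∈ S
    · have hpos : 0 < Metric.infEDist m.1.1 Ωᶜ := by
        rw [Metric.infEDist_pos_iff_notMem_closure, hΩ.isClosed_compl.closure_eq, notMem_compl_iff]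
        exact hm.1
      have h1 : Tendsto (fun n => ENNReal.ofReal (ε n * (2 * √N))) atTop (𝓝 0) := by
        have := ENNReal.tendsto_ofReal (h.ε_lim.mul_const (2 * √N))
        simpa using this
      refine tendsto_const_nhds.congr' ?_
      filter_upwards [h1.eventually_lt_const hpos] with n hn
      rw [indicator_of_notMem]
      simpa [hA] using hn
    · refine tendsto_const_nhds.congr fun n => ?_
      simp [indicator, hm]
  have hlim2 := h.weak _ hZS
  have heq : ∀ n, ∫ m, inner ℝ (f n (unfolding (ε n) (δ n) m)) (S.indicator Z m) ∂(unfoldMeasure N)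
      = ∫ m, inner ℝ (f n (unfolding (ε n) (δ n) m))
        ((A n).indicator (S.indicator Z) m) ∂(unfoldMeasure N) := by
    intro n
    congr 1; ext m
    by_cases hmA : m ∈ A n
    · rw [indicator_of_mem hmA]
    · rw [indicator_of_notMem hmA, inner_zero_right]
      by_cases hmS : m ∈ S
      · rw [hzero n m hmS hmA, inner_zero_left]
      · rw [indicator_of_notMem hmS, inner_zero_right]
  simp_rw [heq] at hlim2
  have h0 := tendsto_nhds_unique hlim2 hlim
  simp only [inner_zero_right, integral_zero] at h0
  have h1 : S.indicator Z =ᵐ[unfoldMeasure N] 0 := by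
    refine ae_eq_zero_of_integral_inner_self hZS ?_
    rw [← h0]
    congr 1; ext m
    by_cases hmS : m ∈ S
    · rw [indicator_of_mem hmS]
    · rw [indicator_of_notMem hmS, inner_zero_right, inner_zero_right]
  filter_upwards [h1] with m hm hmΩ hmY
  rwa [indicator_of_mem (show m ∈ S from ⟨hmΩ, hmY⟩)] at hm

end IsTwoScaleLimit

theorem integral_unfoldMeasure_eq_cellStar (hc : IsCompact YH)
    {G : (Euc N × ℝ × ℝ) × Euc N → ℝ} (hG : ∀ m, m.2 ∈ unitCell N → m.2 ∉ cellStar YH → G m = 0) :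
    ∫ m, G m ∂(unfoldMeasure N) =
      ∫ m, G m ∂((paramMeasure N).prod (volume.restrict (cellStar YH))) := by
  have hY : MeasurableSet (cellStar YH) := (isOpen_cellStar hc).measurableSet
  have h1 : (paramMeasure N).prod (volume.restrict (cellStar YH)) =
      (unfoldMeasure N).restrict (univ ×ˢ cellStar YH) := by
    rw [← Measure.prod_restrict, Measure.restrict_univ, Measure.restrict_restrict hY,
      show cellStar YH ∩ unitCell N = cellStar YH from inter_eq_left.2 sdiff_subset]
  rw [h1, setIntegral_eq_integral_of_ae_compl_eq_zero]
  filter_upwards [ae_unfoldMeasure] with m hm hmY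
  exact hG m hm.2 fun h' => hmY ⟨mem_univ _, h'⟩

/-- The field `c φ (u/ε, ∇u)` corrected by the term with `∇φ`, with which the equations on the
perforated domains become orthogonality relations on the cell. -/
noncomputable def fluxJet (ε : ℝ) (φ : Euc N → ℝ) (c₁ c₂ : ℝ → ℝ) (z : Euc N × ℝ) (s : ℝ)
    (j : Jet N) : Jet N :=
  (c₁ z.2 * c₂ s) • jet (ε⁻¹ * φ z.1 * j.fst) (j.fst • gradient φ z.1 + φ z.1 • j.snd)

/-- Smooth functions on the real line of period one. -/
structure IsPeriodicTime (c : ℝ → ℝ) : Prop where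
  smooth : ContDiff ℝ ∞ c
  periodic : Function.Periodic c 1

theorem IsPeriodicTime.exists_bound {c : ℝ → ℝ} (h : IsPeriodicTime c) : ∃ C, ∀ s, ‖c s‖ ≤ C := by
  obtain ⟨C, hC⟩ := (h.periodic.compact_of_continuous one_ne_zero
    h.smooth.continuous).isBounded.exists_norm_le
  exact ⟨C, fun s => hC _ ⟨s, rfl⟩⟩

section Flux

variable {φ : Euc N → ℝ} {c₁ c₂ : ℝ → ℝ}

theorem inner_fluxJet (ε : ℝ) (z : Euc N × ℝ) (s : ℝ) (j k : Jet N) :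
    inner ℝ (fluxJet ε φ c₁ c₂ z s j) k = inner ℝ j ((c₁ z.2 * c₂ s) •
      jet (ε⁻¹ * φ z.1 * k.fst + inner ℝ (gradient φ z.1) k.snd) (φ z.1 • k.snd)) := by
  rw [fluxJet, inner_smul_left, inner_smul_right, inner_jet, inner_jet]
  simp only [jet_fst, jet_snd, inner_add_left, inner_smul_left, inner_smul_right, conj_trivial]
  ring

theorem continuous_fluxJet (ε : ℝ) (hφ : IsTestFun Ω φ) (hc₁ : Continuous c₁)
    (hc₂ : Continuous c₂) : Continuous fun p : (Euc N × ℝ) × ℝ × Jet N =>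
      fluxJet ε φ c₁ c₂ p.1 p.2.1 p.2.2 := by
  have h1 := hφ.smooth.continuous
  have h2 := hφ.continuous_gradient
  have h3 : Continuous fun p : (Euc N × ℝ) × ℝ × Jet N => p.2.2.fst :=
    continuous_jet_fst.comp (by fun_prop)
  have h4 : Continuous fun p : (Euc N × ℝ) × ℝ × Jet N => p.2.2.snd :=
    continuous_jet_snd.comp (by fun_prop)
  unfold fluxJet
  have h5 : Continuous fun p : (Euc N × ℝ) × ℝ × Jet N => c₁ p.1.2 * c₂ p.2.1 := by fun_prop
  exact h5.smul (continuous_jet.comp (f := fun p : (Euc N × ℝ) × ℝ × Jet N =>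
    (ε⁻¹ * φ p.1.1 * p.2.2.fst, p.2.2.fst • gradient φ p.1.1 + φ p.1.1 • p.2.2.snd)) (by fun_prop))

theorem exists_norm_fluxJet_le (ε : ℝ) (hφ : IsTestFun Ω φ) (hc₁ : IsTestFun (Ioo 0 T) c₁)
    (hc₂ : IsPeriodicTime c₂) : ∃ C, ∀ z s j, ‖fluxJet ε φ c₁ c₂ z s j‖ ≤ C * ‖j‖ := by
  obtain ⟨C₁, h1⟩ := hc₁.compact.exists_bound_of_continuous hc₁.smooth.continuous
  obtain ⟨C₂, h2⟩ := hc₂.exists_bound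
  obtain ⟨C₃, h3⟩ := hφ.compact.exists_bound_of_continuous hφ.smooth.continuous
  obtain ⟨C₄, h4⟩ := hφ.hasCompactSupport_gradient.exists_bound_of_continuous hφ.continuous_gradient
  have p1 : 0 ≤ C₁ := (norm_nonneg _).trans (h1 0)
  have p2 : 0 ≤ C₂ := (norm_nonneg _).trans (h2 0)
  have p3 : 0 ≤ C₃ := (norm_nonneg _).trans (h3 0)
  have p4 : 0 ≤ C₄ := (norm_nonneg _).trans (h4 0)
  refine ⟨C₁ * C₂ * (‖ε⁻¹‖ * C₃ + (C₄ + C₃)), fun z s j => ?_⟩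
  rw [fluxJet, norm_smul, norm_mul, mul_assoc (C₁ * C₂)]
  gcongr
  · exact h1 _
  · exact h2 _
  refine (norm_jet_le _ _).trans ?_
  rw [add_mul]
  gcongr
  · rw [norm_mul, norm_mul]
    gcongr
    · exact h3 _
    · exact norm_jet_fst_le j
  · refine (norm_add_le _ _).trans ?_
    rw [norm_smul, norm_smul, add_mul, mul_comm C₄]
    gcongr
    · exact norm_jet_fst_le j
    · exact h4 _
    · exact h3 _
    · exact norm_jet_snd_le j

/-- Products of a test function with a rapidly oscillating one that avoids the holes. -/
theorem IsTestFun.mul_comp_smul {ε : ℝ} (hφ : IsTestFun Ω φ) {η : Euc N → ℝ}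
    (hη : IsPerTest YH η) : IsTestFun (perforated Ω YH ε) fun x => φ x * η (ε⁻¹ • x) := by
  refine ⟨hφ.smooth.mul (hη.smooth.comp (contDiff_id.const_smul _)), hφ.compact.mul_right, ?_⟩
  have h1 : IsClosed {x : Euc N | x ∈ tsupport φ ∧ ε⁻¹ • x ∈ tsupport η} :=
    (isClosed_tsupport φ).inter ((isClosed_tsupport η).preimage (by fun_prop))
  refine (closure_minimal (fun x hx => ?_) h1).trans fun x hx =>
    Or.inl ⟨hφ.support_subset hx.1, hη.support_subset hx.2⟩
  rw [Function.mem_support] at hx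
  exact ⟨subset_tsupport _ (left_ne_zero_of_mul hx), subset_tsupport _ (right_ne_zero_of_mul hx)⟩

theorem exists_radius (hφ : IsTestFun Ω φ) (hc₁ : IsTestFun (Ioo 0 T) c₁) :
    ∃ R, ∀ z : Euc N × ℝ, R < ‖z‖ → (φ z.1 = 0 ∧ gradient φ z.1 = 0) ∨ c₁ z.2 = 0 := by
  obtain ⟨R₁, h1⟩ := hφ.compact.isCompact.isBounded.exists_norm_le
  obtain ⟨R₂, h2⟩ := hc₁.compact.isCompact.isBounded.exists_norm_le
  refine ⟨max R₁ R₂, fun z hz => ?_⟩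
  rw [Prod.norm_def, lt_max_iff] at hz
  rcases hz with hz | hz
  · left
    have h3 : z.1 ∉ tsupport φ := fun h' =>
      ((h1 _ h').trans (le_max_left _ _)).not_gt hz
    refine ⟨image_eq_zero_of_notMem_tsupport h3, ?_⟩
    rw [gradient, image_eq_zero_of_notMem_tsupport (fun h' => h3 (tsupport_fderiv_subset ℝ h')),
      map_zero]
  · right
    exact image_eq_zero_of_notMem_tsupport fun h' =>
      ((h2 _ h').trans (le_max_right _ _)).not_gt hz

theorem cellTests_eq_zero (hsub : YH ⊆ unitCell N) {τ : Euc N → Jet N} (hτ : τ ∈ cellTests YH)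
    {y : Euc N} (hy : y ∈ unitCell N) (hy' : y ∉ cellStar YH) : τ y = 0 := by
  obtain ⟨η, e, hη, rfl⟩ := hτ
  have h1 : y ∉ tsupport η := fun h' => by
    rw [cellStar_eq hsub] at hy'
    exact hy' ⟨hy, hη.support_subset h'⟩
  have h2 : fderiv ℝ η y = 0 :=
    image_eq_zero_of_notMem_tsupport fun h' => h1 (tsupport_fderiv_subset ℝ h')
  have h3 : η y = 0 := image_eq_zero_of_notMem_tsupport h1
  simp only [h2, h3, zero_smul]
  rfl

namespace IsTwoScaleLimit

theorem memLp_flux (h : IsTwoScaleLimit Ω YH T ε δ f Z) (hφ : IsTestFun Ω φ)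
    (hc₁ : IsTestFun (Ioo 0 T) c₁) (hc₂ : IsPeriodicTime c₂) (n : ℕ) :
    MemLp (fun m : (Euc N × ℝ × ℝ) × Euc N => fluxJet (ε n) φ c₁ c₂ (unfolding (ε n) (δ n) m)
      m.1.2.2 (f n (unfolding (ε n) (δ n) m))) 2 (unfoldMeasure N) := by
  obtain ⟨C, hC⟩ := exists_norm_fluxJet_le (ε n) hφ hc₁ hc₂
  refine ((h.memLp_unfolded n).norm.const_mul C).mono ?_
    (Eventually.of_forall fun m => (hC _ _ _).trans (le_abs_self _))
  have h1 := (h.measurePreserving n).measurable.aestronglyMeasurable (μ := unfoldMeasure N)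
  have h2 : AEStronglyMeasurable (fun m : (Euc N × ℝ × ℝ) × Euc N => m.1.2.2) (unfoldMeasure N) :=
    (by fun_prop : Measurable fun m : (Euc N × ℝ × ℝ) × Euc N => m.1.2.2).aestronglyMeasurable
  exact (continuous_fluxJet (ε n) hφ hc₁.smooth.continuous
    hc₂.smooth.continuous).comp_aestronglyMeasurable
    (h1.prodMk (h2.prodMk (h.memLp_unfolded n).1))

/-- The equation for `f n`, tested with the product of `φ` and the oscillating functions. -/
theorem integral_flux_cellTests (h : IsTwoScaleLimit Ω YH T ε δ f Z) (hφ : IsTestFun Ω φ)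
    (hc₁ : IsTestFun (Ioo 0 T) c₁) (hc₂ : IsPeriodicTime c₂) (n : ℕ) {τ : Euc N → Jet N}
    (hτ : τ ∈ cellTests YH) :
    ∫ m, inner ℝ (fluxJet (ε n) φ c₁ c₂ (unfolding (ε n) (δ n) m)
      m.1.2.2 (f n (unfolding (ε n) (δ n) m))) (τ m.2) ∂(unfoldMeasure N) = 0 := by
  obtain ⟨η, e, hη, rfl⟩ := hτ
  have hχ := hφ.mul_comp_smul (ε := ε n) hη
  have hc : IsTestFun (Ioo 0 T) fun t => c₁ t * c₂ (t / δ n) :=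
    ⟨hc₁.smooth.mul (hc₂.smooth.comp (contDiff_id.div_const _)), hc₁.compact.mul_right,
      (tsupport_mul_subset_left).trans hc₁.support_subset⟩
  have h1 := h.integral_fderiv n _ e _ hχ hc
  have hd : Continuous fun x => fderiv ℝ (fun x => φ x * η ((ε n)⁻¹ • x)) x e :=
    (hχ.smooth.continuous_fderiv (by simp)).clm_apply continuous_const
  have hd2 := hχ.smooth.continuous
  have hd3 := hc.smooth.continuous
  rw [h.integral_unfold n] at h1
  · rw [← h1]
    congr 1; ext m
    rw [inner_fluxJet]
    have hper := unfolding_fst_index (δ := δ n) (h.ε_pos n).ne' m.1 (y := m.2)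
    have hper2 := unfolding_snd_index (ε := ε n) (h.δ_pos n).ne' m.1 (y := m.2)
    have e2 : c₂ ((unfolding (ε n) (δ n) m).2 / δ n) = c₂ m.1.2.2 := by
      rw [hper2]
      simpa using hc₂.periodic.int_mul ⌊(δ n)⁻¹ * m.1.2.1⌋ m.1.2.2
    have e3 : fderiv ℝ (fun x => φ x * η ((ε n)⁻¹ • x)) (unfolding (ε n) (δ n) m).1 e =
        (ε n)⁻¹ * φ (unfolding (ε n) (δ n) m).1 * fderiv ℝ η m.2 e +
          inner ℝ (gradient φ (unfolding (ε n) (δ n) m).1) (η m.2 • e) := by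
      have d1 := (hφ.smooth.differentiable (by simp)).differentiableAt
        (x := (unfolding (ε n) (δ n) m).1) |>.hasFDerivAt
      have d2 := (hη.smooth.differentiable (by simp)).differentiableAt
        (x := (ε n)⁻¹ • (unfolding (ε n) (δ n) m).1) |>.hasFDerivAt
      have d3 := d1.mul (d2.comp (unfolding (ε n) (δ n) m).1
        ((hasFDerivAt_id (𝕜 := ℝ) (unfolding (ε n) (δ n) m).1).const_smul (ε n)⁻¹))
      have d4 := d3.fderiv
      simp only [Function.comp_def] at d4
      rw [show (fun x => φ x * η ((ε n)⁻¹ • x)) = (φ * fun x => η ((ε n)⁻¹ • x)) from rfl, d4]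
      rw [hper]
      simp only [FunLike.coe_add, FunLike.coe_smul, Pi.add_apply, Pi.smul_apply,
        ContinuousLinearMap.comp_apply, ContinuousLinearMap.id_apply, map_smul,
        hη.fderiv_periodic, hη.periodic, smul_eq_mul, inner_smul_right, inner_gradient_eq_fderiv]
      ring
    simp only [e2, e3, hper, hη.periodic, jet_fst, jet_snd, smul_smul]
  · have hd4 : Continuous fun z : Euc N × ℝ => φ z.1 * η ((ε n)⁻¹ • z.1) := hd2.comp continuous_fst
    have hd5 : Continuous fun z : Euc N × ℝ =>
      fderiv ℝ (fun x => φ x * η ((ε n)⁻¹ • x)) z.1 e := hd.comp continuous_fst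
    exact (hd3.comp continuous_snd).aestronglyMeasurable.smul
      (continuous_jet.comp (f := fun z : Euc N × ℝ => (fderiv ℝ (fun x => φ x * η ((ε n)⁻¹ • x)) z.1 e,
        (φ z.1 * η ((ε n)⁻¹ • z.1)) • e)) (hd5.prodMk (hd4.smul continuous_const))).aestronglyMeasurable

/-- The orthogonality to `cellTests`, valid for all test functions in the other variables, passes to
the whole annihilator; here it is formulated for solenoidal fields. -/
theorem integral_flux_solenoidal (h : IsTwoScaleLimit Ω YH T ε δ f Z) (hc : IsCompact YH)
    (hsub : YH ⊆ unitCell N) (hφ : IsTestFun Ω φ)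
    (hc₁ : IsTestFun (Ioo 0 T) c₁) (hc₂ : IsPeriodicTime c₂) (n : ℕ) {θ : Euc N → Euc N}
    (hθ : IsSolenoidal YH θ) :
    ∫ m, inner ℝ (fluxJet (ε n) φ c₁ c₂ (unfolding (ε n) (δ n) m)
      m.1.2.2 (f n (unfolding (ε n) (δ n) m))) (jet 0 ((cellStar YH).indicator θ m.2))
      ∂(unfoldMeasure N) = 0 := by
  set ν := (volume : Measure (Euc N)).restrict (cellStar YH) with hν
  have hY : MeasurableSet (cellStar YH) := (isOpen_cellStar hc).measurableSet
  set Ψ := fun m : (Euc N × ℝ × ℝ) × Euc N => fluxJet (ε n) φ c₁ c₂ (unfolding (ε n) (δ n) m)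
      m.1.2.2 (f n (unfolding (ε n) (δ n) m)) with hΨ
  have hle : (paramMeasure N).prod ν ≤ unfoldMeasure N :=
    Measure.prod_mono le_rfl (Measure.restrict_mono sdiff_subset le_rfl)
  have hΨm : MemLp Ψ 2 ((paramMeasure N).prod ν) :=
    (h.memLp_flux hφ hc₁ hc₂ n).mono_measure hle
  obtain ⟨R, hR⟩ := exists_radius hφ hc₁
  -- a cut-off in `(x, t)` that takes account of the distance between a point and its unfolding
  set R' := R + (ε n * (2 * √N) + δ n)
  set ψ := fun p : Euc N × ℝ × ℝ =>
    (Metric.closedBall (0 : Euc N × ℝ) R').indicator (fun _ => (1 : ℝ)) (p.1, p.2.1)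
  have hψ : MemLp ψ 2 (paramMeasure N) := memLp_paramMeasure_ball R'
  have hψΨ : ∀ᵐ m ∂((paramMeasure N).prod ν), ψ m.1 = 1 ∨ Ψ m = 0 := by
    filter_upwards [hle.absolutelyContinuous.ae_le ae_unfoldMeasure] with m hm
    by_cases hz : (m.1.1, m.1.2.1) ∈ Metric.closedBall (0 : Euc N × ℝ) R'
    · exact Or.inl (indicator_of_mem hz _)
    · right
      have h1 : R < ‖unfolding (ε n) (δ n) m‖ := by
        by_contra hcon
        push Not at hcon
        refine hz ?_
        rw [mem_closedBall_zero_iff]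
        calc ‖(m.1.1, m.1.2.1)‖ = ‖unfolding (ε n) (δ n) m -
              (unfolding (ε n) (δ n) m - (m.1.1, m.1.2.1))‖ := by rw [sub_sub_cancel]
          _ ≤ _ := (norm_sub_le _ _).trans
            (add_le_add hcon (norm_unfolding_sub_le (h.ε_pos n) (h.δ_pos n) hm))
      rcases hR _ h1 with ⟨h2, h3⟩ | h2
      · simp only [hΨ, fluxJet, h2, h3, mul_zero, zero_mul, smul_zero, zero_smul, add_zero]
        exact smul_zero _
      · simp [hΨ, fluxJet, h2]
  have hred : ∀ τ : Euc N → Jet N, MemLp τ 2 ν →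
      ∫ m, inner ℝ (Ψ m) (τ m.2) ∂((paramMeasure N).prod ν) =
        ∫ y, inner ℝ (τ y) (∫ p, ψ p • Ψ (p, y) ∂(paramMeasure N)) ∂ν := by
    intro τ hτ
    rw [← integral_inner_tensor_left hψ hτ hΨm]
    apply integral_congr_ae
    filter_upwards [hψΨ] with m hm
    rcases hm with hm | hm
    · rw [hm, one_smul, real_inner_comm]
    · rw [hm, inner_zero_left, inner_zero_right]
  have hH := memLp_integral_smul_left hψ hΨm
  have hHt : ∀ τ ∈ cellTests YH, ∫ y, inner ℝ (τ y) (∫ p, ψ p • Ψ (p, y) ∂(paramMeasure N)) ∂ν = 0 := by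
    intro τ hτ
    rw [← hred τ (memLp_cellTests τ hτ), ← integral_unfoldMeasure_eq_cellStar hc,
      h.integral_flux_cellTests hφ hc₁ hc₂ n hτ]
    intro m hm hm'
    rw [cellTests_eq_zero hsub hτ hm hm', inner_zero_right]
  have h1 := hθ.orthogonal _ hH hHt
  rw [integral_unfoldMeasure_eq_cellStar hc]
  · have h2 := hred (fun y => jet 0 (θ y)) (memLp_jet MemLp.zero' hθ.memLp)
    simp only [inner_jet, jet_fst, jet_snd, zero_mul, mul_zero, zero_add] at h2 ⊢
    rw [h1] at h2
    rw [← h2]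
    apply integral_congr_ae
    filter_upwards [Measure.quasiMeasurePreserving_snd.ae (ae_restrict_mem hY)] with m hm
    rw [indicator_of_mem hm]
  · intro m _ hm
    rw [indicator_of_notMem hm]
    simp

end IsTwoScaleLimit

end Flux

end Limit

/-! ### Functions that do not oscillate -/

section Time

/-- Lebesgue measure on the unit interval. -/
noncomputable abbrev unitIoo : Measure ℝ := volume.restrict (Ioo 0 1)

theorem IsPeriodicTime.memLp {c : ℝ → ℝ} (h : IsPeriodicTime c) : MemLp c 2 unitIoo := by
  obtain ⟨C, hC⟩ := h.exists_bound
  exact MemLp.of_bound h.smooth.continuous.aestronglyMeasurable C (Eventually.of_forall hC)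

theorem determining_periodicTime : Determining unitIoo {c : ℝ → ℝ | IsPeriodicTime c} := by
  intro k hk h
  refine determining_testSpace (U := Ioo (0 : ℝ) 1) isOpen_Ioo k hk fun χ hχ => ?_
  have hχ' : IsTestFun (Ioo 0 1) χ := hχ
  have h1 := h (periodize (Int.castAddHom ℝ) χ)
    ⟨isTiling_intCast.contDiff_periodize hχ'.compact hχ'.smooth, fun y => by
      have := IsTiling.periodize_add (l := Int.castAddHom ℝ) χ y 1
      simpa using this⟩
  refine Eq.trans (integral_congr_ae ?_) h1
  filter_upwards [ae_restrict_mem measurableSet_Ioo] with s hs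
  have h2 : periodize (Int.castAddHom ℝ) χ s = χ s := by
    rw [periodize, finsum_eq_single _ 0]
    · simp
    · intro m hm
      refine hχ'.eq_zero fun h' => hm ?_
      have e1 := isTiling_intCast.floor_add_lattice s m
      have e2 := isTiling_intCast.mem_iff.1 (Ioo_subset_Ico_self hs)
      have e3 := isTiling_intCast.mem_iff.1 (Ioo_subset_Ico_self h')
      rw [e3, e2, zero_add] at e1
      exact e1.symm
  rw [h2]

theorem IsPeriodicTime.deriv {c : ℝ → ℝ} (h : IsPeriodicTime c) : IsPeriodicTime (deriv c) := by
  refine ⟨(contDiff_infty_iff_deriv.1 h.smooth).2, fun s => ?_⟩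
  rw [← deriv_comp_add_const]
  congr 1
  ext s
  exact h.periodic s

theorem isPeriodicTime_const (a : ℝ) : IsPeriodicTime fun _ => a :=
  ⟨contDiff_const, fun _ => rfl⟩

/-- A periodic function of mean zero has a periodic antiderivative. -/
theorem IsPeriodicTime.exists_antideriv {h : ℝ → ℝ} (hh : IsPeriodicTime h)
    (h0 : ∫ s in Ioo 0 1, h s = 0) : ∃ c, IsPeriodicTime c ∧ _root_.deriv c = h := by
  have hd : ∀ s, HasDerivAt (fun s => ∫ r in (0 : ℝ)..s, h r) (h s) s := fun s =>
    (hh.smooth.continuous.integral_hasStrictDerivAt 0 s).hasDerivAt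
  have hd' : _root_.deriv (fun s => ∫ r in (0 : ℝ)..s, h r) = h := funext fun s => (hd s).deriv
  refine ⟨fun s => ∫ r in (0 : ℝ)..s, h r, ⟨?_, fun s => ?_⟩, hd'⟩
  · refine contDiff_infty_iff_deriv.2 ⟨fun s => (hd s).differentiableAt, ?_⟩
    rw [hd']; exact hh.smooth
  · have hi : ∀ a b, IntervalIntegrable h volume a b := fun a b =>
      hh.smooth.continuous.intervalIntegrable a b
    rw [← intervalIntegral.integral_add_adjacent_intervals (hi 0 s) (hi s (s + 1)),
      hh.periodic.intervalIntegral_add_eq s 0, zero_add,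
      intervalIntegral.integral_of_le zero_le_one, integral_Ioc_eq_integral_Ioo, h0, add_zero]

/-- A function orthogonal to the derivatives of all periodic functions is constant. -/
theorem ae_eq_const_of_integral_deriv {k : ℝ → ℝ} (hk : MemLp k 2 unitIoo)
    (h : ∀ c, IsPeriodicTime c → ∫ s, deriv c s * k s ∂unitIoo = 0) :
    ∀ᵐ s ∂unitIoo, k s = ∫ s, k s ∂unitIoo := by
  set a := ∫ s, k s ∂unitIoo with ha
  have h1 : (fun s => k s - a) =ᵐ[unitIoo] 0 := by
    refine determining_periodicTime _ (hk.sub (memLp_const a)) fun c hc => ?_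
    have hc' : IsPeriodicTime c := hc
    set b := ∫ s, c s ∂unitIoo with hb
    have hint : Integrable c unitIoo := hc'.memLp.integrable (by norm_num)
    obtain ⟨C, hC, hCd⟩ := IsPeriodicTime.exists_antideriv (h := fun s => c s - b)
      ⟨hc'.smooth.sub contDiff_const, fun s => by simp only [hc'.periodic s]⟩ (by
        rw [integral_sub hint (integrable_const _)]
        simp [hb])
    have h2 := h C hC
    rw [hCd] at h2
    have i1 : Integrable (fun s => c s * k s) unitIoo := integrable_smul_of_memLp hc'.memLp hk
    have i2 : Integrable k unitIoo := hk.integrable (by norm_num)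
    simp_rw [sub_mul] at h2
    rw [integral_sub i1 (i2.const_mul b), integral_const_mul, ← ha] at h2
    simp only [RCLike.inner_apply, conj_trivial]
    simp_rw [mul_comm _ (c _), mul_sub]
    rw [integral_sub i1 (hint.mul_const a), integral_mul_const, ← hb]
    linarith
  filter_upwards [h1] with s hs
  exact sub_eq_zero.1 hs

variable {N : ℕ} {YH : Set (Euc N)}

/-- A function whose jet with gradient zero is orthogonal to `cellTests` is constant. -/
theorem ae_eq_const_of_forall_cellTests (hc : IsCompact YH) (hsub : YH ⊆ unitCell N)
    (hs : HasSmoothBoundary YH) (hconn : IsConnected (cellStar YH)) {w : Euc N → ℝ}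
    (hw : MemLp w 2 (volume.restrict (cellStar YH)))
    (h : ∀ τ ∈ cellTests YH, ∫ y in cellStar YH, (τ y).fst * w y = 0) :
    ∀ᵐ y ∂(volume.restrict (cellStar YH)),
      w y = (volume.real (cellStar YH))⁻¹ * ∫ y in cellStar YH, w y := by
  have hvol : volume.real (cellStar YH) ≠ 0 := volume_real_cellStar_ne_zero hc hconn
  obtain ⟨C, hC⟩ := poincare_cellTests hc hsub hs hconn
  set a := (volume.real (cellStar YH))⁻¹ * ∫ y in cellStar YH, w y with ha
  have hint : Integrable w (volume.restrict (cellStar YH)) := hw.integrable (by norm_num)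
  have hm : MemLp (fun y => jet (w y - a) (0 : Euc N)) 2 (volume.restrict (cellStar YH)) :=
    memLp_jet (hw.sub (memLp_const a)) MemLp.zero'
  have h1 := hC _ hm (fun τ hτ => ?_) ?_
  · simp only [jet_fst, jet_snd, eLpNorm_zero', mul_zero, nonpos_iff_eq_zero] at h1
    have h1' := (eLpNorm_eq_zero_iff (hw.1.sub aestronglyMeasurable_const) two_ne_zero).1 h1
    filter_upwards [h1'] with y hy
    exact sub_eq_zero.1 hy
  · have h2 := integral_cellTests_const hsub hτ a
    simp only [inner_jet, jet_fst, jet_snd, inner_zero_right, add_zero] at h2 ⊢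
    have hτm := memLp_jet_fst (memLp_cellTests τ hτ)
    simp_rw [mul_sub]
    have i1 : Integrable (fun y => (τ y).fst * w y) (volume.restrict (cellStar YH)) :=
      integrable_smul_of_memLp hτm hw
    have i2 : Integrable (fun y => (τ y).fst * a) (volume.restrict (cellStar YH)) :=
      (hτm.integrable (by norm_num)).mul_const a
    rw [integral_sub i1 i2, h τ hτ, h2, sub_zero]
  · simp only [jet_fst]
    rw [integral_sub hint (integrable_const _), integral_const, smul_eq_mul, ha]
    simp only [measureReal_restrict_apply_univ]
    field_simp
    simp

/-- A function of fast time and space that oscillates neither in time nor, outside the holes, in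
space is constant. -/
theorem ae_eq_const_of_forall_tests (hc : IsCompact YH) (hsub : YH ⊆ unitCell N)
    (hs : HasSmoothBoundary YH) (hconn : IsConnected (cellStar YH)) {k : ℝ × Euc N → ℝ}
    (hk : MemLp k 2 (unitIoo.prod (volume.restrict (cellStar YH))))
    (h1 : ∀ c, IsPeriodicTime c → ∀ τ ∈ cellTests YH,
      ∫ p, c p.1 * (τ p.2).fst * k p ∂(unitIoo.prod (volume.restrict (cellStar YH))) = 0)
    (h2 : ∀ c, IsPeriodicTime c →
      ∫ p, deriv c p.1 * k p ∂(unitIoo.prod (volume.restrict (cellStar YH))) = 0) :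
    ∀ᵐ s ∂unitIoo, ∀ᵐ y ∂(volume.restrict (cellStar YH)), k (s, y) =
      (volume.real (cellStar YH))⁻¹ *
        ∫ p, k p ∂(unitIoo.prod (volume.restrict (cellStar YH))) := by
  set ν := (volume : Measure (Euc N)).restrict (cellStar YH) with hν
  have hslice := ae_forall_integral_inner_slice_eq_zero (μ := unitIoo) (ν := ν)
    determining_periodicTime (fun _ h => h.memLp)
    (𝒯 := {σ | ∃ τ ∈ cellTests YH, σ = fun y => (τ y).fst})
    (by rintro _ ⟨τ, hτ, rfl⟩; exact memLp_jet_fst (memLp_cellTests τ hτ)) hk (by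
      rintro c hc _ ⟨τ, hτ, rfl⟩
      rw [← h1 c hc τ hτ]
      congr 1; ext p
      simp only [smul_eq_mul, RCLike.inner_apply, conj_trivial]
      ring)
  have hconst : ∀ᵐ s ∂unitIoo, ∀ᵐ y ∂ν,
      k (s, y) = (volume.real (cellStar YH))⁻¹ * ∫ y, k (s, y) ∂ν := by
    filter_upwards [hslice] with s hs'
    refine ae_eq_const_of_forall_cellTests hc hsub hs hconn hs'.1 fun τ hτ => ?_
    rw [← hs'.2 _ ⟨τ, hτ, rfl⟩]
    congr 1; ext y
    simp [mul_comm]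
  have hmean : MemLp (fun s => ∫ y, k (s, y) ∂ν) 2 unitIoo := by
    have := memLp_integral_inner_right (μ := unitIoo) (τ := fun _ => (1 : ℝ)) (memLp_const 1) hk
    simpa using this
  have hint : Integrable k (unitIoo.prod ν) := hk.integrable (by norm_num)
  have htime := ae_eq_const_of_integral_deriv hmean fun c hc => by
    have h3 := h2 c hc
    rw [integral_prod] at h3
    · simp only [integral_const_mul] at h3
      exact h3
    · have h4 : MemLp (fun p : ℝ × Euc N => deriv c p.1 • (1 : ℝ)) 2 (unitIoo.prod ν) :=
        memLp_tensor hc.deriv.memLp (memLp_const 1)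
      simp only [smul_eq_mul, mul_one] at h4
      exact integrable_smul_of_memLp h4 hk
  rw [integral_prod _ hint]
  filter_upwards [hconst, htime] with s h3 h4
  filter_upwards [h3] with y hy
  rw [hy, h4]

end Time

/-! ### Separation of scales in the limit -/

section Separate

variable {N : ℕ} {Ω YH : Set (Euc N)} {T : ℝ} {ε δ : ℕ → ℝ}
  {f : ℕ → Euc N × ℝ → Jet N} {Z : (Euc N × ℝ × ℝ) × Euc N → Jet N}

/-- The transformation of jets adjoint to the multiplication by `c φ` with the product rule for the
gradient. -/
noncomputable def testJet (φ : Euc N → ℝ) (c₁ c₂ : ℝ → ℝ) (z : Euc N × ℝ) (s : ℝ) (k : Jet N) :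
    Jet N :=
  (c₁ z.2 * c₂ s) • jet (φ z.1 * k.fst + inner ℝ (gradient φ z.1) k.snd) (φ z.1 • k.snd)

variable {φ : Euc N → ℝ} {c₁ c₂ : ℝ → ℝ}

theorem continuous_testJet (hφ : IsTestFun Ω φ) (hc₁ : Continuous c₁)
    (hc₂ : Continuous c₂) : Continuous fun p : (Euc N × ℝ) × ℝ × Jet N =>
      testJet φ c₁ c₂ p.1 p.2.1 p.2.2 := by
  have h1 := hφ.smooth.continuous
  have h2 := hφ.continuous_gradient
  have h3 : Continuous fun p : (Euc N × ℝ) × ℝ × Jet N => p.2.2.fst :=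
    continuous_jet_fst.comp (by fun_prop)
  have h4 : Continuous fun p : (Euc N × ℝ) × ℝ × Jet N => p.2.2.snd :=
    continuous_jet_snd.comp (by fun_prop)
  unfold testJet
  have h5 : Continuous fun p : (Euc N × ℝ) × ℝ × Jet N => c₁ p.1.2 * c₂ p.2.1 := by fun_prop
  exact h5.smul (continuous_jet.comp (f := fun p : (Euc N × ℝ) × ℝ × Jet N =>
    (φ p.1.1 * p.2.2.fst + inner ℝ (gradient φ p.1.1) p.2.2.snd, φ p.1.1 • p.2.2.snd))
    (by fun_prop))

theorem exists_norm_testJet_le (hφ : IsTestFun Ω φ) (hc₁ : IsTestFun (Ioo 0 T) c₁)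
    (hc₂ : IsPeriodicTime c₂) : ∃ C, ∀ z s k, ‖testJet φ c₁ c₂ z s k‖ ≤ C * ‖k‖ := by
  -- `testJet` is the adjoint of `fluxJet` for the parameter value `ε = 1`
  obtain ⟨C, hC⟩ := exists_norm_fluxJet_le 1 hφ hc₁ hc₂
  refine ⟨C, fun z s k => ?_⟩
  have h1 := inner_fluxJet (φ := φ) (c₁ := c₁) (c₂ := c₂) 1 z s (testJet φ c₁ c₂ z s k) k
  have h2 := real_inner_le_norm (fluxJet 1 φ c₁ c₂ z s (testJet φ c₁ c₂ z s k)) k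
  rw [h1, inv_one, one_mul] at h2
  have h3 : inner ℝ (testJet φ c₁ c₂ z s k) (testJet φ c₁ c₂ z s k) ≤
      C * ‖testJet φ c₁ c₂ z s k‖ * ‖k‖ := h2.trans (by gcongr; exact hC _ _ _)
  rw [real_inner_self_eq_norm_sq] at h3
  rcases (norm_nonneg (testJet φ c₁ c₂ z s k)).eq_or_lt with h4 | h4
  · have h5 := hC z s k
    have h6 := (norm_nonneg _).trans h5
    rwa [← h4]
  · nlinarith

namespace IsTwoScaleLimit

theorem tendsto_testJet_aux (h : IsTwoScaleLimit Ω YH T ε δ f Z) (hφ : IsTestFun Ω φ)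
    (hc₁ : IsTestFun (Ioo 0 T) c₁) (hc₂ : IsPeriodicTime c₂) {k : Euc N → Jet N}
    (hk : MemLp k 2 (volume.restrict (unitCell N))) :
    (∀ n, MemLp (fun m : (Euc N × ℝ × ℝ) × Euc N =>
      testJet φ c₁ c₂ (unfolding (ε n) (δ n) m) m.1.2.2 (k m.2)) 2 (unfoldMeasure N)) ∧
    Tendsto (fun n => ∫ m, inner ℝ (f n (unfolding (ε n) (δ n) m))
      (testJet φ c₁ c₂ (unfolding (ε n) (δ n) m) m.1.2.2 (k m.2)) ∂(unfoldMeasure N)) atTop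
      (𝓝 (∫ m, inner ℝ (Z m) (testJet φ c₁ c₂ (m.1.1, m.1.2.1) m.1.2.2 (k m.2))
        ∂(unfoldMeasure N))) := by
  obtain ⟨C, hC⟩ := exists_norm_testJet_le hφ hc₁ hc₂
  obtain ⟨R, hR⟩ := exists_radius hφ hc₁
  have hcont := continuous_testJet hφ hc₁.smooth.continuous hc₂.smooth.continuous
  have hqm : ∀ n, AEStronglyMeasurable (fun m : (Euc N × ℝ × ℝ) × Euc N =>
      testJet φ c₁ c₂ (unfolding (ε n) (δ n) m) m.1.2.2 (k m.2)) (unfoldMeasure N) := fun n => by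
    have e1 := (h.measurePreserving n).measurable.aestronglyMeasurable (μ := unfoldMeasure N)
    have e2 : AEStronglyMeasurable (fun m : (Euc N × ℝ × ℝ) × Euc N => m.1.2.2) (unfoldMeasure N) :=
      (by fun_prop : Measurable fun m : (Euc N × ℝ × ℝ) × Euc N => m.1.2.2).aestronglyMeasurable
    have e3 : AEStronglyMeasurable (fun m : (Euc N × ℝ × ℝ) × Euc N => k m.2) (unfoldMeasure N) :=
      hk.1.comp_snd
    exact hcont.comp_aestronglyMeasurable (e1.prodMk (e2.prodMk e3))
  have hqR : ∀ (z : Euc N × ℝ) (w : ℝ × Euc N), R < ‖z‖ →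
      testJet φ c₁ c₂ z w.1 (k w.2) = 0 := fun z w hz => by
    rcases hR z hz with ⟨h2, h3⟩ | h2
    · simp only [testJet, h2, h3, zero_mul, inner_zero_left, zero_smul, add_zero]
      exact smul_zero _
    · simp [testJet, h2]
  obtain ⟨h1, h2, h3⟩ := tendsto_eLpNorm_unfolding h.ε_pos h.δ_pos h.ε_lim h.δ_lim
    (q := fun z w => testJet φ c₁ c₂ z w.1 (k w.2)) (b := fun y => C * ‖k y‖) (R := R)
    (fun w => hcont.comp (f := fun z => (z, w.1, k w.2)) (by fun_prop))
    hqm (hk.norm.const_mul C) (fun z s _ y _ => hC _ _ _) hqR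
  exact ⟨h1, h.tendsto_of_strong h1 h2 h3⟩

theorem memLp_testJet (h : IsTwoScaleLimit Ω YH T ε δ f Z) (hφ : IsTestFun Ω φ)
    (hc₁ : IsTestFun (Ioo 0 T) c₁) (hc₂ : IsPeriodicTime c₂) {k : Euc N → Jet N}
    (hk : MemLp k 2 (volume.restrict (unitCell N))) (n : ℕ) :
    MemLp (fun m : (Euc N × ℝ × ℝ) × Euc N =>
      testJet φ c₁ c₂ (unfolding (ε n) (δ n) m) m.1.2.2 (k m.2)) 2 (unfoldMeasure N) :=
  (h.tendsto_testJet_aux hφ hc₁ hc₂ hk).1 n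

theorem tendsto_testJet (h : IsTwoScaleLimit Ω YH T ε δ f Z) (hφ : IsTestFun Ω φ)
    (hc₁ : IsTestFun (Ioo 0 T) c₁) (hc₂ : IsPeriodicTime c₂) {k : Euc N → Jet N}
    (hk : MemLp k 2 (volume.restrict (unitCell N))) :
    Tendsto (fun n => ∫ m, inner ℝ (f n (unfolding (ε n) (δ n) m))
      (testJet φ c₁ c₂ (unfolding (ε n) (δ n) m) m.1.2.2 (k m.2)) ∂(unfoldMeasure N)) atTop
      (𝓝 (∫ m, inner ℝ (Z m) (testJet φ c₁ c₂ (m.1.1, m.1.2.1) m.1.2.2 (k m.2))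
        ∂(unfoldMeasure N))) :=
  (h.tendsto_testJet_aux hφ hc₁ hc₂ hk).2

end IsTwoScaleLimit

end Separate

/-! ### Orthogonality relations in the limit -/

section Relations

variable {N : ℕ} {Ω YH : Set (Euc N)} {T : ℝ} {ε δ : ℕ → ℝ}
  {f : ℕ → Euc N × ℝ → Jet N} {Z : (Euc N × ℝ × ℝ) × Euc N → Jet N}

/-- Lebesgue measure for the slow variables `(x, t)`. -/
noncomputable abbrev slowMeasure (Ω : Set (Euc N)) (T : ℝ) : Measure (Euc N × ℝ) :=
  (volume.restrict Ω).prod (volume.restrict (Ioo 0 T))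

/-- Lebesgue measure for the fast variables `(s, y)`. -/
noncomputable abbrev fastMeasure (YH : Set (Euc N)) : Measure (ℝ × Euc N) :=
  unitIoo.prod (volume.restrict (cellStar YH))

/-- Lebesgue measure for the variables `(x, t, s)` on which correctors depend. -/
noncomputable abbrev domMeasure (Ω : Set (Euc N)) (T : ℝ) : Measure (Euc N × ℝ × ℝ) :=
  (volume.restrict Ω).prod ((volume.restrict (Ioo 0 T)).prod unitIoo)

/-- Rearrangement of the slow and the fast variables. -/
def regroup (N : ℕ) : (Euc N × ℝ) × (ℝ × Euc N) ≃ᵐ (Euc N × ℝ × ℝ) × Euc N :=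
  MeasurableEquiv.prodAssoc.symm.trans
    (MeasurableEquiv.prodCongr MeasurableEquiv.prodAssoc (MeasurableEquiv.refl _))

theorem regroup_apply (q : (Euc N × ℝ) × (ℝ × Euc N)) :
    regroup N q = ((q.1.1, q.1.2, q.2.1), q.2.2) := rfl

theorem measurePreserving_regroup : MeasurePreserving (regroup N)
    ((slowMeasure Ω T).prod (fastMeasure YH))
    ((domMeasure Ω T).prod (volume.restrict (cellStar YH))) := by
  have h1 := (measurePreserving_prodAssoc (slowMeasure Ω T) unitIoo
    (volume.restrict (cellStar YH))).symm
  have h2 := (measurePreserving_prodAssoc (volume.restrict Ω) (volume.restrict (Ioo 0 T))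
    unitIoo).prod (MeasurePreserving.id (volume.restrict (cellStar YH)))
  exact h2.comp h1

theorem domMeasure_prod_eq (hc : IsCompact YH) :
    (domMeasure Ω T).prod (volume.restrict (cellStar YH)) =
      (unfoldMeasure N).restrict ((Ω ×ˢ Ioo 0 T ×ˢ univ) ×ˢ cellStar YH) := by
  have hY : MeasurableSet (cellStar YH) := (isOpen_cellStar hc).measurableSet
  rw [← Measure.prod_restrict, Measure.restrict_restrict hY,
    show cellStar YH ∩ unitCell N = cellStar YH from inter_eq_left.2 sdiff_subset,
    ← Measure.prod_restrict, ← Measure.prod_restrict, Measure.restrict_univ]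

theorem domMeasure_prod_le (hc : IsCompact YH) :
    (domMeasure Ω T).prod (volume.restrict (cellStar YH)) ≤ unfoldMeasure N := by
  rw [domMeasure_prod_eq hc]; exact Measure.restrict_le_self

theorem memLp_indicator_cellStar {F : Type*} [NormedAddCommGroup F] (hc : IsCompact YH)
    {θ : Euc N → F} (hθ : MemLp θ 2 (volume.restrict (cellStar YH))) :
    MemLp ((cellStar YH).indicator θ) 2 (volume.restrict (unitCell N)) := by
  have hY : MeasurableSet (cellStar YH) := (isOpen_cellStar hc).measurableSet
  rwa [memLp_indicator_iff_restrict hY, Measure.restrict_restrict hY,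
    show cellStar YH ∩ unitCell N = cellStar YH from inter_eq_left.2 sdiff_subset]

theorem IsTestFun.gradient_eq_zero {φ : Euc N → ℝ} (hφ : IsTestFun Ω φ) {x : Euc N} (hx : x ∉ Ω) :
    gradient φ x = 0 := by
  rw [gradient, image_eq_zero_of_notMem_tsupport
    (fun h' => hx (hφ.support_subset (tsupport_fderiv_subset ℝ h'))), map_zero]

theorem IsTestFun.deriv {U : Set ℝ} {c : ℝ → ℝ} (h : IsTestFun U c) : IsTestFun U (deriv c) :=
  ⟨(contDiff_infty_iff_deriv.1 h.smooth).2, h.compact.deriv,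
    (closure_minimal (support_deriv_subset) (isClosed_tsupport _)).trans h.support_subset⟩

section Identities

variable {φ : Euc N → ℝ} {c₁ c₂ : ℝ → ℝ}

namespace IsTwoScaleLimit

theorem memLp_regroup (h : IsTwoScaleLimit Ω YH T ε δ f Z) (hc : IsCompact YH) :
    MemLp (fun q => Z (regroup N q)) 2 ((slowMeasure Ω T).prod (fastMeasure YH)) :=
  (h.memLp_lim.mono_measure (domMeasure_prod_le hc)).comp_measurePreserving
    measurePreserving_regroup

/-- Integrals of the limit against functions supported in `Ω × (0, T)` only see `Y*`. -/
theorem integral_inner_lim (h : IsTwoScaleLimit Ω YH T ε δ f Z) (hΩ : IsOpen Ω)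
    (hc : IsCompact YH) (hsub : YH ⊆ unitCell N) {Q : (Euc N × ℝ × ℝ) × Euc N → Jet N}
    (hQ : ∀ m, ¬ (m.1.1 ∈ Ω ∧ m.1.2.1 ∈ Ioo 0 T) → Q m = 0) :
    ∫ m, inner ℝ (Z m) (Q m) ∂(unfoldMeasure N) =
      ∫ q, inner ℝ (Z (regroup N q)) (Q (regroup N q))
        ∂((slowMeasure Ω T).prod (fastMeasure YH)) := by
  have h1 := (measurePreserving_regroup (Ω := Ω) (T := T) (YH := YH)).integral_comp'
    (fun m => (inner ℝ (Z m) (Q m) : ℝ))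
  rw [h1, domMeasure_prod_eq hc, setIntegral_eq_integral_of_ae_compl_eq_zero]
  filter_upwards [ae_unfoldMeasure, h.lim_eq_zero_of_mem_hole hΩ hc hsub] with m hm h2 hm'
  by_cases h3 : m.1.1 ∈ Ω ∧ m.1.2.1 ∈ Ioo 0 T
  · rw [h2 h3.1, inner_zero_left]
    by_contra h4
    exact hm' ⟨⟨h3.1, h3.2, mem_univ _⟩, hm.2, h4⟩
  · rw [hQ m h3, inner_zero_right]

theorem integral_testJet_eq_zero (h : IsTwoScaleLimit Ω YH T ε δ f Z) (hΩ : IsOpen Ω)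
    (hc : IsCompact YH) (hsub : YH ⊆ unitCell N) (hφ : IsTestFun Ω φ)
    (hc₁ : IsTestFun (Ioo 0 T) c₁) (hc₂ : IsPeriodicTime c₂) {k : Euc N → Jet N}
    (hk : MemLp k 2 (volume.restrict (unitCell N)))
    (hlim : Tendsto (fun n => ∫ m, inner ℝ (f n (unfolding (ε n) (δ n) m))
      (testJet φ c₁ c₂ (unfolding (ε n) (δ n) m) m.1.2.2 (k m.2)) ∂(unfoldMeasure N)) atTop (𝓝 0)) :
    ∫ q, inner ℝ (Z (regroup N q)) (testJet φ c₁ c₂ q.1 q.2.1 (k q.2.2))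
      ∂((slowMeasure Ω T).prod (fastMeasure YH)) = 0 := by
  rw [← tendsto_nhds_unique (h.tendsto_testJet hφ hc₁ hc₂ hk) hlim,
    h.integral_inner_lim hΩ hc hsub (Q := fun m =>
      testJet φ c₁ c₂ (m.1.1, m.1.2.1) m.1.2.2 (k m.2))]
  · rfl
  · intro m hm
    rw [not_and_or] at hm
    rcases hm with hm | hm
    · simp only [testJet, hφ.eq_zero hm, hφ.gradient_eq_zero hm, zero_mul, inner_zero_left,
        zero_smul, add_zero]
      exact smul_zero _
    · simp [testJet, hc₁.eq_zero hm]

/-- The limit relation at order `1/ε`. -/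
theorem integral_lim_cellTests (h : IsTwoScaleLimit Ω YH T ε δ f Z) (hΩ : IsOpen Ω)
    (hc : IsCompact YH) (hsub : YH ⊆ unitCell N) (hφ : IsTestFun Ω φ)
    (hc₁ : IsTestFun (Ioo 0 T) c₁) (hc₂ : IsPeriodicTime c₂) {τ : Euc N → Jet N}
    (hτ : τ ∈ cellTests YH) :
    ∫ q, (φ q.1.1 * c₁ q.1.2) * (c₂ q.2.1 * (τ q.2.2).fst * (Z (regroup N q)).fst)
      ∂((slowMeasure Ω T).prod (fastMeasure YH)) = 0 := by
  have hY : MeasurableSet (cellStar YH) := (isOpen_cellStar hc).measurableSet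
  have hind : MemLp ((cellStar YH).indicator τ) 2 (volume.restrict (unitCell N)) :=
    memLp_indicator_cellStar hc (memLp_cellTests τ hτ)
  have hA : MemLp (fun y => jet ((cellStar YH).indicator τ y).fst (0 : Euc N)) 2
    (volume.restrict (unitCell N)) := memLp_jet (memLp_jet_fst hind) MemLp.zero'
  have hB : MemLp (fun y => jet 0 ((cellStar YH).indicator τ y).snd) 2
    (volume.restrict (unitCell N)) := memLp_jet MemLp.zero' (memLp_jet_snd hind)
  have hlim := h.tendsto_testJet hφ hc₁ hc₂ hB
  -- times `ε`, the part of the relation with the gradients tends to zero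
  have h0 : Tendsto (fun n => - (ε n * ∫ m, inner ℝ (f n (unfolding (ε n) (δ n) m))
      (testJet φ c₁ c₂ (unfolding (ε n) (δ n) m) m.1.2.2
        (jet 0 ((cellStar YH).indicator τ m.2).snd)) ∂(unfoldMeasure N))) atTop (𝓝 0) := by
    have := (h.ε_lim.mul hlim).neg
    rwa [zero_mul, neg_zero] at this
  have h1 := h.integral_testJet_eq_zero hΩ hc hsub hφ hc₁ hc₂ hA (h0.congr fun n => ?_)
  · rw [← h1]
    apply integral_congr_ae
    have hmem : ∀ᵐ q ∂((slowMeasure Ω T).prod (fastMeasure YH)), q.2.2 ∈ cellStar YH :=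
      (Measure.quasiMeasurePreserving_snd.comp Measure.quasiMeasurePreserving_snd).ae
        (ae_restrict_mem hY)
    filter_upwards [hmem] with q hq
    rw [testJet, inner_smul_right, inner_jet, indicator_of_mem hq]
    simp only [jet_fst, jet_snd, inner_zero_right, smul_zero, add_zero]
    ring
  · have h2 := h.integral_flux_cellTests hφ hc₁ hc₂ n hτ
    have iA := integrable_inner_of_memLp (h.memLp_unfolded n)
      (h.memLp_testJet hφ hc₁ hc₂ hA n)
    have iB := integrable_inner_of_memLp (h.memLp_unfolded n)
      (h.memLp_testJet hφ hc₁ hc₂ hB n)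
    have h3 : ∫ m, inner ℝ (fluxJet (ε n) φ c₁ c₂ (unfolding (ε n) (δ n) m)
        m.1.2.2 (f n (unfolding (ε n) (δ n) m))) (τ m.2) ∂(unfoldMeasure N) =
        (ε n)⁻¹ * (∫ m, inner ℝ (f n (unfolding (ε n) (δ n) m))
          (testJet φ c₁ c₂ (unfolding (ε n) (δ n) m) m.1.2.2
            (jet ((cellStar YH).indicator τ m.2).fst 0)) ∂(unfoldMeasure N)) +
        ∫ m, inner ℝ (f n (unfolding (ε n) (δ n) m))
          (testJet φ c₁ c₂ (unfolding (ε n) (δ n) m) m.1.2.2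
            (jet 0 ((cellStar YH).indicator τ m.2).snd)) ∂(unfoldMeasure N) := by
      rw [← integral_const_mul, ← integral_add (iA.const_mul _) iB]
      apply integral_congr_ae
      filter_upwards [ae_unfoldMeasure] with m hm
      have h4 : (cellStar YH).indicator τ m.2 = τ m.2 := by
        by_cases h5 : m.2 ∈ cellStar YH
        · exact indicator_of_mem h5 _
        · rw [indicator_of_notMem h5, cellTests_eq_zero hsub hτ hm.2 h5]
      rw [h4, inner_fluxJet, testJet, testJet, inner_smul_right, inner_smul_right,
        inner_smul_right, inner_jet, inner_jet, inner_jet]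
      simp only [jet_fst, jet_snd, inner_zero_right, smul_zero, add_zero, zero_add, mul_zero]
      ring
    rw [h2] at h3
    have hε := (h.ε_pos n).ne'
    field_simp at h3
    linarith

/-- The limit of the assumption on the oscillations in time. -/
theorem integral_lim_deriv (h : IsTwoScaleLimit Ω YH T ε δ f Z) (hΩ : IsOpen Ω)
    (hc : IsCompact YH) (hsub : YH ⊆ unitCell N) (hφ : IsTestFun Ω φ)
    (hc₁ : IsTestFun (Ioo 0 T) c₁) (hc₂ : IsPeriodicTime c₂) :
    ∫ q, (φ q.1.1 * c₁ q.1.2) * (deriv c₂ q.2.1 * (Z (regroup N q)).fst)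
      ∂((slowMeasure Ω T).prod (fastMeasure YH)) = 0 := by
  have : IsFiniteMeasure ((volume : Measure (Euc N)).restrict (unitCell N)) :=
    ⟨by simp [volume_unitCell]⟩
  have hk : MemLp (fun _ : Euc N => (jet 1 0 : Jet N)) 2 (volume.restrict (unitCell N)) :=
    memLp_const _
  have hlim := h.tendsto_testJet hφ hc₁.deriv hc₂ hk
  -- the derivative of `c₁` contributes a bounded term, multiplied by `δ`
  have h0 := (h.oscillation φ c₁ c₂ hφ hc₁ hc₂.smooth hc₂.periodic).sub (h.δ_lim.mul hlim)
  rw [zero_mul, sub_zero] at h0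
  have h1 := h.integral_testJet_eq_zero hΩ hc hsub hφ hc₁ hc₂.deriv hk (h0.congr fun n => ?_)
  · rw [← h1]
    congr 1; ext q
    rw [testJet, inner_smul_right, inner_jet]
    simp only [jet_fst, jet_snd, inner_zero_right, smul_zero, add_zero]
    ring
  · have iA := integrable_inner_of_memLp (h.memLp_unfolded n)
      (h.memLp_testJet hφ hc₁.deriv hc₂ hk n)
    have iB := integrable_inner_of_memLp (h.memLp_unfolded n)
      (h.memLp_testJet hφ hc₁ hc₂.deriv hk n)
    have hcs : ContDiff ℝ ∞ fun τ => c₁ τ * c₂ (τ / δ n) :=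
      hc₁.smooth.mul (hc₂.smooth.comp (contDiff_id.div_const _))
    have hcd : Continuous (_root_.deriv fun τ => c₁ τ * c₂ (τ / δ n)) :=
      hcs.continuous_deriv (by simp)
    have hφc := hφ.smooth.continuous
    rw [h.integral_unfold n, sub_eq_iff_eq_add, ← integral_const_mul,
      ← integral_add iB (iA.const_mul _)]
    · congr 1; ext m
      have hδ := (h.δ_pos n).ne'
      have hper := unfolding_snd_index (ε := ε n) hδ m.1 (y := m.2)
      set t := (unfolding (ε n) (δ n) m).2 with ht
      have e2 : c₂ (t / δ n) = c₂ m.1.2.2 := by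
        rw [hper]
        simpa using hc₂.periodic.int_mul ⌊(δ n)⁻¹ * m.1.2.1⌋ m.1.2.2
      have e3 : _root_.deriv c₂ (t / δ n) = _root_.deriv c₂ m.1.2.2 := by
        rw [hper]
        simpa using hc₂.deriv.periodic.int_mul ⌊(δ n)⁻¹ * m.1.2.1⌋ m.1.2.2
      have d1 : HasDerivAt c₁ (_root_.deriv c₁ t) t :=
        ((hc₁.smooth.differentiable (by simp)) t).hasDerivAt
      have d2 : HasDerivAt c₂ (_root_.deriv c₂ (t / δ n)) (t / δ n) :=
        ((hc₂.smooth.differentiable (by simp)) _).hasDerivAt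
      have d3 := d1.mul (d2.comp t ((hasDerivAt_id t).div_const (δ n)))
      have d4 : _root_.deriv (fun τ => c₁ τ * c₂ (τ / δ n)) t =
          _root_.deriv c₁ t * c₂ m.1.2.2 + c₁ t * (_root_.deriv c₂ m.1.2.2 * (1 / δ n)) := by
        rw [← e2, ← e3]; exact d3.deriv
      rw [d4, testJet, testJet, inner_smul_right, inner_smul_right, inner_jet, inner_jet]
      simp only [jet_fst, jet_snd, inner_zero_right, smul_zero, add_zero]
      rw [← ht]
      field_simp
      ring
    · exact (continuous_jet.comp (f := fun z : Euc N × ℝ =>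
        (φ z.1 * (δ n * _root_.deriv (fun τ => c₁ τ * c₂ (τ / δ n)) z.2), (0 : Euc N)))
        ((hφc.comp continuous_fst).mul
          (continuous_const.mul (hcd.comp continuous_snd)) |>.prodMk
            continuous_const)).aestronglyMeasurable

/-- The limit relation at order one: for solenoidal fields the term of order `1/ε` is absent. -/
theorem integral_lim_solenoidal (h : IsTwoScaleLimit Ω YH T ε δ f Z) (hΩ : IsOpen Ω)
    (hc : IsCompact YH) (hsub : YH ⊆ unitCell N) (hφ : IsTestFun Ω φ)
    (hc₁ : IsTestFun (Ioo 0 T) c₁) (hc₂ : IsPeriodicTime c₂) {θ : Euc N → Euc N}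
    (hθ : IsSolenoidal YH θ) :
    ∫ q, (c₁ q.1.2 * c₂ q.2.1) * ((Z (regroup N q)).fst * inner ℝ (gradient φ q.1.1) (θ q.2.2) +
      φ q.1.1 * inner ℝ (θ q.2.2) (Z (regroup N q)).snd)
      ∂((slowMeasure Ω T).prod (fastMeasure YH)) = 0 := by
  have hY : MeasurableSet (cellStar YH) := (isOpen_cellStar hc).measurableSet
  have hk : MemLp (fun y => jet 0 ((cellStar YH).indicator θ y)) 2
    (volume.restrict (unitCell N)) := memLp_jet MemLp.zero' (memLp_indicator_cellStar hc hθ.memLp)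
  have h1 := h.integral_testJet_eq_zero hΩ hc hsub hφ hc₁ hc₂ hk
    (tendsto_const_nhds.congr fun n => ?_)
  · rw [← h1]
    apply integral_congr_ae
    have hmem : ∀ᵐ q ∂((slowMeasure Ω T).prod (fastMeasure YH)), q.2.2 ∈ cellStar YH :=
      (Measure.quasiMeasurePreserving_snd.comp Measure.quasiMeasurePreserving_snd).ae
        (ae_restrict_mem hY)
    filter_upwards [hmem] with q hq
    rw [testJet, inner_smul_right, inner_jet, indicator_of_mem hq]
    simp only [jet_fst, jet_snd, mul_zero, zero_add, inner_smul_right]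
    rw [real_inner_comm (Z (regroup N q)).snd (θ q.2.2)]
  · refine (h.integral_flux_solenoidal hc hsub hφ hc₁ hc₂ n hθ).symm.trans ?_
    congr 1; ext m
    rw [inner_fluxJet, testJet]
    simp only [jet_fst, jet_snd, mul_zero]

end IsTwoScaleLimit

end Identities

end Relations

/-! ### The slow limit and its gradient -/

section SlowLimit

variable {N : ℕ} {Ω YH : Set (Euc N)} {T : ℝ} {ε δ : ℕ → ℝ}
  {f : ℕ → Euc N × ℝ → Jet N} {Z : (Euc N × ℝ × ℝ) × Euc N → Jet N}

/-- Equality almost everywhere on almost every slice is equality almost everywhere; the set where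
measurable representatives agree is measurable. -/
theorem ae_eq_of_ae_ae_eq {α β F : Type*} [MeasurableSpace α] [MeasurableSpace β]
    [NormedAddCommGroup F] {μ : Measure α} {ν : Measure β} [SFinite μ] [SFinite ν]
    {g h : α × β → F} (hg : AEStronglyMeasurable g (μ.prod ν))
    (hh : AEStronglyMeasurable h (μ.prod ν))
    (H : ∀ᵐ a ∂μ, ∀ᵐ b ∂ν, g (a, b) = h (a, b)) : g =ᵐ[μ.prod ν] h := by
  have h1 := hg.ae_eq_mk
  have h2 := hh.ae_eq_mk
  have hm : MeasurableSet {p | hg.mk g p = hh.mk h p} :=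
    hg.stronglyMeasurable_mk.measurableSet_eq_fun hh.stronglyMeasurable_mk
  have h3 : ∀ᵐ p ∂(μ.prod ν), hg.mk g p = hh.mk h p := by
    rw [Measure.ae_prod_iff_ae_ae hm]
    filter_upwards [H, Measure.ae_ae_of_ae_prod h1, Measure.ae_ae_of_ae_prod h2] with a e1 e2 e3
    filter_upwards [e1, e2, e3] with b e4 e5 e6
    rw [← e5, ← e6, e4]
  filter_upwards [h1, h2, h3] with p e1 e2 e3
  rw [e1, e2, e3]

/-- Since there are at least two directions, there is a nontrivial field on the perforated cell
that is parallel to the `i`-th axis, depends on another coordinate only, and avoids the hole. -/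
theorem exists_isPerTest_fderiv_eq_zero (hN : 2 ≤ N) (hc : IsCompact YH)
    (hsub : YH ⊆ unitCell N) (i : Fin N) :
    ∃ η : Euc N → ℝ, IsPerTest YH η ∧
      (∀ y, fderiv ℝ η y (EuclideanSpace.single i 1) = 0) ∧ ∫ y in cellStar YH, η y ≠ 0 := by
  obtain ⟨j, hj⟩ : ∃ j : Fin N, j ≠ i := by
    have : Nontrivial (Fin N) := Fin.nontrivial_iff_two_le.2 hN
    exact exists_ne i
  set S : Set ℝ := (fun y : Euc N => y j) '' YH with hS
  have hSc : IsCompact S := hc.image (by fun_prop)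
  have hS1 : S ⊆ Ioo 0 1 := by
    rintro _ ⟨y, hy, rfl⟩; exact hsub hy j
  obtain ⟨d, hd, hd1⟩ := hSc.exists_cthickening_subset_open isOpen_Ioo hS1
  let χ : ContDiffBump (0 : ℝ) := ⟨d / 2, d, by positivity, by linarith⟩
  have hχs : HasCompactSupport χ := χ.hasCompactSupport
  set ψ : ℝ → ℝ := periodize (Int.castAddHom ℝ) χ with hψ
  have hψs : ContDiff ℝ ∞ ψ := isTiling_intCast.contDiff_periodize hχs χ.contDiff
  have hψt : tsupport ψ ⊆ {a | ∀ k : ℤ, a - k ∉ S} := by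
    refine isTiling_intCast.tsupport_periodize_subset hχs (fun a k h m hm => ?_) fun a ha k hk => ?_
    · refine h (m + k) ?_
      simpa using hm
    · rw [χ.tsupport_eq, Metric.mem_closedBall, dist_zero_right] at ha
      have h1 : (-k : ℝ) ∈ Metric.cthickening d S := by
        refine Metric.mem_cthickening_of_dist_le _ _ _ _ hk ?_
        rw [dist_eq_norm, show (-k : ℝ) - (a - k) = -a by ring, norm_neg]
        exact ha
      have h2 := hd1 h1
      have h3 : (0 : ℤ) < -k := by exact_mod_cast h2.1
      have h4 : -k < (1 : ℤ) := by exact_mod_cast h2.2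
      omega
  have hψ0 : ∀ a, 0 ≤ ψ a := fun a => finsum_nonneg fun k => χ.nonneg
  have hψp : ∀ a, |a| < d → 0 < ψ a := by
    intro a ha
    obtain ⟨K, h0, hK⟩ := isTiling_intCast.exists_finset_periodize hχs
      (Metric.isBounded_ball (x := a) (r := 1))
    rw [hψ, hK a (Metric.mem_ball_self one_pos)]
    refine Finset.sum_pos' (fun k _ => χ.nonneg) ⟨0, ?_, ?_⟩
    · by_contra hcon
      have h1 := h0 a (Metric.mem_ball_self one_pos) 0 hcon
      have h2 : 0 < χ a := χ.pos_of_mem_ball (by simpa using ha)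
      simp only [map_zero, add_zero] at h1
      exact h2.ne' h1
    · have h2 : 0 < χ a := χ.pos_of_mem_ball (by simpa using ha)
      simpa using h2
  have hηper : IsPerTest YH fun y => ψ (y j) := by
    refine ⟨hψs.comp (contDiff_euclidean.1 contDiff_id j), fun y k => ?_, ?_⟩
    · have := IsTiling.periodize_add (l := Int.castAddHom ℝ) χ (y j) (k j)
      simpa [latticeVec_coord] using this
    · intro y hy k hk
      have h1 : y j ∈ tsupport ψ := by
        have hcl : IsClosed ((fun y : Euc N => y j) ⁻¹' tsupport ψ) :=
          (isClosed_tsupport ψ).preimage (by fun_prop)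
        have hsupp : Function.support (fun y : Euc N => ψ (y j)) ⊆
          (fun y : Euc N => y j) ⁻¹' tsupport ψ := fun z hz => subset_tsupport ψ hz
        exact closure_minimal hsupp hcl hy
      exact hψt h1 (k j) ⟨_, hk, rfl⟩
  refine ⟨fun y => ψ (y j), hηper, fun y => ?_, ?_⟩
  · have h1 : HasFDerivAt (fun y : Euc N => y j) (EuclideanSpace.proj j : Euc N →L[ℝ] ℝ) y :=
      (EuclideanSpace.proj j : Euc N →L[ℝ] ℝ).hasFDerivAt
    have h2 := ((hψs.differentiable (by simp)) (y j)).hasFDerivAt.comp y h1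
    have h3 : fderiv ℝ (fun y : Euc N => ψ (y j)) y = _ := h2.fderiv
    rw [h3]
    simp [hj]
  · have hint : IntegrableOn (fun y : Euc N => ψ (y j)) (cellStar YH) :=
      (memLp_of_periodic hηper.smooth.continuous hηper.periodic).integrable (by norm_num)
    refine ne_of_gt ?_
    rw [setIntegral_pos_iff_support_of_nonneg_ae (Eventually.of_forall fun y => hψ0 _) hint]
    have hop : IsOpen (Function.support (fun y : Euc N => ψ (y j)) ∩ cellStar YH) :=
      hηper.smooth.continuous.isOpen_support.inter (isOpen_cellStar hc)
    refine hop.measure_pos volume ⟨WithLp.toLp 2 fun _ => min (d / 2) (1 / 2), ?_, ?_⟩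
    · refine (hψp _ ?_).ne'
      have : 0 < min (d / 2) (1 / 2) := by positivity
      rw [abs_of_pos this]
      exact (min_le_left _ _).trans_lt (by linarith)
    · rw [cellStar_eq hsub]
      refine ⟨fun _ => ⟨by positivity, (min_le_right _ _).trans_lt (by norm_num)⟩,
        hηper.support_subset (subset_tsupport _ (hψp _ ?_).ne')⟩
      have : 0 < min (d / 2) (1 / 2) := by positivity
      rw [abs_of_pos this]
      exact (min_le_left _ _).trans_lt (by linarith)

theorem IsPerTest.isSolenoidal {η : Euc N → ℝ} (h : IsPerTest YH η) {e : Euc N}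
    (he : ∀ y, fderiv ℝ η y e = 0) : IsSolenoidal YH fun y => η y • e := by
  have hτ : (fun y => jet (fderiv ℝ η y e) (η y • e)) ∈ cellTests YH := ⟨η, e, h, rfl⟩
  refine ⟨memLp_jet_snd (memLp_cellTests _ hτ), fun k hk hk' => ?_⟩
  rw [← hk' _ hτ]
  simp_rw [inner_jet, jet_fst, jet_snd, he, zero_mul, zero_add]

/-- Products of test functions of `x` and of `t`. -/
def slowTests (Ω : Set (Euc N)) (T : ℝ) : Set (Euc N × ℝ → ℝ) :=
  image2 (fun φ c p => φ p.1 • c p.2) {φ | IsTestFun Ω φ} {c | IsTestFun (Ioo 0 T) c}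

theorem memLp_slowTests : ∀ ψ ∈ slowTests Ω T, MemLp ψ 2 (slowMeasure Ω T) := by
  rintro _ ⟨φ, hφ, c, hc, rfl⟩
  exact memLp_tensor (IsTestFun.memLp hφ 2 Ω) (IsTestFun.memLp hc 2 (Ioo 0 T))

theorem memLp_mul_gradient {φ : Euc N → ℝ} {c₁ : ℝ → ℝ} (hφ : IsTestFun Ω φ)
    (hc₁ : IsTestFun (Ioo 0 T) c₁) {u : Euc N × ℝ → ℝ} (hu : MemLp u 2 (slowMeasure Ω T)) :
    MemLp (fun p : Euc N × ℝ => (c₁ p.2 * u p) • gradient φ p.1) 2 (slowMeasure Ω T) := by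
  obtain ⟨C₁, hC₁⟩ := hc₁.compact.exists_bound_of_continuous hc₁.smooth.continuous
  obtain ⟨C₂, hC₂⟩ := hφ.hasCompactSupport_gradient.exists_bound_of_continuous hφ.continuous_gradient
  refine (hu.norm.const_mul (C₁ * C₂)).mono ?_ (Eventually.of_forall fun p => ?_)
  · exact ((hc₁.smooth.continuous.comp continuous_snd).aestronglyMeasurable.mul hu.1).smul
      (hφ.continuous_gradient.comp continuous_fst).aestronglyMeasurable
  · have e1 := hC₁ p.2
    have e2 := hC₂ p.1
    have p1 : 0 ≤ C₁ := (norm_nonneg _).trans e1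
    rw [norm_smul, norm_mul]
    refine le_trans ?_ (le_abs_self _)
    calc ‖c₁ p.2‖ * ‖u p‖ * ‖gradient φ p.1‖ ≤ C₁ * ‖u p‖ * C₂ := by gcongr
      _ = _ := by ring

variable [IsFiniteMeasure ((volume : Measure (Euc N)).restrict Ω)]

theorem determining_slowTests (hΩ : IsOpen Ω) :
    Determining (slowMeasure Ω T) (slowTests Ω T) :=
  (determining_testSpace hΩ).prod (determining_testSpace isOpen_Ioo)
    (fun _ h => IsTestFun.memLp h 2 Ω) fun _ h => IsTestFun.memLp h 2 _

namespace IsTwoScaleLimit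

/-- The limit of the functions does not depend on the fast variables. -/
theorem exists_slow_limit (h : IsTwoScaleLimit Ω YH T ε δ f Z) (hΩ : IsOpen Ω)
    (hc : IsCompact YH) (hsub : YH ⊆ unitCell N) (hs : HasSmoothBoundary YH)
    (hconn : IsConnected (cellStar YH)) : ∃ u : Euc N × ℝ → ℝ, MemLp u 2 (slowMeasure Ω T) ∧
      ∀ᵐ q ∂((slowMeasure Ω T).prod (fastMeasure YH)), (Z (regroup N q)).fst = u q.1 := by
  have hζ := memLp_jet_fst (h.memLp_regroup (T := T) hc)
  have : MeasureTheory.IsSeparable (fastMeasure YH) := inferInstance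
  set k : (Euc N × ℝ) × (ℝ × Euc N) → ℝ := fun q => (Z (regroup N q)).fst with hk
  have hslice := ae_forall_integral_inner_slice_eq_zero (determining_slowTests (T := T) hΩ)
    memLp_slowTests
    (𝒯 := image2 (fun c (τ : Euc N → Jet N) (w : ℝ × Euc N) => c w.1 • (τ w.2).fst)
        {c | IsPeriodicTime c} (cellTests YH) ∪
      {σ | ∃ c, IsPeriodicTime c ∧ σ = fun w => deriv c w.1 • 1}) (ν := fastMeasure YH)
    (by
      rintro _ (⟨c, hc', τ, hτ, rfl⟩ | ⟨c, hc', rfl⟩)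
      · exact memLp_tensor (IsPeriodicTime.memLp hc') (memLp_jet_fst (memLp_cellTests τ hτ))
      · exact memLp_tensor hc'.deriv.memLp (memLp_const 1)) hζ (by
      rintro _ ⟨φ, hφ, c₁, hc₁, rfl⟩ _ (⟨c₂, hc₂, τ, hτ, rfl⟩ | ⟨c₂, hc₂, rfl⟩)
      · refine Eq.trans ?_ (h.integral_lim_cellTests hΩ hc hsub hφ hc₁ hc₂ hτ)
        congr 1; ext q
        simp only [smul_eq_mul, RCLike.inner_apply, conj_trivial]
        ring
      · refine Eq.trans ?_ (h.integral_lim_deriv hΩ hc hsub hφ hc₁ hc₂)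
        congr 1; ext q
        simp only [smul_eq_mul, RCLike.inner_apply, conj_trivial]
        ring)
  -- the slow limit is the mean over the fast variables
  set u : Euc N × ℝ → ℝ := fun p =>
    (volume.real (cellStar YH))⁻¹ * ∫ w, k (p, w) ∂(fastMeasure YH) with hu
  have hum : MemLp u 2 (slowMeasure Ω T) := by
    have := memLp_integral_inner_right (μ := slowMeasure Ω T) (ν := fastMeasure YH)
      (τ := fun _ => (1 : ℝ)) (memLp_const 1) hζ
    simpa [hu] using this.const_mul (volume.real (cellStar YH))⁻¹
  refine ⟨u, hum, ?_⟩
  have hu2 : AEStronglyMeasurable (fun q : (Euc N × ℝ) × (ℝ × Euc N) => u q.1)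
      ((slowMeasure Ω T).prod (fastMeasure YH)) := hum.1.comp_fst
  refine ae_eq_of_ae_ae_eq hζ.1 hu2 ?_
  filter_upwards [hslice, hζ.1.prodMk_left] with p hp hpm
  refine ae_eq_of_ae_ae_eq hpm aestronglyMeasurable_const ?_
  refine ae_eq_const_of_forall_tests hc hsub hs hconn hp.1 (fun c hc' τ hτ => ?_) fun c hc' => ?_
  · refine Eq.trans ?_ (hp.2 _ (Or.inl ⟨c, hc', τ, hτ, rfl⟩))
    congr 1; ext w
    simp only [smul_eq_mul, RCLike.inner_apply, conj_trivial]
    ring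
  · refine Eq.trans ?_ (hp.2 _ (Or.inr ⟨c, hc', rfl⟩))
    congr 1; ext w
    simp only [smul_eq_mul, RCLike.inner_apply, conj_trivial]
    ring

/-- The limit relation at order one, with the fast variables integrated out where possible. -/
theorem integral_lim_snd (h : IsTwoScaleLimit Ω YH T ε δ f Z) (hΩ : IsOpen Ω)
    (hc : IsCompact YH) (hsub : YH ⊆ unitCell N) {u : Euc N × ℝ → ℝ}
    (hu : MemLp u 2 (slowMeasure Ω T))
    (hZu : ∀ᵐ q ∂((slowMeasure Ω T).prod (fastMeasure YH)), (Z (regroup N q)).fst = u q.1)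
    {φ : Euc N → ℝ} {c₁ c₂ : ℝ → ℝ} (hφ : IsTestFun Ω φ)
    (hc₁ : IsTestFun (Ioo 0 T) c₁) (hc₂ : IsPeriodicTime c₂) {θ : Euc N → Euc N}
    (hθ : IsSolenoidal YH θ) :
    ∫ q, inner ℝ ((φ q.1.1 • c₁ q.1.2) • (c₂ q.2.1 • θ q.2.2)) (Z (regroup N q)).snd
      ∂((slowMeasure Ω T).prod (fastMeasure YH)) =
    - ∫ p, c₁ p.2 * u p * inner ℝ (gradient φ p.1) (∫ w, c₂ w.1 • θ w.2 ∂(fastMeasure YH))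
      ∂(slowMeasure Ω T) := by
  have h1 := h.integral_lim_solenoidal hΩ hc hsub hφ hc₁ hc₂ hθ
  have hζ := memLp_jet_snd (h.memLp_regroup (T := T) hc)
  have hσ : MemLp (fun w : ℝ × Euc N => c₂ w.1 • θ w.2) 2 (fastMeasure YH) :=
    memLp_tensor hc₂.memLp hθ.memLp
  have hV := memLp_mul_gradient hφ hc₁ hu
  have hψ : MemLp (fun p : Euc N × ℝ => φ p.1 • c₁ p.2) 2 (slowMeasure Ω T) :=
    memLp_slowTests _ ⟨φ, hφ, c₁, hc₁, rfl⟩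
  have i1 : Integrable (fun q : (Euc N × ℝ) × (ℝ × Euc N) =>
      (inner ℝ ((φ q.1.1 • c₁ q.1.2) • (c₂ q.2.1 • θ q.2.2)) (Z (regroup N q)).snd : ℝ))
      ((slowMeasure Ω T).prod (fastMeasure YH)) :=
    integrable_inner_of_memLp (memLp_tensor hψ hσ) hζ
  have hV1 : MemLp (fun q : (Euc N × ℝ) × (ℝ × Euc N) => (c₁ q.1.2 * u q.1) • gradient φ q.1.1) 2
      ((slowMeasure Ω T).prod (fastMeasure YH)) := hV.comp_fst _
  have hσ1 : MemLp (fun q : (Euc N × ℝ) × (ℝ × Euc N) => c₂ q.2.1 • θ q.2.2) 2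
      ((slowMeasure Ω T).prod (fastMeasure YH)) := hσ.comp_snd _
  have i2 : Integrable (fun q : (Euc N × ℝ) × (ℝ × Euc N) =>
      (inner ℝ ((c₁ q.1.2 * u q.1) • gradient φ q.1.1) (c₂ q.2.1 • θ q.2.2) : ℝ))
      ((slowMeasure Ω T).prod (fastMeasure YH)) := integrable_inner_of_memLp hV1 hσ1
  have h2 : ∫ q, (inner ℝ ((c₁ q.1.2 * u q.1) • gradient φ q.1.1) (c₂ q.2.1 • θ q.2.2) : ℝ)
      ∂((slowMeasure Ω T).prod (fastMeasure YH)) =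
      ∫ p, c₁ p.2 * u p * inner ℝ (gradient φ p.1) (∫ w, c₂ w.1 • θ w.2 ∂(fastMeasure YH))
      ∂(slowMeasure Ω T) := by
    rw [integral_prod _ i2]
    congr 1; ext p
    simp only [inner_smul_left (𝕜 := ℝ) (gradient φ p.1), conj_trivial]
    rw [integral_const_mul, integral_inner (hσ.integrable (by norm_num))]
  have h3 : ∫ q, (inner ℝ ((φ q.1.1 • c₁ q.1.2) • (c₂ q.2.1 • θ q.2.2)) (Z (regroup N q)).snd : ℝ) +
      inner ℝ ((c₁ q.1.2 * u q.1) • gradient φ q.1.1) (c₂ q.2.1 • θ q.2.2)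
      ∂((slowMeasure Ω T).prod (fastMeasure YH)) = 0 := by
    refine Eq.trans (integral_congr_ae ?_) h1
    filter_upwards [hZu] with q hq
    rw [hq]
    simp only [inner_smul_left, inner_smul_right, conj_trivial, smul_eq_mul]
    ring
  rw [integral_add i1 i2, h2] at h3
  linarith

/-- The gradient of the slow limit, in the sense of distributions in `(x, t)`. -/
theorem exists_slow_gradient (h : IsTwoScaleLimit Ω YH T ε δ f Z) (hN : 2 ≤ N) (hΩ : IsOpen Ω)
    (hc : IsCompact YH) (hsub : YH ⊆ unitCell N) {u : Euc N × ℝ → ℝ}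
    (hu : MemLp u 2 (slowMeasure Ω T))
    (hZu : ∀ᵐ q ∂((slowMeasure Ω T).prod (fastMeasure YH)), (Z (regroup N q)).fst = u q.1) :
    ∃ G : Euc N × ℝ → Euc N, MemLp G 2 (slowMeasure Ω T) ∧
      ∀ (φ : Euc N → ℝ) (c : ℝ → ℝ) (e : Euc N), IsTestFun Ω φ → IsTestFun (Ioo 0 T) c →
        ∫ p, c p.2 * u p * inner ℝ (gradient φ p.1) e ∂(slowMeasure Ω T) +
          ∫ p, (φ p.1 • c p.2) * inner ℝ e (G p) ∂(slowMeasure Ω T) = 0 := by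
  have hζ := memLp_jet_snd (h.memLp_regroup (T := T) hc)
  choose η hη hη0 hηm using exists_isPerTest_fderiv_eq_zero (YH := YH) hN hc hsub
  let m : Fin N → ℝ := fun i => ∫ y in cellStar YH, η i y
  let b : Fin N → Euc N := fun i => EuclideanSpace.single i 1
  have hθ : ∀ i, IsSolenoidal YH fun y => η i y • b i := fun i => (hη i).isSolenoidal (hη0 i)
  have hσ : ∀ i, MemLp (fun w : ℝ × Euc N => η i w.2 • b i) 2 (fastMeasure YH) := fun i =>
    (hθ i).memLp.comp_snd _
  -- the components of the gradient are means of `W` against the fields `η i • b i`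
  let g : Fin N → Euc N × ℝ → ℝ := fun i p =>
    (m i)⁻¹ * ∫ w, inner ℝ (η i w.2 • b i) (Z (regroup N (p, w))).snd ∂(fastMeasure YH)
  have hg : ∀ i, MemLp (g i) 2 (slowMeasure Ω T) := fun i =>
    (memLp_integral_inner_right (hσ i) hζ).const_mul _
  refine ⟨fun p => ∑ i, g i p • b i, memLp_finsetSum _ fun i _ =>
    (ContinuousLinearMap.toSpanSingleton ℝ (b i)).comp_memLp' (hg i), ?_⟩
  intro φ c e hφ hc₁
  have hψ : MemLp (fun p : Euc N × ℝ => φ p.1 • c p.2) 2 (slowMeasure Ω T) :=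
    memLp_slowTests _ ⟨φ, hφ, c, hc₁, rfl⟩
  have iA : ∀ i, Integrable (fun p => c p.2 * u p * inner ℝ (gradient φ p.1) (b i))
      (slowMeasure Ω T) := fun i => by
    have h1 := ((memLp_mul_gradient hφ hc₁ hu).integrable (by norm_num)).inner_const (𝕜 := ℝ) (b i)
    simpa only [inner_smul_left, conj_trivial] using h1
  have iB : ∀ i, Integrable (fun p => (φ p.1 • c p.2) * g i p) (slowMeasure Ω T) := fun i =>
    integrable_smul_of_memLp hψ (hg i)
  have hrel : ∀ i, ∫ p, c p.2 * u p * inner ℝ (gradient φ p.1) (b i) ∂(slowMeasure Ω T) +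
      ∫ p, (φ p.1 • c p.2) * g i p ∂(slowMeasure Ω T) = 0 := by
    intro i
    have h1 := h.integral_lim_snd hΩ hc hsub hu hZu hφ hc₁ (isPeriodicTime_const 1) (hθ i)
    simp only [one_smul] at h1
    rw [integral_inner_tensor_right hψ (hσ i) hζ] at h1
    have h2 : ∫ w : ℝ × Euc N, η i w.2 • b i ∂(fastMeasure YH) = m i • b i := by
      rw [integral_fun_snd (fun y => η i y • b i), integral_smul_const]
      simp [m]
    have h3 : ∀ p, ∫ w, inner ℝ (η i w.2 • b i) (Z (regroup N (p, w))).snd ∂(fastMeasure YH) =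
        m i * g i p := fun p => (mul_inv_cancel_left₀ (hηm i) _).symm
    simp_rw [h2, h3, inner_smul_right, mul_left_comm _ (m i)] at h1
    rw [integral_const_mul, integral_const_mul] at h1
    have h4 := hηm i
    have h5 : m i * (∫ p, c p.2 * u p * inner ℝ (gradient φ p.1) (b i) ∂(slowMeasure Ω T) +
      ∫ p, (φ p.1 • c p.2) * g i p ∂(slowMeasure Ω T)) = 0 := by
      rw [mul_add, h1]; ring
    exact (mul_eq_zero.1 h5).resolve_left h4
  have e1 : ∀ x : Euc N, (inner ℝ x e : ℝ) = ∑ i, e i * inner ℝ x (b i) := fun x => by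
    simp [b, PiLp.inner_apply]
  have e2 : ∀ p, (inner ℝ e (∑ i, g i p • b i) : ℝ) = ∑ i, e i * g i p := fun p => by
    simp [b, inner_sum, inner_smul_right, EuclideanSpace.inner_single_right, mul_comm]
  simp_rw [e1, e2, Finset.mul_sum, mul_left_comm _ (e _)]
  rw [integral_finsetSum _ fun i _ => (iA i).const_mul _,
    integral_finsetSum _ fun i _ => (iB i).const_mul _, ← Finset.sum_add_distrib]
  refine Finset.sum_eq_zero fun i _ => ?_
  rw [integral_const_mul, integral_const_mul, ← mul_add, hrel, mul_zero]

end IsTwoScaleLimit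

end SlowLimit

/-! ### Admissible oscillating test functions -/

section Admissible

variable {N : ℕ} {Ω YH : Set (Euc N)} {T : ℝ} {ε δ : ℕ → ℝ}
  {f : ℕ → Euc N × ℝ → Jet N} {Z : (Euc N × ℝ × ℝ) × Euc N → Jet N}

instance : IsProbabilityMeasure ((volume : Measure (Euc N)).restrict (unitCell N)) :=
  ⟨by simp [volume_unitCell]⟩

instance : IsProbabilityMeasure unitIoo := ⟨by simp⟩

theorem measurePreserving_slow : MeasurePreserving
    (fun m : (Euc N × ℝ × ℝ) × Euc N => (m.1.1, m.1.2.1)) (unfoldMeasure N) volume := by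
  have h1 := measurePreserving_fst (μ := paramMeasure N)
    (ν := (volume : Measure (Euc N)).restrict (unitCell N))
  have h2 := (MeasurePreserving.id (volume : Measure (Euc N))).prod
    (measurePreserving_fst (μ := (volume : Measure ℝ)) (ν := unitIoo))
  exact h2.comp h1

/-- Evaluation of the values of `V`, continuous functions of `(y, s)`, after a transformation of the
slow variables. -/
theorem memLp_eval {V : Euc N × ℝ → (Euc N × ℝ) →ᵇ Euc N} (hV : MemLp V 2 volume)
    {Φ : (Euc N × ℝ × ℝ) × Euc N → Euc N × ℝ}
    (hΦ : MeasurePreserving Φ (unfoldMeasure N) volume) :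
    MemLp (fun m => V (Φ m) (m.2, m.1.2.2)) 2 (unfoldMeasure N) ∧
      eLpNorm (fun m => V (Φ m) (m.2, m.1.2.2)) 2 (unfoldMeasure N) ≤ eLpNorm V 2 volume := by
  have h1 : AEStronglyMeasurable (fun m : (Euc N × ℝ × ℝ) × Euc N => (m.2, m.1.2.2))
      (unfoldMeasure N) :=
    (by fun_prop : Measurable fun m : (Euc N × ℝ × ℝ) × Euc N =>
      (m.2, m.1.2.2)).aestronglyMeasurable
  have h2 : MemLp (fun m => V (Φ m)) 2 (unfoldMeasure N) := hV.comp_measurePreserving hΦ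
  have h3 : AEStronglyMeasurable (fun m => V (Φ m) (m.2, m.1.2.2)) (unfoldMeasure N) :=
    (continuous_eval (F := (Euc N × ℝ) →ᵇ Euc N)).comp_aestronglyMeasurable (h2.1.prodMk h1)
  have h4 : ∀ m : (Euc N × ℝ × ℝ) × Euc N, ‖V (Φ m) (m.2, m.1.2.2)‖ ≤ ‖V (Φ m)‖ := fun m =>
    BoundedContinuousFunction.norm_coe_le_norm _ _
  refine ⟨h2.mono h3 (Eventually.of_forall h4), ?_⟩
  exact (eLpNorm_mono h4).trans_eq (eLpNorm_comp_measurePreserving hV.1 hΦ)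

/-- Square integrable functions of `(x, t)` with values in the continuous functions of `(y, s)`
are strongly approximated by their unfoldings. -/
theorem tendsto_eLpNorm_eval (hε : ∀ n, 0 < ε n) (hδ : ∀ n, 0 < δ n)
    (hε0 : Tendsto ε atTop (𝓝 0)) (hδ0 : Tendsto δ atTop (𝓝 0))
    {V : Euc N × ℝ → (Euc N × ℝ) →ᵇ Euc N} (hV : MemLp V 2 volume) :
    Tendsto (fun n => eLpNorm (fun m => V (unfolding (ε n) (δ n) m) (m.2, m.1.2.2) -
      V (m.1.1, m.1.2.1) (m.2, m.1.2.2)) 2 (unfoldMeasure N)) atTop (𝓝 0) := by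
  rw [ENNReal.tendsto_nhds_zero]
  intro a ha
  have ha3 : a / 3 ≠ 0 := (ENNReal.div_pos ha.ne' (by norm_num)).ne'
  -- `W` is continuous with compact support, and `memLp_eval` bounds the error uniformly in `n`
  obtain ⟨W, hWs, hWV, hWc, hW⟩ := hV.exists_hasCompactSupport_eLpNorm_sub_le (by norm_num) ha3
  obtain ⟨C, hC⟩ := hWs.exists_bound_of_continuous hWc
  obtain ⟨R, hR⟩ := hWs.isCompact.isBounded.exists_norm_le
  have hmp := fun n => measurePreserving_unfolding (N := N) (hε n) (hδ n)
  have hWn := fun n => memLp_eval hW (hmp n)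
  have hD := hV.sub hW
  have hlim := (tendsto_eLpNorm_unfolding hε hδ hε0 hδ0 (q := fun z w => W z (w.2, w.1))
    (b := fun _ => C) (R := R)
    (fun w => (continuous_eval_const (F := (Euc N × ℝ) →ᵇ Euc N) (x := (w.2, w.1))).comp hWc)
    (fun n => (hWn n).1.1) (memLp_const C)
    (fun z s _ y _ => (BoundedContinuousFunction.norm_coe_le_norm _ _).trans (hC z))
    (fun z w hz => by
      rw [image_eq_zero_of_notMem_tsupport fun h' => (hR z h').not_gt hz]; rfl)).2.2
  rw [ENNReal.tendsto_nhds_zero] at hlim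
  filter_upwards [hlim (a / 3) (pos_iff_ne_zero.2 ha3)] with n hn
  have hDn := memLp_eval hD (hmp n)
  have hD0 := memLp_eval hD measurePreserving_slow
  have hW0 := memLp_eval hW measurePreserving_slow
  have e1 : (fun m : (Euc N × ℝ × ℝ) × Euc N => V (unfolding (ε n) (δ n) m) (m.2, m.1.2.2) -
      V (m.1.1, m.1.2.1) (m.2, m.1.2.2)) =
      ((fun m => (V - W) (unfolding (ε n) (δ n) m) (m.2, m.1.2.2)) +
        fun m => W (unfolding (ε n) (δ n) m) (m.2, m.1.2.2) - W (m.1.1, m.1.2.1) (m.2, m.1.2.2)) -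
      fun m => (V - W) (m.1.1, m.1.2.1) (m.2, m.1.2.2) := by
    ext1 m
    simp only [Pi.add_apply, Pi.sub_apply, BoundedContinuousFunction.coe_sub]
    abel
  rw [e1]
  have m1 : AEStronglyMeasurable (fun m : (Euc N × ℝ × ℝ) × Euc N =>
      W (unfolding (ε n) (δ n) m) (m.2, m.1.2.2) - W (m.1.1, m.1.2.1) (m.2, m.1.2.2))
      (unfoldMeasure N) := (hWn n).1.1.sub hW0.1.1
  calc _ ≤ _ := eLpNorm_sub_le (hDn.1.1.add m1) hD0.1.1 (by norm_num)
    _ ≤ (a / 3 + a / 3) + a / 3 := by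
      refine add_le_add ((eLpNorm_add_le hDn.1.1 m1 (by norm_num)).trans
        (add_le_add (hDn.2.trans hWV) hn)) (hD0.2.trans hWV)
    _ = a := ENNReal.add_thirds a

namespace IsTwoScaleLimit

/-- The two-scale convergence of the gradients. -/
theorem tendsto_admissible (h : IsTwoScaleLimit Ω YH T ε δ f Z) (hΩ : IsOpen Ω)
    (hc : IsCompact YH) (hsub : YH ⊆ unitCell N)
    {V : Euc N × ℝ → (Euc N × ℝ) →ᵇ Euc N} (hV : MemLp V 2 volume)
    (hV0 : ∀ z, z ∉ Ω ×ˢ Ioo 0 T → V z = 0)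
    (hper : ∀ᵐ z, ∀ (k : Fin N → ℤ) (m : ℤ) (y : Euc N) (s : ℝ),
      V z (y + latticeVec k, s + m) = V z (y, s)) :
    Tendsto (fun n => ∫ z, inner ℝ (f n z) (jet 0 (V z ((ε n)⁻¹ • z.1, z.2 / δ n)))) atTop
      (𝓝 (∫ q, inner ℝ (Z (regroup N q)).snd (V q.1 (q.2.2, q.2.1))
        ∂((slowMeasure Ω T).prod (fastMeasure YH)))) := by
  have h0 := memLp_eval hV (measurePreserving_slow (N := N))
  have hn := fun n => memLp_eval hV (h.measurePreserving n)
  have h1 := h.tendsto_of_strong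
    (q := fun n m => jet 0 (V (unfolding (ε n) (δ n) m) (m.2, m.1.2.2)))
    (q₀ := fun m => jet 0 (V (m.1.1, m.1.2.1) (m.2, m.1.2.2)))
    (fun n => memLp_jet MemLp.zero' (hn n).1) (memLp_jet MemLp.zero' h0.1) (by
      refine (tendsto_eLpNorm_eval h.ε_pos h.δ_pos h.ε_lim h.δ_lim hV).congr fun n => ?_
      refine eLpNorm_congr_norm_ae (Eventually.of_forall fun m => ?_)
      rw [← sq_eq_sq₀ (norm_nonneg _) (norm_nonneg _), norm_jet_sq]
      change _ = ‖(0 : ℝ) - 0‖ ^ 2 + ‖V (unfolding (ε n) (δ n) m) (m.2, m.1.2.2) -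
        V (m.1.1, m.1.2.1) (m.2, m.1.2.2)‖ ^ 2
      simp)
  rw [h.integral_inner_lim hΩ hc hsub] at h1
  · refine (h1.congr fun n => ?_).trans_eq ?_
    · have hQ : AEStronglyMeasurable (fun z : Euc N × ℝ => V z ((ε n)⁻¹ • z.1, z.2 / δ n)) volume :=
        (continuous_eval (F := (Euc N × ℝ) →ᵇ Euc N)).comp_aestronglyMeasurable
          (hV.1.prodMk (by fun_prop : Continuous fun z : Euc N × ℝ =>
            ((ε n)⁻¹ • z.1, z.2 / δ n)).aestronglyMeasurable)
      rw [h.integral_unfold n (aestronglyMeasurable_jet aestronglyMeasurable_const hQ)]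
      apply integral_congr_ae
      filter_upwards [(h.measurePreserving n).quasiMeasurePreserving.ae hper] with m hm
      rw [unfolding_fst_index (δ := δ n) (h.ε_pos n).ne' m.1 (y := m.2),
        unfolding_snd_index (ε := ε n) (h.δ_pos n).ne' m.1 (y := m.2), hm]
    · congr 1
      congr 1; ext q
      rw [inner_jet]
      simp [regroup_apply]
  · intro m hm
    rw [hV0]
    · rfl
    · exact hm

end IsTwoScaleLimit

end Admissible

/-! ### The slow limit and the corrector as Sobolev functions -/

section Conclusion

variable {N : ℕ} {Ω YH : Set (Euc N)} {T : ℝ} {ε δ : ℕ → ℝ}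
  {f : ℕ → Euc N × ℝ → Jet N} {Z : (Euc N × ℝ × ℝ) × Euc N → Jet N}

theorem isWeakGradient_of_forall_inner {w : Euc N → ℝ} {g : Euc N → Euc N}
    (hw : MemLp w 2 (volume.restrict Ω)) (hg : MemLp g 2 (volume.restrict Ω))
    (H : ∀ φ e, IsTestFun Ω φ →
      ∫ x in Ω, inner ℝ (jet (inner ℝ (gradient φ x) e) (φ x • e)) (jet (w x) (g x)) = 0) :
    IsWeakGradient Ω w g := by
  refine ⟨locallyIntegrableOn_of_locallyIntegrable_restrict (hw.locallyIntegrable (by norm_num)),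
    locallyIntegrableOn_of_locallyIntegrable_restrict (hg.locallyIntegrable (by norm_num)),
    fun φ hφ => ?_⟩
  have hφ' : MemLp (gradient φ) 2 (volume.restrict Ω) :=
    (hφ.continuous_gradient.memLp_of_hasCompactSupport hφ.hasCompactSupport_gradient).restrict Ω
  have i1 : Integrable (fun x => w x • gradient φ x) (volume.restrict Ω) :=
    integrable_smul_of_memLp hw hφ'
  have i2 : Integrable (fun x => φ x • g x) (volume.restrict Ω) :=
    integrable_smul_of_memLp (IsTestFun.memLp hφ 2 Ω) hg
  refine ext_inner_left ℝ fun e => ?_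
  rw [inner_neg_right, ← integral_inner i1, ← integral_inner i2, ← add_eq_zero_iff_eq_neg,
    ← integral_add (i1.const_inner e) (i2.const_inner e)]
  refine Eq.trans ?_ (H φ e hφ)
  congr 1; ext x
  rw [inner_jet]
  simp only [jet_fst, jet_snd, inner_smul_right, inner_smul_left, conj_trivial,
    real_inner_comm e]
  ring

theorem memL2H1PerZeroMean_perExt (hc : IsCompact YH) {P : Type*} [MeasurableSpace P] {μ : Measure P} [SFinite μ] {w : P × Euc N → ℝ}
    {F : P × Euc N → Euc N} (hw : MemLp w 2 (μ.prod (volume.restrict (cellStar YH))))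
    (hF : MemLp F 2 (μ.prod (volume.restrict (cellStar YH))))
    (h : ∀ᵐ p ∂μ, ∀ τ ∈ meanZeroTests YH,
      ∫ y in cellStar YH, inner ℝ (τ y) (jet (w (p, y)) (F (p, y))) = 0) :
    MemL2H1PerZeroMean μ YH (fun p => perExt YH fun y => w (p, y))
      (fun p => perExt YH fun y => F (p, y)) := by
  have hY : MeasurableSet (cellStar YH) := (isOpen_cellStar hc).measurableSet
  have hmem : ∀ᵐ q ∂(μ.prod ((volume : Measure (Euc N)).restrict (cellStar YH))),
      q.2 ∈ cellStar YH :=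
    Measure.quasiMeasurePreserving_snd.ae (ae_restrict_mem hY)
  refine ⟨(memLp_congr_ae ?_).2 hw, (memLp_congr_ae ?_).2 hF,
    Eventually.of_forall fun p k y => perExt_periodic _ y k, ?_, ?_⟩
  · filter_upwards [hmem] with q hq using perExt_of_mem hq
  · filter_upwards [hmem] with q hq using perExt_of_mem hq
  · filter_upwards [h, ae_memLp_slice hw, ae_memLp_slice hF] with p hp h1 h2
    exact isWeakGradient_perExt hc h1 h2 fun τ hτ => hp τ (Or.inr hτ)
  · filter_upwards [h] with p hp
    rw [setIntegral_congr_fun hY fun y hy => perExt_of_mem hy]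
    have h1 := hp _ (Or.inl rfl)
    rwa [integral_inner_jet_one] at h1

/-- Products of test functions of `x`, of `t` and of `s`. -/
def domTests (Ω : Set (Euc N)) (T : ℝ) : Set (Euc N × ℝ × ℝ → ℝ) :=
  image2 (fun φ c p => φ p.1 • c p.2) {φ | IsTestFun Ω φ}
    (image2 (fun c₁ c₂ q => c₁ q.1 • c₂ q.2) {c | IsTestFun (Ioo 0 T) c} {c | IsPeriodicTime c})

theorem memLp_domTests : ∀ ψ ∈ domTests Ω T, MemLp ψ 2 (domMeasure Ω T) := by
  rintro _ ⟨φ, hφ, _, ⟨c₁, hc₁, c₂, hc₂, rfl⟩, rfl⟩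
  exact memLp_tensor (IsTestFun.memLp hφ 2 Ω)
    (memLp_tensor (IsTestFun.memLp hc₁ 2 (Ioo 0 T)) (IsPeriodicTime.memLp hc₂))

variable [IsFiniteMeasure ((volume : Measure (Euc N)).restrict Ω)]

/-- A distributional relation in `(x, t)`, tested with products, holds for almost every `t`. -/
theorem memL2H1_of_relation {u : Euc N × ℝ → ℝ} {G : Euc N × ℝ → Euc N}
    (hu : MemLp u 2 (slowMeasure Ω T)) (hG : MemLp G 2 (slowMeasure Ω T))
    (H : ∀ (φ : Euc N → ℝ) (c : ℝ → ℝ) (e : Euc N), IsTestFun Ω φ → IsTestFun (Ioo 0 T) c →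
        ∫ p, c p.2 * u p * inner ℝ (gradient φ p.1) e ∂(slowMeasure Ω T) +
          ∫ p, (φ p.1 • c p.2) * inner ℝ e (G p) ∂(slowMeasure Ω T) = 0) :
    MemL2H1 (volume.restrict (Ioo 0 T)) Ω (fun t x => u (x, t)) (fun t x => G (x, t)) := by
  have hu' := memLp_comp_swap hu
  have hG' := memLp_comp_swap hG
  refine ⟨hu', hG', ?_⟩
  have hsep : MeasureTheory.IsSeparable ((volume : Measure (Euc N)).restrict Ω) := inferInstance
  have m𝒯 : ∀ τ ∈ {τ : Euc N → Jet N | ∃ φ e, IsTestFun Ω φ ∧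
      τ = fun x => jet (inner ℝ (gradient φ x) e) (φ x • e)},
      MemLp τ 2 (volume.restrict Ω) := by
    rintro _ ⟨φ, e, hφ, rfl⟩
    refine memLp_jet ?_ ?_
    · have := (hφ.continuous_gradient.memLp_of_hasCompactSupport (p := 2) (μ := volume)
        hφ.hasCompactSupport_gradient).restrict Ω
      exact this.inner_const e
    · exact ((hφ.smooth.continuous.smul continuous_const).memLp_of_hasCompactSupport
        (hφ.compact.smul_right)).restrict Ω
  have hslice := ae_forall_integral_inner_slice_eq_zero
    (determining_testSpace (μ := (volume : Measure ℝ)) (U := Ioo (0 : ℝ) T) isOpen_Ioo)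
    (fun c hc => IsTestFun.memLp hc 2 (Ioo 0 T)) m𝒯 (memLp_jet hu' hG') (by
      rintro c hc _ ⟨φ, e, hφ, rfl⟩
      have hc' : IsTestFun (Ioo 0 T) c := hc
      rw [← integral_prod_swap]
      have hψ : MemLp (fun p : Euc N × ℝ => φ p.1 • c p.2) 2 (slowMeasure Ω T) :=
        memLp_slowTests _ ⟨φ, hφ, c, hc', rfl⟩
      have i1 : Integrable (fun p => c p.2 * u p * inner ℝ (gradient φ p.1) e)
          (slowMeasure Ω T) := by
        have h1 := ((memLp_mul_gradient hφ hc' hu).integrable (by norm_num)).inner_const (𝕜 := ℝ) e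
        simpa only [inner_smul_left, conj_trivial] using h1
      have i2 : Integrable (fun p => (φ p.1 • c p.2) * inner ℝ e (G p)) (slowMeasure Ω T) :=
        integrable_smul_of_memLp hψ (hG.const_inner e)
      refine Eq.trans ?_ (H φ c e hφ hc')
      rw [← integral_add i1 i2]
      congr 1; ext p
      rw [inner_jet]
      simp only [WithLp.smul_fst, WithLp.smul_snd, jet_fst, jet_snd, Prod.fst_swap, Prod.snd_swap,
        inner_smul_left, conj_trivial, smul_eq_mul, Prod.swap_swap]
      ring)
  filter_upwards [hslice, ae_memLp_slice hu', ae_memLp_slice hG'] with t ht h1 h2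
  exact isWeakGradient_of_forall_inner h1 h2 fun φ e hφ => ht.2 _ ⟨φ, e, hφ, rfl⟩

theorem determining_domTests (hΩ : IsOpen Ω) :
    Determining (domMeasure Ω T) (domTests Ω T) := by
  refine (determining_testSpace hΩ).prod ((determining_testSpace isOpen_Ioo).prod
    determining_periodicTime (fun _ h => IsTestFun.memLp h 2 _) fun _ h => h.memLp)
    (fun _ h => IsTestFun.memLp h 2 Ω) ?_
  rintro _ ⟨c₁, hc₁, c₂, hc₂, rfl⟩
  exact memLp_tensor (IsTestFun.memLp hc₁ 2 (Ioo 0 T)) (IsPeriodicTime.memLp hc₂)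

namespace IsTwoScaleLimit

/-- The limit of the gradients differs from the gradient of the slow limit by the gradient of a
periodic function: the difference is orthogonal to all solenoidal fields. -/
theorem exists_corrector (h : IsTwoScaleLimit Ω YH T ε δ f Z) (hΩ : IsOpen Ω)
    (hc : IsCompact YH) (hsub : YH ⊆ unitCell N) (hs : HasSmoothBoundary YH)
    (hconn : IsConnected (cellStar YH)) {u : Euc N × ℝ → ℝ} {G : Euc N × ℝ → Euc N}
    (hu : MemLp u 2 (slowMeasure Ω T)) (hG : MemLp G 2 (slowMeasure Ω T))
    (hZu : ∀ᵐ q ∂((slowMeasure Ω T).prod (fastMeasure YH)), (Z (regroup N q)).fst = u q.1)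
    (H : ∀ (φ : Euc N → ℝ) (c : ℝ → ℝ) (e : Euc N), IsTestFun Ω φ → IsTestFun (Ioo 0 T) c →
        ∫ p, c p.2 * u p * inner ℝ (gradient φ p.1) e ∂(slowMeasure Ω T) +
          ∫ p, (φ p.1 • c p.2) * inner ℝ e (G p) ∂(slowMeasure Ω T) = 0) :
    ∃ w : (Euc N × ℝ × ℝ) × Euc N → ℝ, MemL2H1PerZeroMean (domMeasure Ω T) YH
      (fun p => perExt YH fun y => w (p, y))
      (fun p => perExt YH fun y => (Z (p, y)).snd - G (p.1, p.2.1)) := by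
  have hmp := measurePreserving_regroup (Ω := Ω) (T := T) (YH := YH)
  have hZ : MemLp (fun m => (Z m).snd) 2
      ((domMeasure Ω T).prod (volume.restrict (cellStar YH))) :=
    memLp_jet_snd (h.memLp_lim.mono_measure (domMeasure_prod_le hc))
  have hG1 : MemLp (fun q : (Euc N × ℝ) × (ℝ × Euc N) => G q.1) 2
      ((slowMeasure Ω T).prod (fastMeasure YH)) := hG.comp_fst _
  have hG2 : MemLp (fun m : (Euc N × ℝ × ℝ) × Euc N => G (m.1.1, m.1.2.1)) 2
      ((domMeasure Ω T).prod (volume.restrict (cellStar YH))) :=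
    hG1.comp_measurePreserving hmp.symm
  have hF := hZ.sub hG2
  obtain ⟨w, hw, hwF⟩ := Perforated.exists_corrector hc hsub hs hconn
    (determining_domTests (T := T) hΩ) memLp_domTests hF (by
      rintro _ ⟨φ, hφ, _, ⟨c₁, hc₁, c₂, hc₂, rfl⟩, rfl⟩ θ hθ
      have hφ' : IsTestFun Ω φ := hφ
      have hc₁' : IsTestFun (Ioo 0 T) c₁ := hc₁
      have hc₂' : IsPeriodicTime c₂ := hc₂
      rw [← hmp.integral_comp']
      have hψ : MemLp (fun p : Euc N × ℝ => φ p.1 • c₁ p.2) 2 (slowMeasure Ω T) :=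
        memLp_slowTests _ ⟨φ, hφ, c₁, hc₁, rfl⟩
      have hσ : MemLp (fun w : ℝ × Euc N => c₂ w.1 • θ w.2) 2 (fastMeasure YH) :=
        memLp_tensor hc₂'.memLp hθ.memLp
      have hζ := memLp_jet_snd (h.memLp_regroup (T := T) hc)
      have i1 := integrable_inner_of_memLp (memLp_tensor hψ hσ) hζ
      have i2 := integrable_inner_of_memLp (memLp_tensor hψ hσ) hG1
      have e1 := h.integral_lim_snd hΩ hc hsub hu hZu hφ' hc₁' hc₂' hθ
      have e2 := H φ c₁ (∫ w, c₂ w.1 • θ w.2 ∂(fastMeasure YH)) hφ' hc₁'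
      have e3 : ∫ q, inner ℝ ((φ q.1.1 • c₁ q.1.2) • (c₂ q.2.1 • θ q.2.2)) (G q.1)
          ∂((slowMeasure Ω T).prod (fastMeasure YH)) = ∫ p, (φ p.1 • c₁ p.2) *
            inner ℝ (∫ w, c₂ w.1 • θ w.2 ∂(fastMeasure YH)) (G p) ∂(slowMeasure Ω T) := by
        rw [integral_inner_tensor_right hψ hσ hG1]
        congr 1; ext p
        rw [real_inner_comm, ← integral_inner (hσ.integrable (by norm_num))]
        simp_rw [real_inner_comm]
      refine Eq.trans (b := ∫ q, inner ℝ ((φ q.1.1 • c₁ q.1.2) • (c₂ q.2.1 • θ q.2.2))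
          (Z (regroup N q)).snd ∂((slowMeasure Ω T).prod (fastMeasure YH)) -
        ∫ q, inner ℝ ((φ q.1.1 • c₁ q.1.2) • (c₂ q.2.1 • θ q.2.2)) (G q.1)
          ∂((slowMeasure Ω T).prod (fastMeasure YH))) ?_ (by rw [e1, e3]; linarith)
      rw [← integral_sub i1 i2]
      congr 1; ext q
      simp only [regroup_apply, Pi.sub_apply, inner_sub_right, smul_smul, smul_eq_mul, mul_assoc])
  exact ⟨w, memL2H1PerZeroMean_perExt hc hw hF (hwF.mono fun p hp => hp.2)⟩

end IsTwoScaleLimit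

end Conclusion

/-! ### Passage to the limit in the statement -/

section Main

variable {N : ℕ} {Ω YH : Set (Euc N)} {T : ℝ}

theorem domMeasure_eq_restrict : domMeasure Ω T = volume.restrict (Ω ×ˢ Ioo 0 T ×ˢ Ioo 0 1) := by
  rw [domMeasure, unitIoo, Measure.prod_restrict, Measure.prod_restrict, ← Measure.volume_eq_prod,
    ← Measure.volume_eq_prod]

/-- The pairing of the gradient `g` with an oscillating admissible field, as an integral over the
whole space. -/
theorem integral_inner_jetExt_admissible {A : Set (Euc N)} (hA : IsOpen A) (hAΩ : A ⊆ Ω)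
    {u : ℝ → Euc N → ℝ} {g : ℝ → Euc N → Euc N}
    (h : MemL2H1 (volume.restrict (Ioo 0 T)) A u g)
    {v : Euc N × ℝ → (Euc N × ℝ) →ᵇ Euc N}
    (hv : MemLp v 2 (volume.restrict (Ω ×ˢ Ioo 0 T))) (a b : ℝ) :
    ∫ z, inner ℝ (jetExt A T u g z) (jet 0 ((Ω ×ˢ Ioo 0 T).indicator v z (a • z.1, z.2 / b))) =
      ∫ t in Ioo 0 T, ∫ x in A, inner ℝ (g t x) (v (x, t) (a • x, t / b)) := by
  have hm : MeasurableSet (A ×ˢ Ioo (0 : ℝ) T) := hA.measurableSet.prod measurableSet_Ioo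
  have hsub : A ×ˢ Ioo 0 T ⊆ Ω ×ˢ Ioo 0 T := prod_mono hAΩ Subset.rfl
  have h1 : MemLp v 2 (volume.restrict (A ×ˢ Ioo 0 T)) :=
    hv.mono_measure (Measure.restrict_mono hsub le_rfl)
  have h2 : AEStronglyMeasurable (fun z : Euc N × ℝ => v z (a • z.1, z.2 / b))
      (volume.restrict (A ×ˢ Ioo 0 T)) :=
    (continuous_eval (F := (Euc N × ℝ) →ᵇ Euc N)).comp_aestronglyMeasurable
      (h1.1.prodMk (by fun_prop : Continuous fun z : Euc N × ℝ =>
        (a • z.1, z.2 / b)).aestronglyMeasurable)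
  have h3 : MemLp (fun z : Euc N × ℝ => v z (a • z.1, z.2 / b)) 2
      (volume.restrict (A ×ˢ Ioo 0 T)) :=
    h1.mono h2 (Eventually.of_forall fun z => BoundedContinuousFunction.norm_coe_le_norm _ _)
  have h4 : MemLp (fun z : Euc N × ℝ => (Ω ×ˢ Ioo 0 T).indicator v z (a • z.1, z.2 / b)) 2
      (volume.restrict (A ×ˢ Ioo 0 T)) := by
    refine (memLp_congr_ae ?_).2 h3
    filter_upwards [ae_restrict_mem hm] with z hz
    rw [indicator_of_mem (hsub hz)]
  rw [integral_inner_jetExt hA h (memLp_jet MemLp.zero' h4)]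
  refine setIntegral_congr_fun measurableSet_Ioo fun t ht => ?_
  refine setIntegral_congr_fun hA.measurableSet fun x hx => ?_
  simp only [inner_jet, jet_fst, jet_snd, mul_zero, zero_add]
  rw [indicator_of_mem (show (x, t) ∈ Ω ×ˢ Ioo 0 T from ⟨hAΩ hx, ht⟩)]

theorem memLp_indicator_of_restrict {α F : Type*} [MeasurableSpace α] {μ : Measure α}
    [NormedAddCommGroup F] {S : Set α} (hS : MeasurableSet S) {v : α → F}
    (hv : MemLp v 2 (μ.restrict S)) :
    MemLp (S.indicator v) 2 μ :=
  (memLp_indicator_iff_restrict hS).2 hv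

/-- Fubini's theorem for the slow and the fast variables. -/
theorem integral_slow_fast [IsFiniteMeasure ((volume : Measure (Euc N)).restrict Ω)]
    {g : (Euc N × ℝ) × (ℝ × Euc N) → ℝ}
    (hg : Integrable g ((slowMeasure Ω T).prod (fastMeasure YH))) :
    ∫ q, g q ∂((slowMeasure Ω T).prod (fastMeasure YH)) =
      ∫ t in Ioo 0 T, ∫ x in Ω, ∫ s in Ioo (0 : ℝ) 1, ∫ y in cellStar YH, g ((x, t), (s, y)) := by
  have h1 : (fun p => ∫ w, g (p, w) ∂(fastMeasure YH)) =ᵐ[slowMeasure Ω T]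
      fun p => ∫ s in Ioo (0 : ℝ) 1, ∫ y in cellStar YH, g (p, (s, y)) := by
    filter_upwards [hg.prod_right_ae] with p hp using integral_prod _ hp
  rw [integral_prod _ hg, integral_congr_ae h1,
    integral_prod_symm _ (hg.integral_prod_left.congr h1)]

end Main

end Perforated

theorem theorem3 (N : ℕ) (hN : 2 ≤ N)
    (Ω : Set (Euc N)) (hΩ_open : IsOpen Ω) (hΩ_bdd : Bornology.IsBounded Ω)
    (hΩ_smooth : HasSmoothBoundary Ω)
    (YH : Set (Euc N)) (hYH_compact : IsCompact YH) (hYH_sub : YH ⊆ unitCell N)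
    (hYH_smooth : HasSmoothBoundary YH) (hYstar_conn : IsConnected (cellStar YH))
    (T : ℝ) (hT : 0 < T) (r : ℝ) (hr : 0 < r)
    (ε : ℕ → ℝ) (hε_pos : ∀ n, 0 < ε n) (hε_lim : Tendsto ε atTop (𝓝 0))
    (uε : ℕ → ℝ → Euc N → ℝ) (guε : ℕ → ℝ → Euc N → Euc N)
    -- each `uε n` lies in `L²(0,T;H¹(Ω_ε))`, with gradient `guε n`
    (huε : ∀ n, MemL2H1 (volume.restrict (Ioo 0 T)) (perforated Ω YH (ε n)) (uε n) (guε n))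
    -- boundedness in `L²(0,T;H¹(Ω_ε))`
    (hbdd : ∃ C : ℝ≥0, ∀ n,
      eLpNorm (Function.uncurry (uε n)) 2
        ((volume.restrict (Ioo 0 T)).prod (volume.restrict (perforated Ω YH (ε n)))) ≤ C ∧
      eLpNorm (Function.uncurry (guε n)) 2
        ((volume.restrict (Ioo 0 T)).prod (volume.restrict (perforated Ω YH (ε n)))) ≤ C)
    (hcond : ∀ (v₁ : Euc N → ℝ) (c₁ c₂ : ℝ → ℝ), IsTestFun Ω v₁ → IsTestFun (Ioo 0 T) c₁ →
      ContDiff ℝ ∞ c₂ → Function.Periodic c₂ 1 →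
      Tendsto (fun n => ε n ^ r * ∫ t in Ioo 0 T, ∫ x in perforated Ω YH (ε n),
        uε n t x * v₁ x * deriv (fun τ => c₁ τ * c₂ (τ / ε n ^ r)) t) atTop (𝓝 0)) :
    ∃ φ : ℕ → ℕ, StrictMono φ ∧
    ∃ (u : ℝ → Euc N → ℝ) (gu : ℝ → Euc N → Euc N)
      (u₁ : Euc N × ℝ × ℝ → Euc N → ℝ) (gu₁ : Euc N × ℝ × ℝ → Euc N → Euc N),
      -- `u ∈ L²(0,T;H¹(Ω))`, with gradient `gu`
      MemL2H1 (volume.restrict (Ioo 0 T)) Ω u gu ∧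
      -- `u₁ ∈ L²(Ω × (0,T) × (0,1); H¹_♯(Y*)/ℝ)` as a function of `(x,t,s)`, with `y`-gradient `gu₁`
      MemL2H1PerZeroMean (volume.restrict (Ω ×ˢ Ioo 0 T ×ˢ Ioo 0 1)) YH u₁ gu₁ ∧
      ∀ v : Euc N × ℝ → (Euc N × ℝ) →ᵇ Euc N, IsAdmissible Ω T v →
        Tendsto
          (fun j => ∫ t in Ioo 0 T, ∫ x in perforated Ω YH (ε (φ j)),
            inner ℝ (guε (φ j) t x) (v (x, t) ((ε (φ j))⁻¹ • x, t / ε (φ j) ^ r)))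
          atTop
          (𝓝 (∫ t in Ioo 0 T, ∫ x in Ω, ∫ s in Ioo (0 : ℝ) 1, ∫ y in cellStar YH,
            inner ℝ (gu t x + gu₁ (x, t, s) y) (v (x, t) (y, s)))) := by
  have : IsFiniteMeasure ((volume : Measure (Euc N)).restrict Ω) :=
    isFiniteMeasure_restrict.2 hΩ_bdd.measure_lt_top.ne
  obtain ⟨φ, hφ, Z, hZ⟩ := exists_isTwoScaleLimit hr hΩ_open hYH_compact hε_pos hε_lim huε hbdd hcond
  obtain ⟨u, hu, hZu⟩ :=
    hZ.exists_slow_limit hΩ_open hYH_compact hYH_sub hYH_smooth hYstar_conn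
  obtain ⟨G, hG, hGu⟩ := hZ.exists_slow_gradient hN hΩ_open hYH_compact hYH_sub hu hZu
  obtain ⟨w, hw⟩ := hZ.exists_corrector hΩ_open hYH_compact hYH_sub hYH_smooth hYstar_conn
    hu hG hZu hGu
  rw [domMeasure_eq_restrict] at hw
  refine ⟨φ, hφ, fun t x => u (x, t), fun t x => G (x, t), fun p => perExt YH fun y => w (p, y),
    fun p => perExt YH fun y => (Z (p, y)).snd - G (p.1, p.2.1),
    memL2H1_of_relation hu hG hGu, hw, fun v hv => ?_⟩
  have hΩT : MeasurableSet (Ω ×ˢ Ioo (0 : ℝ) T) := hΩ_open.measurableSet.prod measurableSet_Ioo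
  have hY : MeasurableSet (cellStar YH) := (isOpen_cellStar hYH_compact).measurableSet
  have hV : MemLp ((Ω ×ˢ Ioo 0 T).indicator v) 2 volume :=
    memLp_indicator_of_restrict hΩT hv.memLp
  have hlim := hZ.tendsto_admissible hΩ_open hYH_compact hYH_sub hV
    (fun z hz => indicator_of_notMem hz v) (by
      filter_upwards [(ae_restrict_iff' hΩT).1 hv.periodic] with z hz k m y s
      by_cases h : z ∈ Ω ×ˢ Ioo 0 T
      · rw [indicator_of_mem h, hz h]
      · rw [indicator_of_notMem h]; rfl)
  refine (hlim.congr fun n => ?_).trans_eq ?_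
  · exact integral_inner_jetExt_admissible (isOpen_perforated hΩ_open hYH_compact _)
      (perforated_subset _) (huε _) hv.memLp _ _
  · congr 1
    have hV2 : MemLp (fun q : (Euc N × ℝ) × (ℝ × Euc N) =>
        (Ω ×ˢ Ioo 0 T).indicator v q.1 (q.2.2, q.2.1)) 2
        ((slowMeasure Ω T).prod (fastMeasure YH)) :=
      ((memLp_eval hV measurePreserving_slow).1.mono_measure
        (domMeasure_prod_le hYH_compact)).comp_measurePreserving measurePreserving_regroup
    have hint := integrable_inner_of_memLp
      (memLp_jet_snd (hZ.memLp_regroup (T := T) hYH_compact)) hV2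
    rw [integral_slow_fast hint]
    refine setIntegral_congr_fun measurableSet_Ioo fun t ht => ?_
    refine setIntegral_congr_fun hΩ_open.measurableSet fun x hx => ?_
    refine integral_congr_ae (Eventually.of_forall fun s => ?_)
    refine setIntegral_congr_fun hY fun y hy => ?_
    simp only [regroup_apply]
    rw [indicator_of_mem (show (x, t) ∈ Ω ×ˢ Ioo 0 T from ⟨hx, ht⟩), perExt_of_mem hy,
      add_sub_cancel]
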